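/- \textbf{Notation.} Let $k$ be a positive even integer and $\kappa = k-\tfrac12$. For real $a$ and $w>0$ put $\Gamma(a,w)=\int_w^\infty e^{-t}t^{a-1}\,dt$; all complex powers are principal. For $\varphi:\mathbb{R}_+\to\mathbb{C}$ and $s\in\mathbb{C}$ put $\varphi_s(x)=\varphi(x)x^{s-1}$ and $(\mathcal{L}\varphi)(s)=\int_0^\infty e^{-st}\varphi(t)\,dt$. Let $S=\left(\begin{smallmatrix}0&-1\\1&0\end{smallmatrix}\right)$, let $\chi_\eta(\gamma)=\eta(\gamma\tau)/(\sqrt{c\tau+d}\,\eta(\tau))$ be the multiplier system of the Dedekind eta function, let $\rho_1$ be the Weil representation on $\mathbb{C}^2$ with $\rho_1(S)\mathbf{e}_l=\frac{1}{\sqrt{2i}}\sum_{l'=1}^{2}e^{-\pi i l l'}\mathbf{e}_{l'}$, and let $\rho_1'(S)=\chi_\eta(S)\rho_1(S)$. Put $$(\varphi|_{2-\kappa,\chi_\eta}S)(x)=x^{\kappa-2}\chi_\eta(S)\varphi(1/x).$$ Let $S_c(\mathbb{R}_+)$ be a set of compactly supported, piecewise smooth functions $\mathbb{R}_+\to\mathbb{C}$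 (the value at a break point being one of the two one-sided limits) such that for each $y>0$ some $\varphi\in S_c(\mathbb{R}_+)$ has $\varphi(y)\ne0$, and such that $\varphi_s\in S_c(\mathbb{R}_+)$ whenever $\varphi\in S_c(\mathbb{R}_+)$ and $s\in\mathbb{C}$ (for example, the set of all such functions). \textbf{Theorem.} Let $n_0\in\mathbb{N}$ and let $(c_f^+(n))_{n\ge -n_0}$ and $(c_f^-(n))_{n<0}$ be sequences of complex numbers, supported on $n\equiv 0,3 \pmod 4$, such that for some $C>0$ $$c_f^+(n),\ c_f^-(n)=O\left(e^{C\sqrt{|n|}}\right)\quad\text{as } |n|\to\infty .$$ For $\tau=u+iv\in\mathbb{H}$ set $$f(\tau)=\sum_{n\ge -n_0}c_f^+(n)e^{2\pi i n\tau}+\sum_{n<0}c_f^-(n)\,\Gamma\left(\tfrac32-k,-4\pi n v\right)e^{2\pi i n\tau}.$$ For $j=1,2$ let $c^\pm_{f,j}(n)=c^\pm_f(n)$ if $n\equiv -j^2\pmod 4$ and $c^\pm_{f,j}(n)=0$ otherwise, let $f_j$ be the series formed in the same way with $c^{\pm}_{f,j}$ in place of $c^\pm_f$ (so $f=f_1+f_2$),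 and let $F(\tau)=\sum_{j=1}^2 f_j(\tau/4)\,\mathbf{e}_j$. For $\varphi:\mathbb{R}_+\to\mathbb{C}$ piecewise smooth with compact support, define $$L_F(\varphi)=\sum_{j=1}^2\Big(\sum_{n\ge -n_0} c^+_{f,j}(n)(\mathcal{L}\varphi)\big(\tfrac{\pi n}{2}\big)+\sum_{n<0}c^-_{f,j}(n)(-\pi n)^{1-\kappa}\int_0^\infty\frac{(\mathcal{L}\varphi_{2-\kappa})\big(-\tfrac{\pi n}{2}(2t+1)\big)}{(1+t)^{\kappa}}\,dt\Big)\mathbf{e}_j$$ and, with $\delta_\kappa F=\tau\frac{\partial F}{\partial u}+\frac{\kappa}{2}F$, $$L_{\delta_\kappa F}(\varphi)=\tfrac{\kappa}{2}L_F(\varphi)-2\pi\sum_{j=1}^2\Big(\sum_{n\ge -n_0} c^+_{f,j}(n)\tfrac n4(\mathcal{L}\varphi_2)\big(\tfrac{\pi n}{2}\big)+\sum_{n<0}c^-_{f,j}(n)\tfrac n4(-\pi n)^{1-\kappa}\int_0^\infty\frac{(\mathcal{L}\varphi_{3-\kappa})\big(-\tfrac{\pi n}{2}(2t+1)\big)}{(1+t)^{\kappa}}\,dt\Big)\mathbf{e}_j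 .$$ Suppose that for each $\varphi\in S_c(\mathbb{R}_+)$ $$L_F(\varphi)=i^{k-\frac12}\,\overline{\rho_1'(S)}\,L_F(\varphi|_{2-\kappa,\chi_\eta}S)\quad\text{and}\quad L_{\delta_\kappa F}(\varphi)=-i^{k-\frac12}\,\overline{\rho_1'(S)}\,L_{\delta_\kappa F}(\varphi|_{2-\kappa,\chi_\eta}S).$$ Then $f$ is a harmonic weak Maass form in $H^+_{k-\frac12}$, that is: $f$ is real-analytic on $\mathbb{H}$; $f(\gamma\tau)=\left(\theta(\gamma\tau)/\theta(\tau)\right)^{2k-1}f(\tau)$ for all $\gamma\in\Gamma_0(4)$, where $\theta(\tau)=\sum_{n\in\mathbb{Z}}e^{2\pi i n^2\tau}$; $\Delta_\kappa f=0$, where $\Delta_\kappa=-4v^2\frac{\partial}{\partial\tau}\frac{\partial}{\partial\bar\tau}+2\kappa i v\frac{\partial}{\partial\bar\tau}$; for every $\gamma=\left(\begin{smallmatrix}a&b\\c&d\end{smallmatrix}\right)\in\mathrm{SL}_2(\mathbb{Z})$ the function $(c\tau+d)^{-\kappa}f(\gamma\tau)$ has, for some integer $h\ge1$, an absolutely convergent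 expansion $\sum_{n\gg-\infty}a(n)e^{2\pi i n\tau/h}+\sum_{n<0}b(n)\Gamma(1-\kappa,-4\pi n v/h)e^{2\pi i n\tau/h}$; and for $\gamma$ the identity there is such an expansion with $h=1$ whose coefficients are supported on $n\equiv0,3\pmod 4$. -/

import Mathlib

noncomputable section

namespace KohnenPlus

open Complex UpperHalfPlane MeasureTheory Filter
open scoped Real Topology MatrixGroups ContDiff

/-! ### Test functions -/

/-- `φ` is (the extension by zero to `ℝ` of) a complex-valued, compactly supported, piecewise
smooth function on the positive reals: near every `y > 0` it agrees on each side of `y` with a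
smooth function, and the value at `y` is one of the two one-sided limits. -/
structure IsTestFunction (φ : ℝ → ℂ) : Prop where
  support : ∃ c₁ c₂ : ℝ, 0 < c₁ ∧ ∀ x, φ x ≠ 0 → x ∈ Set.Icc c₁ c₂
  piecewise : ∀ y : ℝ, 0 < y → ∃ g h : ℝ → ℂ, ContDiff ℝ ∞ g ∧ ContDiff ℝ ∞ h ∧
    φ =ᶠ[𝓝[<] y] g ∧ φ =ᶠ[𝓝[>] y] h ∧ (φ y = g y ∨ φ y = h y)

/-- `φ_s(x) = φ(x) x^{s-1}`. -/
def twist (φ : ℝ → ℂ) (s : ℂ) : ℝ → ℂ := fun x => φ x * (x : ℂ) ^ (s - 1)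

/-- A set of test functions as used in the converse theorem: all members are compactly supported
and piecewise smooth, they do not all vanish at any point of the positive reals, and the set is
stable under `φ ↦ φ_s`. -/
structure IsTestFamily (S : Set (ℝ → ℂ)) : Prop where
  isTest : ∀ φ ∈ S, IsTestFunction φ
  nonvanishing : ∀ y : ℝ, 0 < y → ∃ φ ∈ S, φ y ≠ 0
  twist_mem : ∀ φ ∈ S, ∀ s : ℂ, twist φ s ∈ S

/-- The Laplace transform `(𝓛 φ)(s) = ∫_0^∞ e^{-st} φ(t) dt` at a real point `s`. -/
def laplace (φ : ℝ → ℂ) (s : ℝ) : ℂ := ∫ t in Set.Ioi (0 : ℝ), (Real.exp (-(s * t)) : ℂ) * φ t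

/-- `(φ|_w S)(x) = x^{-w} μ φ(1/x)` for `S = (0 -1; 1 0)`, where `μ` is the value at `S` of a
multiplier system. -/
def slashS (w : ℝ) (μ : ℂ) (φ : ℝ → ℂ) : ℝ → ℂ := fun x => ((x ^ (-w) : ℝ) : ℂ) * μ * φ (1 / x)

/-! ### The eta multiplier and the Weil representation -/

/-- The eta multiplier `χ_η(γ) = η(γτ) / (√(cτ+d) η(τ))`; the quotient does not depend on `τ`, and
is evaluated here at `τ = i`. -/
def chiEta (γ : SL(2, ℤ)) : ℂ :=
  ModularForm.eta ((γ • UpperHalfPlane.I : ℍ) : ℂ) /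
    ((((γ 1 0 : ℤ) : ℂ) * Complex.I + ((γ 1 1 : ℤ) : ℂ)) ^ (1 / 2 : ℂ) *
      ModularForm.eta Complex.I)

/-- The matrix of the Weil representation `ρ_1` at `S~ = (S, √τ)`:
`ρ_1(S~) e_l = (2i)^{-1/2} ∑_{l'=1}^{2} e^{-2πi l l'/2} e_{l'}`.
The basis vector `e_l`, `l = 1, 2`, has index `l - 1` in `Fin 2`. -/
def weilS : Matrix (Fin 2) (Fin 2) ℂ := Matrix.of fun l' l =>
  1 / (2 * Complex.I) ^ (1 / 2 : ℂ) *
    cexp (2 * π * Complex.I * (-((((l : ℕ) + 1) * ((l' : ℕ) + 1) : ℕ) : ℂ)) / 2)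

/-- The value at `S` of the representation `ρ'_1(γ) = χ_η(γ) ρ_1(γ~)` of `SL(2, ℤ)`. -/
def weilS' : Matrix (Fin 2) (Fin 2) ℂ := chiEta ModularGroup.S • weilS

/-- The entrywise complex conjugate of `ρ'_1(S)`. -/
def weilS'Conj : Matrix (Fin 2) (Fin 2) ℂ := weilS'.map (starRingEnd ℂ)

/-! ### Fourier series and `L`-series -/

/-- The upper incomplete gamma function `Γ(a, w) = ∫_w^∞ e^{-t} t^{a-1} dt`, for `w > 0`. -/
def incGamma (a w : ℝ) : ℝ := ∫ t in Set.Ioi w, Real.exp (-t) * t ^ (a - 1)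

/-- The `n`-th holomorphic term `e^{2πi n τ / h}` of an expansion of period `h`. -/
def holTerm (h : ℕ) (n : ℤ) (τ : ℍ) : ℂ := cexp (2 * π * Complex.I * ((n : ℂ) / h) * τ)

/-- The `n`-th non-holomorphic term `Γ(1 - κ, -4π n v / h) e^{2πi n τ / h}`, `v = Im τ`, of an
expansion of weight `κ` and period `h`. It is used for `n < 0`. -/
def nonholTerm (κ : ℝ) (h : ℕ) (n : ℤ) (τ : ℍ) : ℂ :=
  (incGamma (1 - κ) (-4 * π * ((n : ℝ) / h) * τ.im) : ℂ) * holTerm h n τ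

/-- The series `∑ c⁺(n) e^{2πi n τ} + ∑_{n<0} c⁻(n) Γ(3/2 - k, -4π n v) e^{2πi n τ}`; note that
`1 - (k - 1/2) = 3/2 - k`. -/
def plusSeries (k : ℕ) (cp cm : ℤ → ℂ) (τ : ℍ) : ℂ :=
  ∑' n : ℤ, cp n * holTerm 1 n τ + ∑' n : ℤ, cm n * nonholTerm ((k : ℝ) - 1 / 2) 1 n τ

/-- The coefficients `c_j(n)`, equal to `c(n)` if `n ≡ -j² mod 4` and to `0` otherwise, for
`j = 1, 2`; the number `j` has index `j - 1` in `Fin 2`. -/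
def component (c : ℤ → ℂ) (j : Fin 2) (n : ℤ) : ℂ :=
  if n ≡ -(((j : ℕ) : ℤ) + 1) ^ 2 [ZMOD 4] then c n else 0

/-- The `L`-series `L_F(φ)` of the vector-valued function `F(τ) = ∑_j f_j(τ/4) e_j` of weight `κ`,
where `f_j` has coefficients `c^±_j(n)`, so that `F_j` has the exponents `n/4`. -/
def LSeriesF (κ : ℝ) (cp cm : ℤ → ℂ) (φ : ℝ → ℂ) (j : Fin 2) : ℂ :=
  ∑' n : ℤ, component cp j n * laplace φ (2 * π * ((n : ℝ) / 4)) +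
  ∑' n : ℤ, component cm j n * (((-4 * π * ((n : ℝ) / 4)) ^ (1 - κ) : ℝ) : ℂ) *
    ∫ t in Set.Ioi (0 : ℝ),
      laplace (twist φ ((2 - κ : ℝ) : ℂ)) (-2 * π * ((n : ℝ) / 4) * (2 * t + 1)) /
        (((1 + t) ^ κ : ℝ) : ℂ)

/-- The `L`-series `L_{δ_κ F}(φ)` of `δ_κ F = τ ∂F/∂u + (κ/2) F`. -/
def LSeriesDeltaF (κ : ℝ) (cp cm : ℤ → ℂ) (φ : ℝ → ℂ) (j : Fin 2) : ℂ :=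
  ((κ / 2 : ℝ) : ℂ) * LSeriesF κ cp cm φ j -
  2 * π * ∑' n : ℤ, component cp j n * ((n : ℂ) / 4) *
    laplace (twist φ 2) (2 * π * ((n : ℝ) / 4)) -
  2 * π * ∑' n : ℤ, component cm j n * ((n : ℂ) / 4) *
    (((-4 * π * ((n : ℝ) / 4)) ^ (1 - κ) : ℝ) : ℂ) *
    ∫ t in Set.Ioi (0 : ℝ),
      laplace (twist φ ((3 - κ : ℝ) : ℂ)) (-2 * π * ((n : ℝ) / 4) * (2 * t + 1)) /
        (((1 + t) ^ κ : ℝ) : ℂ)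

/-! ### Harmonic weak Maass forms in the plus space -/

/-- `∂/∂τ = (∂/∂u - i ∂/∂v) / 2`. -/
def dTau (g : ℂ → ℂ) (z : ℂ) : ℂ := (fderiv ℝ g z 1 - Complex.I * fderiv ℝ g z Complex.I) / 2

/-- `∂/∂τ̄ = (∂/∂u + i ∂/∂v) / 2`. -/
def dTauBar (g : ℂ → ℂ) (z : ℂ) : ℂ := (fderiv ℝ g z 1 + Complex.I * fderiv ℝ g z Complex.I) / 2

/-- The weight `κ` hyperbolic Laplacian `-4 v² ∂/∂τ ∂/∂τ̄ + 2 κ i v ∂/∂τ̄`. -/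
def hypLaplacian (κ : ℝ) (g : ℂ → ℂ) (z : ℂ) : ℂ :=
  -4 * (z.im : ℂ) ^ 2 * dTau (dTauBar g) z + 2 * κ * Complex.I * z.im * dTauBar g z

/-- `g` has an absolutely convergent expansion
`∑_{n ≫ -∞} a(n) e^{2πi n τ/h} + ∑_{n<0} b(n) Γ(1-κ, -4π n v/h) e^{2πi n τ/h}`. -/
structure HasHarmonicExpansion (κ : ℝ) (h : ℕ) (a b : ℤ → ℂ) (g : ℍ → ℂ) : Prop where
  bounded_below : ∃ N : ℤ, ∀ n < N, a n = 0
  negative : ∀ n : ℤ, 0 ≤ n → b n = 0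
  summable_hol : ∀ τ : ℍ, Summable fun n : ℤ => a n * holTerm h n τ
  summable_nonhol : ∀ τ : ℍ, Summable fun n : ℤ => b n * nonholTerm κ h n τ
  eq_tsum : ∀ τ : ℍ, g τ = ∑' n : ℤ, a n * holTerm h n τ + ∑' n : ℤ, b n * nonholTerm κ h n τ

/-- `f` belongs to `H^+_{k-1/2}`, `k` even: it is a harmonic weak Maass form of weight `k - 1/2` on
`Γ_0(4)` whose Fourier coefficients are supported on `n ≡ 0, 3 mod 4`.
With the theta function `θ(τ) = ∑_n e^{2πi n² τ}`, which has no zeros on `ℍ`, modularity reads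
`f(γτ) = (θ(γτ)/θ(τ))^{2k-1} f(τ)`, here with the denominator cleared. -/
structure IsHarmonicMaassPlus (k : ℕ) (f : ℍ → ℂ) : Prop where
  analytic : AnalyticOnNhd ℝ (f ∘ UpperHalfPlane.ofComplex) {z : ℂ | 0 < z.im}
  modular : ∀ γ : SL(2, ℤ), γ ∈ CongruenceSubgroup.Gamma0 4 → ∀ τ : ℍ,
    f (γ • τ) * jacobiTheta (2 * τ) ^ (2 * k - 1) =
      jacobiTheta (2 * ((γ • τ : ℍ) : ℂ)) ^ (2 * k - 1) * f τ
  harmonic : ∀ z : ℂ, 0 < z.im →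
    hypLaplacian ((k : ℝ) - 1 / 2) (f ∘ UpperHalfPlane.ofComplex) z = 0
  /-- expansion at `∞`, with the plus space condition -/
  plus : ∃ a b : ℤ → ℂ, HasHarmonicExpansion ((k : ℝ) - 1 / 2) 1 a b f ∧
    ∀ n : ℤ, (a n ≠ 0 ∨ b n ≠ 0) → n ≡ 0 [ZMOD 4] ∨ n ≡ 3 [ZMOD 4]
  /-- expansion at every cusp `γ∞` -/
  cusps : ∀ γ : SL(2, ℤ), ∃ (h : ℕ) (a b : ℤ → ℂ), 0 < h ∧
    HasHarmonicExpansion ((k : ℝ) - 1 / 2) h a b fun τ : ℍ =>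
      (((γ 1 0 : ℤ) : ℂ) * τ + ((γ 1 1 : ℤ) : ℂ)) ^ (-((k : ℂ) - 1 / 2)) * f (γ • τ)

end KohnenPlus

end

noncomputable section

namespace KohnenPlus

open Complex MeasureTheory Filter
open scoped UpperHalfPlane Real Topology MatrixGroups ContDiff ComplexConjugate

/-! Write κ = k - 1/2 and let F = (F_0, F_1) be the vector of the series `vecF`, with exponents n/4,
so that f(τ) = F_0(4τ) + F_1(4τ). Interchanging sum and integral shows that the L-series are
integrals along the imaginary axis: L_F(φ) = ∫ φ(x) F(ix) dx, and L_{δF}(φ) is the same integral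
with δ_κ F in place of F (`LSeriesF_eq`, `LSeriesDeltaF_eq`). After x ↦ 1/x the functional equations
say that every φ in the family annihilates F(iy) - c y^{-κ} M F(i/y), with M = `signMatrix`, and the
analogous expression for δ_κ F with the opposite sign. The family is stable under multiplication by
x^n, so Weierstrass approximation makes both identities hold at every y > 0 (`IsTestFamily.eq_zero`,
`IsTestFamily.axis_relation`).

Together they say that F and its transform under S have the same values and the same u-derivatives
on the imaginary axis. This determines a harmonic function of the kind considered. The difference G
satisfies ∂G/∂τ̄ = v^{-κ} conj(H) with H holomorphic; on the axis both partial derivatives of G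
vanish, hence H = 0 there and so everywhere; then G is holomorphic and zero on the axis, hence zero
(`eq_zero_of_cauchy_data`, `IsHarm.eq_slash`). The phases χ_η(S) cancel, and c² = 1/2 because k is
even; nothing else about c is needed (`exists_const`, `vecF_transform`).

The congruence conditions on n give the behaviour of F under T. The group Γ_0(4) is generated by T,
-1 and S T^{-4} S^{-1}, and on these generators f is compared directly with θ^{2k-1}
(`Gamma0_four_le`, `TransformsWeil.modular`). For the cusps, every element of SL(2, ℤ) acts on F by
a matrix times an automorphy factor, and 4γτ is rewritten as A applied to an affine function of τ,
with A in SL(2, ℤ) (`TransformsWeil.exists_matrix`, `exists_upper_triangular`).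

The analytic input is that the nonholomorphic part is v^{1-κ} times a series that is jointly
holomorphic when u and v are regarded as independent complex variables. This gives real analyticity
and allows termwise differentiation (`analyticAt_nonholSeries`, `hasWirt_nonholSeries`). -/

/-! ### Wirtinger calculus and unique continuation from the imaginary axis -/

/-- `g` is real differentiable at `z` with `∂g/∂τ = A` and `∂g/∂τ̄ = B`. -/
def HasWirt (g : ℂ → ℂ) (A B z : ℂ) : Prop :=
  HasFDerivAt g (A • (1 : ℂ →L[ℝ] ℂ) + B • (conjCLE : ℂ →L[ℝ] ℂ)) z

lemma HasWirt.fderiv_apply {g : ℂ → ℂ} {A B z : ℂ} (h : HasWirt g A B z) (w : ℂ) :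
    fderiv ℝ g z w = A * w + B * conj w := by
  rw [HasFDerivAt.fderiv h]
  simp

lemma HasWirt.dTau_eq {g : ℂ → ℂ} {A B z : ℂ} (h : HasWirt g A B z) : dTau g z = A := by
  simp only [dTau, h.fderiv_apply, conj_I, map_one]
  linear_combination (-(A - B) / 2) * Complex.I_sq

lemma HasWirt.dTauBar_eq {g : ℂ → ℂ} {A B z : ℂ} (h : HasWirt g A B z) : dTauBar g z = B := by
  simp only [dTauBar, h.fderiv_apply, conj_I, map_one]
  linear_combination ((A - B) / 2) * Complex.I_sq

lemma hasWirt_of_fderiv {g : ℂ → ℂ} {L : ℂ →L[ℝ] ℂ} {A B z : ℂ} (h : HasFDerivAt g L z)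
    (h1 : L 1 = A + B) (hI : L I = I * (A - B)) : HasWirt g A B z := by
  have : L = A • (1 : ℂ →L[ℝ] ℂ) + B • (conjCLE : ℂ →L[ℝ] ℂ) := by
    ext1 w
    have hw : w = w.re • (1 : ℂ) + w.im • I := by simp [re_add_im]
    have hc : conj w = w.re - w.im * I := by
      apply Complex.ext <;> simp
    have hr : L w = w.re * (A + B) + w.im * (I * (A - B)) := by
      conv_lhs => rw [hw, map_add, map_smul, map_smul, h1, hI]
      simp only [real_smul]
    rw [hr]
    simp only [add_apply, smul_apply,
      one_apply_eq_self, smul_eq_mul, ContinuousLinearEquiv.coe_coe, conjCLE_apply, hc]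
    linear_combination A * re_add_im w
  rw [HasWirt, ← this]
  exact h

lemma HasWirt.congr {g g' : ℂ → ℂ} {A B z : ℂ} (h : HasWirt g A B z) (hg : g' =ᶠ[𝓝 z] g) :
    HasWirt g' A B z := HasFDerivAt.congr_of_eventuallyEq h hg

lemma hasWirt_of_hasDerivAt {g : ℂ → ℂ} {A z : ℂ} (h : HasDerivAt g A z) : HasWirt g A 0 z := by
  exact hasWirt_of_fderiv h.complexToReal_fderiv (by simp) (by simp; ring)

lemma hasWirt_conj {g : ℂ → ℂ} {A z : ℂ} (h : HasDerivAt g A z) :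
    HasWirt (fun w => conj (g w)) 0 (conj A) z := by
  have h2 := conjCLE.hasFDerivAt.comp z h.complexToReal_fderiv
  refine hasWirt_of_fderiv h2 (by simp) (by simp; ring)

lemma HasWirt.add {g g' : ℂ → ℂ} {A B A' B' z : ℂ} (h : HasWirt g A B z)
    (h' : HasWirt g' A' B' z) : HasWirt (fun w => g w + g' w) (A + A') (B + B') z := by
  refine hasWirt_of_fderiv (HasFDerivAt.add h h') (by simp; ring) (by simp; ring)

lemma HasWirt.mul {g g' : ℂ → ℂ} {A B A' B' z : ℂ} (h : HasWirt g A B z)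
    (h' : HasWirt g' A' B' z) :
    HasWirt (fun w => g w * g' w) (A * g' z + g z * A') (B * g' z + g z * B') z := by
  refine hasWirt_of_fderiv (HasFDerivAt.mul h h') (by simp; ring) (by simp; ring)

lemma HasWirt.const_mul {g : ℂ → ℂ} {A B z : ℂ} (h : HasWirt g A B z) (c : ℂ) :
    HasWirt (fun w => c * g w) (c * A) (c * B) z := by
  simpa using (hasWirt_of_hasDerivAt (hasDerivAt_const z c)).mul h

lemma HasWirt.comp {g p : ℂ → ℂ} {A B p' z : ℂ} (h : HasWirt g A B (p z))
    (hp : HasDerivAt p p' z) :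
    HasWirt (fun w => g (p w)) (A * p') (B * conj p') z := by
  refine hasWirt_of_fderiv (HasFDerivAt.comp z h hp.complexToReal_fderiv) (by simp)
    (by simp; ring)

lemma hasWirt_im_rpow (s : ℝ) {z : ℂ} (hz : 0 < z.im) :
    HasWirt (fun w => ((w.im ^ s : ℝ) : ℂ)) (-I / 2 * (s * z.im ^ (s - 1) : ℝ))
      (I / 2 * (s * z.im ^ (s - 1) : ℝ)) z := by
  have h1 : HasFDerivAt (fun w : ℂ => w.im ^ s) _ z :=
    imCLM.hasFDerivAt.rpow_const (p := s) (Or.inl (by simpa using hz.ne'))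
  refine hasWirt_of_fderiv (ofRealCLM.hasFDerivAt.comp z h1) ?_ ?_
  · simp; ring
  · simp; linear_combination (s * (z.im ^ (s - 1) : ℝ) : ℂ) * I_sq

lemma isOpen_im_pos : IsOpen {z : ℂ | 0 < z.im} := isOpen_lt continuous_const continuous_im

lemma isPreconnected_im_pos : IsPreconnected {z : ℂ | 0 < z.im} :=
  (convex_halfSpace_im_gt 0).isPreconnected

/-- Functions with `∂g/∂τ̄ = v^{-κ} \overline{h}`, `h` holomorphic, are harmonic of weight `κ`. -/
lemma hypLaplacian_eq_zero {κ : ℝ} {g h : ℂ → ℂ} (hh : DifferentiableOn ℂ h {z | 0 < z.im})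
    (hg : ∀ z : ℂ, 0 < z.im → ∃ A, HasWirt g A (((z.im ^ (-κ) : ℝ) : ℂ) * conj (h z)) z)
    {z : ℂ} (hz : 0 < z.im) : hypLaplacian κ g z = 0 := by
  have hB : ∀ w : ℂ, 0 < w.im → dTauBar g w = ((w.im ^ (-κ) : ℝ) : ℂ) * conj (h w) := by
    intro w hw
    obtain ⟨A, hA⟩ := hg w hw
    exact hA.dTauBar_eq
  have hd : HasDerivAt h (deriv h z) z :=
    ((hh z hz).differentiableAt (isOpen_im_pos.mem_nhds hz)).hasDerivAt
  -- Since ∂/∂τ annihilates the antiholomorphic factor, only v^{-κ} is differentiated; the result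
  -- cancels the first-order term of the Laplacian.
  have h1 := ((hasWirt_im_rpow (-κ) hz).mul (hasWirt_conj hd)).congr
    (g' := dTauBar g) (by filter_upwards [isOpen_im_pos.mem_nhds hz] with w hw using hB w hw)
  rw [hypLaplacian, h1.dTau_eq, hB z hz]
  have : z.im ^ (-κ) = z.im ^ (-κ - 1) * z.im := by
    rw [Real.rpow_sub_one hz.ne']; field_simp
  rw [this]
  push_cast
  ring

/-- A harmonic function whose Cauchy data vanish on the imaginary axis is zero. -/
lemma eq_zero_of_cauchy_data {κ : ℝ} {g h : ℂ → ℂ} (hh : DifferentiableOn ℂ h {z | 0 < z.im})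
    (hg : ∀ z : ℂ, 0 < z.im → ∃ A, HasWirt g A (((z.im ^ (-κ) : ℝ) : ℂ) * conj (h z)) z)
    (h0 : ∀ y : ℝ, 0 < y → g (y * I) = 0)
    (h1 : ∀ y : ℝ, 0 < y → fderiv ℝ g (y * I) 1 = 0) {z : ℂ} (hz : 0 < z.im) : g z = 0 := by
  -- Identity theorem: the axis accumulates at i. It is applied first to `h` and then to `g`.
  have key : ∀ φ : ℂ → ℂ, DifferentiableOn ℂ φ {z | 0 < z.im} →
      (∀ y : ℝ, 0 < y → φ (y * I) = 0) → ∀ w : ℂ, 0 < w.im → φ w = 0 := by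
    intro φ hφ hφ0 w hw
    have hI : (I : ℂ) ∈ {z : ℂ | 0 < z.im} := by simp
    refine AnalyticOnNhd.eqOn_of_preconnected_of_frequently_eq (f := φ) (g := fun _ => 0)
      (hφ.analyticOnNhd isOpen_im_pos) (fun _ _ => analyticAt_const) isPreconnected_im_pos hI ?_ hw
    have ht : Tendsto (fun y : ℝ => (y : ℂ) * I) (𝓝[≠] 1) (𝓝[≠] I) := by
      refine tendsto_nhdsWithin_iff.mpr ⟨?_, ?_⟩
      · have : Continuous fun y : ℝ => (y : ℂ) * I := by fun_prop
        simpa using (this.tendsto 1).mono_left nhdsWithin_le_nhds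
      · filter_upwards [self_mem_nhdsWithin] with y hy h
        apply hy
        have h' : (y : ℂ) * I = I := h
        have := congrArg im h'
        simpa using this
    refine ht.frequently (Eventually.frequently ?_)
    filter_upwards [nhdsWithin_le_nhds (lt_mem_nhds (one_pos : (0 : ℝ) < 1))] with y hy
    exact hφ0 y hy
  -- On the axis the u-derivative is A + B and the v-derivative is I (A - B), where B = v^{-κ}
  -- conj(h). Both vanish, the second because g is zero along the axis, so B = 0.
  have hh0 : ∀ w : ℂ, 0 < w.im → h w = 0 := by
    refine key h hh fun y hy => ?_
    have hyI : 0 < ((y : ℂ) * I).im := by simpa using hy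
    obtain ⟨A, hA⟩ := hg _ hyI
    have e1 : A + ((((y : ℂ) * I).im ^ (-κ) : ℝ) : ℂ) * conj (h (y * I)) = 0 := by
      have := h1 y hy
      rw [hA.fderiv_apply] at this
      simpa using this
    have e2 : fderiv ℝ g (y * I) I = 0 := by
      have hc : HasDerivAt (fun t : ℝ => (t : ℂ) * I) I y := by
        simpa using (ofRealCLM.hasDerivAt (x := y)).mul_const I
      have hgd : HasFDerivAt g (fderiv ℝ g (y * I)) (y * I) :=
        (HasFDerivAt.differentiableAt hA).hasFDerivAt
      have h2 := HasFDerivAt.comp_hasDerivAt (f := fun t : ℝ => (t : ℂ) * I) y hgd hc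
      have h3 : HasDerivAt (g ∘ fun t : ℝ => (t : ℂ) * I) 0 y := by
        refine (hasDerivAt_const y (0 : ℂ)).congr_of_eventuallyEq ?_
        filter_upwards [lt_mem_nhds hy] with t ht using h0 t ht
      exact h2.unique h3
    rw [hA.fderiv_apply] at e2
    have hne : ((((y : ℂ) * I).im ^ (-κ) : ℝ) : ℂ) ≠ 0 := by
      exact_mod_cast (Real.rpow_pos_of_pos hyI _).ne'
    have e3 : A - ((((y : ℂ) * I).im ^ (-κ) : ℝ) : ℂ) * conj (h (y * I)) = 0 := by
      have : I * (A - ((((y : ℂ) * I).im ^ (-κ) : ℝ) : ℂ) * conj (h (y * I))) = 0 := by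
        rw [← e2, conj_I]; ring
      simpa using this
    have e4 : ((((y : ℂ) * I).im ^ (-κ) : ℝ) : ℂ) * conj (h (y * I)) = 0 := by
      linear_combination (e1 - e3) / 2
    simpa using (mul_eq_zero.mp e4).resolve_left hne
  refine key g (fun w hw => ?_) h0 z hz
  obtain ⟨A, hA⟩ := hg w hw
  rw [hh0 w hw] at hA
  have : HasFDerivAt g (A • (1 : ℂ →L[ℝ] ℂ)) w := by
    convert! (show HasFDerivAt g _ w from hA) using 1
    ext1 w; simp
  have h5 : HasFDerivAt g (A • (1 : ℂ →L[ℂ] ℂ)) w := by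
    refine hasFDerivAt_of_restrictScalars ℝ this ?_
    ext1; simp
  exact h5.differentiableAt.differentiableWithinAt

/-! ### Joint analyticity of series in two variables -/

/-- A series of products of holomorphic functions of two separate variables is analytic. -/
lemma analyticAt_tsum_mul {x y : ℤ → ℂ → ℂ} {U V : Set ℂ} (hU : IsOpen U) (hV : IsOpen V)
    {bx by' : ℤ → ℝ} (hbx : Summable bx) (hby : Summable by')
    (hx : ∀ n, DifferentiableOn ℂ (x n) U) (hy : ∀ n, DifferentiableOn ℂ (y n) V)
    (hxb : ∀ n, ∀ w ∈ U, ‖x n w‖ ≤ bx n) (hyb : ∀ n, ∀ w ∈ V, ‖y n w‖ ≤ by' n)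
    {p : ℂ × ℂ} (hp1 : p.1 ∈ U) (hp2 : p.2 ∈ V) :
    AnalyticAt ℂ (fun q : ℂ × ℂ => ∑' n, x n q.1 * y n q.2) p := by
  -- The vectors δ_n and the evaluations ev_n are biorthogonal and of norm at most 1. So the series
  -- is the pairing of Y = ∑ y_n ev_n with X = ∑ x_n δ_n, each a Banach-valued holomorphic function
  -- of one variable, and joint analyticity follows from that of the bounded bilinear pairing.
  let δ : ℤ → BoundedContinuousFunction ℤ ℂ := fun n => BoundedContinuousFunction.ofNormedAddCommGroupDiscrete
    (Pi.single n (1 : ℂ)) 1 (fun m => by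
      by_cases h : m = n
      · subst h; simp
      · simp [h])
  have hδ : ∀ n, ‖δ n‖ ≤ 1 := fun n =>
    BoundedContinuousFunction.norm_ofNormedAddCommGroup_le _ zero_le_one _
  let ev : ℤ → (BoundedContinuousFunction ℤ ℂ →L[ℂ] ℂ) := fun n => BoundedContinuousFunction.evalCLM ℂ n
  have hev : ∀ n, ‖ev n‖ ≤ 1 := fun n => ContinuousLinearMap.opNorm_le_bound _ zero_le_one
    fun f => by rw [one_mul]; exact f.norm_coe_le_norm n
  have hXb : ∀ n, ∀ w ∈ U, ‖x n w • δ n‖ ≤ bx n := fun n w hw => by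
    rw [norm_smul]
    exact (mul_le_of_le_one_right (norm_nonneg _) (hδ n)).trans (hxb n w hw)
  have hYb : ∀ n, ∀ w ∈ V, ‖y n w • ev n‖ ≤ by' n := fun n w hw => by
    rw [norm_smul]
    exact (mul_le_of_le_one_right (norm_nonneg _) (hev n)).trans (hyb n w hw)
  have hX : DifferentiableOn ℂ (fun w => ∑' n, x n w • δ n) U :=
    Complex.differentiableOn_tsum_of_summable_norm hbx (fun n => (hx n).smul_const _) hU hXb
  have hY : DifferentiableOn ℂ (fun w => ∑' n, y n w • ev n) V :=
    Complex.differentiableOn_tsum_of_summable_norm (F := fun n w => y n w • ev n) hby (fun n => (hy n).smul_const _) hV hYb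
  have hXa : AnalyticAt ℂ (fun q : ℂ × ℂ => ∑' n, x n q.1 • δ n) p :=
    AnalyticAt.fun_comp (g := fun w => ∑' n, x n w • δ n) (hX.analyticAt (hU.mem_nhds hp1)) analyticAt_fst
  have hYa : AnalyticAt ℂ (fun q : ℂ × ℂ => ∑' n, y n q.2 • ev n) p :=
    AnalyticAt.fun_comp (g := fun w => ∑' n, y n w • ev n) (hY.analyticAt (hV.mem_nhds hp2)) analyticAt_snd
  have hprod := AnalyticAt.fun_comp
    (ContinuousLinearMap.analyticAt_bilinear (ContinuousLinearMap.id ℂ (BoundedContinuousFunction ℤ ℂ →L[ℂ] ℂ)) _)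
    (hYa.prod hXa)
  refine hprod.congr ?_
  have hmem : U ×ˢ V ∈ 𝓝 p := prod_mem_nhds (hU.mem_nhds hp1) (hV.mem_nhds hp2)
  filter_upwards [hmem] with q hq
  have sX : Summable fun n => x n q.1 • δ n :=
    Summable.of_norm_bounded hbx fun n => hXb n _ hq.1
  have sY : Summable fun n => y n q.2 • ev n :=
    Summable.of_norm_bounded hby fun n => hYb n _ hq.2
  have hevX : ∀ n, ev n (∑' m, x m q.1 • δ m) = x n q.1 := by
    intro n
    rw [(ev n).map_tsum sX, tsum_eq_single n]
    · simp [ev, δ]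
    · intro m hm
      simp [ev, δ, hm.symm]
  have := (ContinuousLinearMap.apply ℂ ℂ (∑' m, x m q.1 • δ m)).map_tsum sY
  simp only [ContinuousLinearMap.apply_apply] at this
  simp only [ContinuousLinearMap.id_apply]
  rw [this]
  refine tsum_congr fun n => ?_
  rw [smul_apply, hevX, smul_eq_mul, mul_comm]

/-! ### The incomplete gamma function -/

/-- The Laplace transform `∫_0^∞ e^{-wt} (1+t)^{-κ} dt`. -/
def lapKer (κ : ℝ) (w : ℂ) : ℂ :=
  ∫ t in Set.Ioi (0 : ℝ), cexp (-(w * t)) * (((1 + t) ^ (-κ) : ℝ) : ℂ)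

lemma norm_one_add_rpow_le {κ : ℝ} (hκ : 0 ≤ κ) {t : ℝ} (ht : 0 < t) :
    ‖(((1 + t) ^ (-κ) : ℝ) : ℂ)‖ ≤ 1 := by
  rw [norm_real, Real.norm_of_nonneg (Real.rpow_nonneg (by linarith) _)]
  exact Real.rpow_le_one_of_one_le_of_nonpos (by linarith) (by linarith)

lemma norm_cexp_neg_mul (w : ℂ) (t : ℝ) : ‖cexp (-(w * t))‖ = Real.exp (-w.re * t) := by
  rw [norm_exp]; simp

lemma norm_lapKer_integrand_le {κ : ℝ} (hκ : 0 ≤ κ) (w : ℂ) {t : ℝ} (ht : 0 < t) :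
    ‖cexp (-(w * t)) * (((1 + t) ^ (-κ) : ℝ) : ℂ)‖ ≤ Real.exp (-w.re * t) := by
  rw [norm_mul, norm_cexp_neg_mul]
  exact mul_le_of_le_one_right (Real.exp_pos _).le (norm_one_add_rpow_le hκ ht)

lemma aestronglyMeasurable_lapKer_integrand (κ : ℝ) (w : ℂ) :
    AEStronglyMeasurable (fun t : ℝ => cexp (-(w * t)) * (((1 + t) ^ (-κ) : ℝ) : ℂ))
      (volume.restrict (Set.Ioi 0)) := by
  refine ContinuousOn.aestronglyMeasurable ?_ measurableSet_Ioi
  refine ContinuousOn.mul (by fun_prop) ?_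
  refine continuous_ofReal.comp_continuousOn ?_
  refine ContinuousOn.rpow_const (by fun_prop) fun t ht => Or.inl ?_
  have : (0 : ℝ) < t := ht
  positivity

lemma integrableOn_lapKer_integrand {κ : ℝ} (hκ : 0 ≤ κ) {w : ℂ} (hw : 0 < w.re) :
    IntegrableOn (fun t : ℝ => cexp (-(w * t)) * (((1 + t) ^ (-κ) : ℝ) : ℂ)) (Set.Ioi 0) := by
  refine Integrable.mono' (integrableOn_exp_mul_Ioi (neg_lt_zero.mpr hw) 0)
    (aestronglyMeasurable_lapKer_integrand κ w) ?_
  filter_upwards [ae_restrict_mem measurableSet_Ioi] with t ht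
  exact norm_lapKer_integrand_le hκ w ht

lemma norm_lapKer_le {κ : ℝ} (hκ : 0 ≤ κ) {w : ℂ} (hw : 0 < w.re) :
    ‖lapKer κ w‖ ≤ 1 / w.re := by
  have h := norm_integral_le_of_norm_le (μ := volume.restrict (Set.Ioi 0))
    (f := fun t : ℝ => cexp (-(w * t)) * (((1 + t) ^ (-κ) : ℝ) : ℂ))
    (integrableOn_exp_mul_Ioi (neg_lt_zero.mpr hw) 0) (by
      filter_upwards [ae_restrict_mem measurableSet_Ioi] with t ht
      exact norm_lapKer_integrand_le hκ w ht)
  rw [integral_exp_mul_Ioi (neg_lt_zero.mpr hw)] at h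
  simpa [lapKer, neg_div_neg_eq] using h

lemma differentiableOn_lapKer {κ : ℝ} (hκ : 0 ≤ κ) :
    DifferentiableOn ℂ (lapKer κ) {w | 0 < w.re} := by
  intro w hw
  have hw : 0 < w.re := hw
  set r := w.re / 2 with hr
  have hr0 : 0 < r := by positivity
  have hs : {z : ℂ | r < z.re} ∈ 𝓝 w :=
    (isOpen_lt continuous_const continuous_re).mem_nhds (by simp [hr]; linarith)
  have hbi : IntegrableOn (fun t : ℝ => t ^ (1 : ℝ) * Real.exp (-r * t ^ (1 : ℝ))) (Set.Ioi 0) :=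
    integrableOn_rpow_mul_exp_neg_mul_rpow (by norm_num) one_pos hr0
  have h := hasDerivAt_integral_of_dominated_loc_of_deriv_le (μ := volume.restrict (Set.Ioi 0))
    (F := fun (z : ℂ) (t : ℝ) => cexp (-(z * t)) * (((1 + t) ^ (-κ) : ℝ) : ℂ))
    (F' := fun (z : ℂ) (t : ℝ) => -(t : ℂ) * (cexp (-(z * t)) * (((1 + t) ^ (-κ) : ℝ) : ℂ)))
    (bound := fun t : ℝ => t ^ (1 : ℝ) * Real.exp (-r * t ^ (1 : ℝ))) hs
    (Eventually.of_forall fun z => aestronglyMeasurable_lapKer_integrand κ z)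
    (integrableOn_lapKer_integrand hκ hw)
    (AEStronglyMeasurable.mul (by fun_prop) (aestronglyMeasurable_lapKer_integrand κ w))
    (by
      filter_upwards [ae_restrict_mem measurableSet_Ioi] with t ht z hz
      have ht : 0 < t := ht
      have hz : r < z.re := hz
      rw [norm_mul, norm_neg, norm_real, Real.norm_of_nonneg ht.le, Real.rpow_one]
      refine mul_le_mul_of_nonneg_left ((norm_lapKer_integrand_le hκ z ht).trans ?_) ht.le
      exact Real.exp_le_exp.mpr (by nlinarith))
    hbi
    (by
      filter_upwards with t z hz
      have h1 : HasDerivAt (fun z : ℂ => -(z * t)) (-(t : ℂ)) z := by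
        simpa using ((hasDerivAt_id z).mul_const (t : ℂ)).fun_neg
      convert! (h1.cexp.mul_const (((1 + t) ^ (-κ) : ℝ) : ℂ)) using 1
      ring)
  exact h.2.differentiableAt.differentiableWithinAt

/-- Substitute w(1 + t) for the integration variable. The factor `lapKer` extends holomorphically to
Re w > 0, which allows v to be made complex. -/
lemma incGamma_eq_lapKer (κ : ℝ) {w : ℝ} (hw : 0 < w) :
    (incGamma (1 - κ) w : ℂ) = ((w ^ (1 - κ) : ℝ) : ℂ) * cexp (-w) * lapKer κ w := by
  have h1 : incGamma (1 - κ) w =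
      ∫ t in Set.Ioi (0 : ℝ), w ^ (1 - κ) * Real.exp (-w) *
        (Real.exp (-(w * t)) * (1 + t) ^ (-κ)) := by
    have e1 := integral_comp_mul_left_Ioi (fun t => Real.exp (-t) * t ^ (1 - κ - 1)) 1 hw
    have e2 := (measurePreserving_add_right volume (1 : ℝ)).setIntegral_preimage_emb
      (measurableEmbedding_addRight 1)
      (fun x => Real.exp (-(w * x)) * (w * x) ^ (1 - κ - 1)) (Set.Ioi 1)
    rw [mul_one] at e1
    have e3 : incGamma (1 - κ) w = w * ∫ x in Set.Ioi (1 : ℝ),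
        Real.exp (-(w * x)) * (w * x) ^ (1 - κ - 1) := by
      rw [e1, incGamma, smul_eq_mul, ← mul_assoc, mul_inv_cancel₀ hw.ne', one_mul]
    rw [e3, ← e2, Set.preimage_add_const_Ioi, sub_self, ← integral_const_mul]
    refine setIntegral_congr_fun measurableSet_Ioi fun t ht => ?_
    have ht : 0 < t := ht
    rw [Real.mul_rpow hw.le (by linarith), show -(w * (t + 1)) = -w + -(w * t) by ring,
      Real.exp_add, show w ^ (1 - κ) = w * w ^ (1 - κ - 1) by
        rw [Real.rpow_sub_one hw.ne']; field_simp, show 1 - κ - 1 = -κ by ring, add_comm t 1]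
    ring
  rw [h1, ← integral_complex_ofReal, lapKer, ← integral_const_mul]
  refine setIntegral_congr_fun measurableSet_Ioi fun t _ => ?_
  push_cast
  ring

lemma hasDerivAt_incGamma (a : ℝ) {w : ℝ} (hw : 0 < w) :
    HasDerivAt (incGamma a) (-(Real.exp (-w) * w ^ (a - 1))) w := by
  set f : ℝ → ℝ := fun t => Real.exp (-t) * t ^ (a - 1) with hf
  have hcont : ContinuousOn f (Set.Ioi 0) := by
    refine ContinuousOn.mul (by fun_prop) (ContinuousOn.rpow_const continuousOn_id ?_)
    exact fun x hx => Or.inl (ne_of_gt hx)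
  have hint : ∀ x, 0 < x → IntegrableOn f (Set.Ioi x) := by
    intro x hx
    refine integrable_of_isBigO_exp_neg (b := 1 / 2) (by norm_num)
      (hcont.mono fun y hy => lt_of_lt_of_le hx hy) ?_
    have h := isLittleO_exp_neg_mul_rpow_atTop (a := 1 / 2) (by norm_num) (-(a - 1))
    -- Half of the exponential absorbs the power of x.
    have h2 : f =O[atTop] fun x => Real.exp (-(1 / 2 : ℝ) * x) := by
      have h3 : ∀ᶠ x : ℝ in atTop, f x = Real.exp (-(1 / 2 : ℝ) * x) *
          (Real.exp (-(1 / 2 : ℝ) * x) * x ^ (a - 1)) := by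
        filter_upwards with x
        rw [← mul_assoc, ← Real.exp_add, hf]
        ring_nf
      refine (Asymptotics.IsBigO.congr' ?_ (h3.mono fun _ h => h.symm) EventuallyEq.rfl)
      have h4 : (fun x : ℝ => Real.exp (-(1 / 2 : ℝ) * x) * x ^ (a - 1)) =O[atTop]
          fun _ => (1 : ℝ) := by
        have := (h.isBigO.mul (Asymptotics.isBigO_refl (fun x : ℝ => x ^ (a - 1)) atTop))
        refine this.trans (Asymptotics.IsBigO.of_bound 1 ?_)
        filter_upwards [eventually_gt_atTop 0] with x hx
        rw [← Real.rpow_add hx]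
        simp
      simpa using (Asymptotics.isBigO_refl (fun x : ℝ => Real.exp (-(1 / 2 : ℝ) * x)) atTop).mul h4
    exact h2
  have hd : HasDerivAt (fun x => ∫ t in w..x, f t) (f w) w := by
    refine intervalIntegral.integral_hasDerivAt_right (by simp) ?_
      (hcont.continuousAt (Ioi_mem_nhds hw))
    exact hcont.stronglyMeasurableAtFilter isOpen_Ioi w hw
  have h2 := (hasDerivAt_const w (incGamma a w)).sub hd
  rw [zero_sub] at h2
  refine h2.congr_of_eventuallyEq ?_
  filter_upwards [Ioi_mem_nhds hw] with x hx
  have := intervalIntegral.integral_interval_add_Ioi (hint w hw) (hint x hx)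
  simp only [Pi.sub_apply, incGamma]
  rw [← this]
  ring

/-! ### Growth of coefficients -/

/-- Sequences of subexponential growth. -/
def SubExp (c : ℤ → ℂ) : Prop :=
  ∀ ε : ℝ, 0 < ε → ∃ M : ℝ, 0 ≤ M ∧ ∀ n : ℤ, ‖c n‖ ≤ M * Real.exp (ε * |(n : ℝ)|)

/-- By completing the square, C s ≤ ε s² + C²/(4ε), applied to s = √|n|. The comparison function has
no zeros, so the bound holds for every n and not only off a finite set. -/
lemma subExp_of_isBigO {c : ℤ → ℂ} {C : ℝ}
    (h : c =O[cofinite] fun n : ℤ => Real.exp (C * Real.sqrt |(n : ℝ)|)) : SubExp c := by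
  intro ε hε
  rw [Asymptotics.isBigO_cofinite_iff (fun n hn => absurd hn (Real.exp_pos _).ne')] at h
  obtain ⟨D, hD⟩ := h
  have hD0 : 0 ≤ D := by
    have := (norm_nonneg _).trans (hD 0)
    simpa using this
  refine ⟨D * Real.exp (C ^ 2 / (4 * ε)), by positivity, fun n => (hD n).trans ?_⟩
  rw [Real.norm_of_nonneg (Real.exp_pos _).le, mul_assoc, ← Real.exp_add]
  refine mul_le_mul_of_nonneg_left (Real.exp_le_exp.mpr ?_) hD0
  set s := Real.sqrt |(n : ℝ)|
  have hs : s ^ 2 = |(n : ℝ)| := Real.sq_sqrt (abs_nonneg _)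
  rw [← hs, ← sub_nonneg]
  have : C ^ 2 / (4 * ε) + ε * s ^ 2 - C * s = (C - 2 * ε * s) ^ 2 / (4 * ε) := by
    field_simp; ring
  rw [this]
  positivity

lemma subExp_of_norm_le {c : ℤ → ℂ} {D : ℝ} (h : ∀ n, ‖c n‖ ≤ D) : SubExp c := by
  intro ε hε
  refine ⟨D, (norm_nonneg _).trans (h 0), fun n => (h n).trans ?_⟩
  exact le_mul_of_one_le_right ((norm_nonneg _).trans (h 0))
    (Real.one_le_exp (by positivity))

lemma SubExp.mul {c d : ℤ → ℂ} (hc : SubExp c) (hd : SubExp d) :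
    SubExp fun n => c n * d n := by
  intro ε hε
  obtain ⟨M, hM, hM'⟩ := hc (ε / 2) (by positivity)
  obtain ⟨N, hN, hN'⟩ := hd (ε / 2) (by positivity)
  refine ⟨M * N, by positivity, fun n => ?_⟩
  rw [norm_mul]
  refine (mul_le_mul (hM' n) (hN' n) (norm_nonneg _) (by positivity)).trans (le_of_eq ?_)
  rw [show ε * |(n : ℝ)| = ε / 2 * |(n : ℝ)| + ε / 2 * |(n : ℝ)| by ring, Real.exp_add]
  ring

lemma SubExp.mono {c d : ℤ → ℂ} (hc : SubExp c) (h : ∀ n, ‖d n‖ ≤ ‖c n‖) : SubExp d := by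
  intro ε hε
  obtain ⟨M, hM, hM'⟩ := hc ε hε
  exact ⟨M, hM, fun n => (h n).trans (hM' n)⟩

lemma subExp_intCast : SubExp fun n => (n : ℂ) := by
  intro ε hε
  refine ⟨1 / ε, by positivity, fun n => ?_⟩
  have h := Real.add_one_le_exp (ε * |(n : ℝ)|)
  rw [norm_intCast, div_mul_eq_mul_div, one_mul, le_div_iff₀ hε]
  linarith

lemma SubExp.comp_neg {c : ℤ → ℂ} (hc : SubExp c) : SubExp fun n => c (-n) := by
  intro ε hε
  obtain ⟨M, hM, hM'⟩ := hc ε hε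
  exact ⟨M, hM, fun n => by simpa using hM' (-n)⟩

lemma summable_exp_neg_abs {δ : ℝ} (hδ : 0 < δ) :
    Summable fun n : ℤ => Real.exp (-(δ * |(n : ℝ)|)) := by
  have h : Summable fun n : ℕ => Real.exp (-(δ * (n : ℝ))) := by
    have := Real.summable_exp_nat_mul_iff.mpr (neg_lt_zero.mpr hδ)
    refine this.congr fun n => ?_
    ring_nf
  refine Summable.of_nat_of_neg (h.congr fun n => ?_) (h.congr fun n => ?_) <;> simp

/-- The coefficients of the series under consideration: the holomorphic part has finitely many
terms of negative index, the nonholomorphic part has only such terms, and the growth is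
subexponential. -/
structure IsCoeff (a b : ℤ → ℂ) : Prop where
  lower : ∃ N : ℤ, ∀ n < N, a n = 0
  neg : ∀ n : ℤ, 0 ≤ n → b n = 0
  subExp_left : SubExp a
  subExp_right : SubExp b

lemma IsCoeff.mul {a b d : ℤ → ℂ} (h : IsCoeff a b) (hd : SubExp d) :
    IsCoeff (fun n => a n * d n) (fun n => b n * d n) where
  lower := by
    obtain ⟨N, hN⟩ := h.lower
    exact ⟨N, fun n hn => by simp [hN n hn]⟩
  neg := fun n hn => by simp [h.neg n hn]
  subExp_left := h.subExp_left.mul hd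
  subExp_right := h.subExp_right.mul hd

/-! ### Bounds for the terms -/

/-- `e^{2πi n z / h}` -/
def expTerm (h : ℕ) (n : ℤ) (z : ℂ) : ℂ := cexp (2 * π * I * ((n : ℂ) / h) * z)

lemma norm_expTerm (h : ℕ) (n : ℤ) (z : ℂ) :
    ‖expTerm h n z‖ = Real.exp (-(2 * π * ((n : ℝ) / h) * z.im)) := by
  rw [expTerm, norm_exp]
  congr 1
  have : (2 * π * I * ((n : ℂ) / h) * z) = ((2 * π * ((n : ℝ) / h) : ℝ) : ℂ) * (I * z) := by
    push_cast; ring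
  rw [this, re_ofReal_mul]
  simp

lemma hasDerivAt_expTerm (h : ℕ) (n : ℤ) (z : ℂ) :
    HasDerivAt (expTerm h n) (2 * π * I * ((n : ℂ) / h) * expTerm h n z) z := by
  have h1 : HasDerivAt (fun z : ℂ => 2 * π * I * ((n : ℂ) / h) * z)
      (2 * π * I * ((n : ℂ) / h)) z := by
    simpa using (hasDerivAt_id z).const_mul (2 * π * I * ((n : ℂ) / h))
  rw [mul_comm]
  exact h1.cexp

/-- On a horizontal strip the exponential decays like e^{-2δ|n|}; half of this pays for the
coefficients. The finitely many negative indices cost only a constant depending on N and v₁. -/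
lemma holomorphic_bound {a : ℤ → ℂ} (ha : ∃ N : ℤ, ∀ n < N, a n = 0) (hs : SubExp a) {h : ℕ}
    (hh : 0 < h) {v₀ v₁ : ℝ} (hv₀ : 0 < v₀) : ∃ B : ℤ → ℝ, Summable B ∧
      ∀ n, ∀ z : ℂ, v₀ ≤ z.im → z.im ≤ v₁ → ‖a n * expTerm h n z‖ ≤ B n := by
  obtain ⟨N, hN⟩ := ha
  have hh' : (0 : ℝ) < h := by exact_mod_cast hh
  have hπ := Real.pi_pos
  set δ : ℝ := π * v₀ / h with hδ
  have hδ0 : 0 < δ := by positivity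
  obtain ⟨M, hM, hM'⟩ := hs δ hδ0
  refine ⟨fun n => M * Real.exp (4 * π * |(N : ℝ)| * |v₁| / h) * Real.exp (-(δ * |(n : ℝ)|)),
    (summable_exp_neg_abs hδ0).mul_left _, fun n z h0 h1 => ?_⟩
  rcases lt_or_ge n N with hn | hn
  · rw [hN n hn]
    simp only [zero_mul, norm_zero]
    positivity
  beta_reduce
  rw [norm_mul, norm_expTerm, mul_assoc M, ← Real.exp_add]
  refine (mul_le_mul_of_nonneg_right (hM' n) (Real.exp_pos _).le).trans ?_
  rw [mul_assoc, ← Real.exp_add]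
  refine mul_le_mul_of_nonneg_left (Real.exp_le_exp.mpr ?_) hM
  have hv1 : 0 < v₁ := hv₀.trans_le (h0.trans h1)
  rw [abs_of_pos hv1]
  have key : 2 * v₀ * |(n : ℝ)| ≤ 2 * (n : ℝ) * z.im + 4 * |(N : ℝ)| * v₁ := by
    rcases le_or_gt 0 n with h2 | h2
    · have h3 : (0 : ℝ) ≤ n := by exact_mod_cast h2
      rw [abs_of_nonneg h3]
      have : (n : ℝ) * v₀ ≤ n * z.im := mul_le_mul_of_nonneg_left h0 h3
      have : 0 ≤ |(N : ℝ)| * v₁ := by positivity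
      linarith
    · have h3 : (n : ℝ) < 0 := by exact_mod_cast h2
      have h4 : (N : ℝ) ≤ n := by exact_mod_cast hn
      have h5 : |(n : ℝ)| ≤ |(N : ℝ)| := by
        rw [abs_of_neg h3, abs_of_neg (h4.trans_lt h3)]; linarith
      have h6 : |(n : ℝ)| * z.im ≤ |(N : ℝ)| * v₁ :=
        mul_le_mul h5 h1 (hv₀.le.trans h0) (abs_nonneg _)
      have h7 : |(n : ℝ)| * v₀ ≤ |(N : ℝ)| * v₁ :=
        mul_le_mul h5 (h0.trans h1) hv₀.le (abs_nonneg _)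
      have h8 : (n : ℝ) = -|(n : ℝ)| := by rw [abs_of_neg h3]; ring
      have h9 : 2 * (n : ℝ) * z.im = -2 * (|(n : ℝ)| * z.im) := by
        conv_lhs => rw [h8]
        ring
      linarith
  have : δ * |(n : ℝ)| + δ * |(n : ℝ)| ≤
      2 * π * ((n : ℝ) / h) * z.im + 4 * π * |(N : ℝ)| * v₁ / h := by
    have e1 : δ * |(n : ℝ)| + δ * |(n : ℝ)| = π / h * (2 * v₀ * |(n : ℝ)|) := by
      rw [hδ]; ring
    have e2 : 2 * π * ((n : ℝ) / h) * z.im + 4 * π * |(N : ℝ)| * v₁ / h =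
      π / h * (2 * (n : ℝ) * z.im + 4 * |(N : ℝ)| * v₁) := by ring
    rw [e1, e2]
    exact mul_le_mul_of_nonneg_left key (by positivity)
  linarith

lemma summable_hol {a : ℤ → ℂ} (ha : ∃ N : ℤ, ∀ n < N, a n = 0) (hs : SubExp a) {h : ℕ}
    (hh : 0 < h) {z : ℂ} (hz : 0 < z.im) : Summable fun n => a n * expTerm h n z := by
  obtain ⟨B, hB, hB'⟩ := holomorphic_bound ha hs hh (v₁ := z.im) hz
  exact Summable.of_norm_bounded hB fun n => hB' n z le_rfl le_rfl

/-- The holomorphic part `∑ a(n) e^{2πi n z / h}`. -/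
def holSeries (h : ℕ) (a : ℤ → ℂ) (z : ℂ) : ℂ := ∑' n : ℤ, a n * expTerm h n z

lemma hasDerivAt_holSeries {a : ℤ → ℂ} (ha : ∃ N : ℤ, ∀ n < N, a n = 0) (hs : SubExp a) {h : ℕ}
    (hh : 0 < h) {z : ℂ} (hz : 0 < z.im) :
    HasDerivAt (holSeries h a) (2 * π * I * holSeries h (fun n => a n * ((n : ℂ) / h)) z) z := by
  obtain ⟨B, hB, hB'⟩ := holomorphic_bound ha hs hh (v₀ := z.im / 2) (v₁ := 2 * z.im) (by linarith)
  set U : Set ℂ := {w | z.im / 2 < w.im} ∩ {w | w.im < 2 * z.im} with hU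
  have hUo : IsOpen U :=
    (isOpen_lt continuous_const continuous_im).inter (isOpen_lt continuous_im continuous_const)
  have hzU : z ∈ U := ⟨by simp; linarith, by simp; linarith⟩
  have hd : ∀ n, Differentiable ℂ fun w => a n * expTerm h n w := fun n w =>
    (hasDerivAt_expTerm h n w).differentiableAt.const_mul _
  have hb : ∀ n, ∀ w ∈ U, ‖a n * expTerm h n w‖ ≤ B n := fun n w hw =>
    hB' n w hw.1.le hw.2.le
  have h1 := Complex.differentiableOn_tsum_of_summable_norm hB
    (fun n => (hd n).differentiableOn) hUo hb
  have h2 := Complex.hasSum_deriv_of_summable_norm hB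
    (fun n => (hd n).differentiableOn) hUo hb hzU
  have h3 := ((h1 z hzU).differentiableAt (hUo.mem_nhds hzU)).hasDerivAt
  convert! h3 using 1
  rw [← h2.tsum_eq, holSeries, ← tsum_mul_left]
  refine tsum_congr fun n => ?_
  rw [((hasDerivAt_expTerm h n z).const_mul (a n)).deriv]
  ring

/-- The `n`-th term of the nonholomorphic part, up to the factor `v^{1-κ}`, as a function of two
independent complex variables. -/
def nonholKer (κ : ℝ) (h : ℕ) (n : ℤ) (v u : ℂ) : ℂ :=
  (((-4 * π * ((n : ℝ) / h)) ^ (1 - κ) : ℝ) : ℂ) * lapKer κ ((-4 * π * ((n : ℝ) / h) : ℝ) * v) *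
    cexp ((2 * π * ((n : ℝ) / h) : ℝ) * (v + I * u))

lemma neg_freq_pos {h : ℕ} (hh : 0 < h) {n : ℤ} (hn : n < 0) : 0 < -4 * π * ((n : ℝ) / h) := by
  have h1 : (n : ℝ) < 0 := by exact_mod_cast hn
  have h2 : (0 : ℝ) < h := by exact_mod_cast hh
  have := div_neg_of_neg_of_pos h1 h2
  have := Real.pi_pos
  nlinarith

/-- As 1 - κ ≤ 0, the power is largest at n = -1. -/
lemma freq_rpow_le {κ : ℝ} (hκ : 1 ≤ κ) {h : ℕ} (hh : 0 < h) {n : ℤ} (hn : n < 0) :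
    ‖(((-4 * π * ((n : ℝ) / h)) ^ (1 - κ) : ℝ) : ℂ)‖ ≤ (4 * π / h) ^ (1 - κ) := by
  have h1 : (n : ℝ) ≤ -1 := by exact_mod_cast (by omega : n ≤ -1)
  have h2 : (0 : ℝ) < h := by exact_mod_cast hh
  have hπ := Real.pi_pos
  rw [norm_real, Real.norm_of_nonneg (Real.rpow_nonneg (neg_freq_pos hh hn).le _)]
  refine Real.rpow_le_rpow_of_nonpos (by positivity) ?_ (by linarith)
  have e : -4 * π * ((n : ℝ) / h) = 4 * π / h * (-n) := by ring
  rw [e]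
  exact le_mul_of_one_le_right (by positivity) (by linarith)

/-- In this region Re(v + iu) ≥ r/2, so the exponential contributes e^{-2δ|n|}, while the two other
factors are bounded uniformly in n < 0. Half of the decay absorbs the coefficients. Allowing |Im u|
≤ r/2 leaves room for complex u. -/
lemma nonholKer_bound {κ : ℝ} (hκ : 1 ≤ κ) {b : ℤ → ℂ} (hb : ∀ n : ℤ, 0 ≤ n → b n = 0)
    (hs : SubExp b) {h : ℕ} (hh : 0 < h) {r : ℝ} (hr : 0 < r) : ∃ B : ℤ → ℝ, Summable B ∧
      ∀ n, ∀ v u : ℂ, r ≤ v.re → |u.im| ≤ r / 2 → ‖b n * nonholKer κ h n v u‖ ≤ B n := by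
  have hh' : (0 : ℝ) < h := by exact_mod_cast hh
  have hπ := Real.pi_pos
  set δ : ℝ := π * r / (2 * h) with hδ
  have hδ0 : 0 < δ := by positivity
  obtain ⟨M, hM, hM'⟩ := hs δ hδ0
  set D : ℝ := (4 * π / h) ^ (1 - κ) * (1 / (4 * π / h * r)) with hD
  have hD0 : 0 ≤ D := by positivity
  refine ⟨fun n => M * D * Real.exp (-(δ * |(n : ℝ)|)),
    (summable_exp_neg_abs hδ0).mul_left _, fun n v u hv hu => ?_⟩
  rcases le_or_gt 0 n with hn | hn
  · rw [hb n hn]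
    simp only [zero_mul, norm_zero]
    positivity
  have hn1 : (n : ℝ) ≤ -1 := by exact_mod_cast (by omega : n ≤ -1)
  have hn0 : (n : ℝ) < 0 := by linarith
  have hf := neg_freq_pos hh hn
  have hv0 : 0 < v.re := hr.trans_le hv
  have hre : (((-4 * π * ((n : ℝ) / h) : ℝ) : ℂ) * v).re = -4 * π * ((n : ℝ) / h) * v.re :=
    re_ofReal_mul _ _
  have h1 : ‖lapKer κ ((-4 * π * ((n : ℝ) / h) : ℝ) * v)‖ ≤ 1 / (4 * π / h * r) := by
    refine (norm_lapKer_le (by linarith) (by rw [hre]; positivity)).trans ?_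
    rw [hre]
    refine one_div_le_one_div_of_le (by positivity) ?_
    have e : -4 * π * ((n : ℝ) / h) = 4 * π / h * (-n) := by ring
    rw [e]
    refine mul_le_mul ?_ hv hr.le (mul_nonneg (by positivity) (by linarith))
    exact le_mul_of_one_le_right (by positivity) (by linarith)
  have h2 : ‖cexp ((2 * π * ((n : ℝ) / h) : ℝ) * (v + I * u))‖ ≤
      Real.exp (-(2 * δ * |(n : ℝ)|)) := by
    rw [norm_exp, re_ofReal_mul]
    refine Real.exp_le_exp.mpr ?_
    have e1 : (v + I * u).re = v.re - u.im := by simp [sub_eq_add_neg]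
    have h3 : r / 2 ≤ v.re - u.im := by
      have := (abs_le.mp hu).2
      linarith
    rw [e1, abs_of_neg hn0, hδ]
    have e2 : 2 * π * ((n : ℝ) / h) * (v.re - u.im) = -(2 * π / h * (-n) * (v.re - u.im)) := by
      ring
    have e3 : 2 * (π * r / (2 * h)) * -(n : ℝ) = 2 * π / h * (-n) * (r / 2) := by ring
    rw [e2, e3]
    exact neg_le_neg (mul_le_mul_of_nonneg_left h3 (mul_nonneg (by positivity) (by linarith)))
  have h4 : ‖nonholKer κ h n v u‖ ≤ D * Real.exp (-(2 * δ * |(n : ℝ)|)) := by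
    rw [nonholKer, norm_mul, norm_mul]
    refine mul_le_mul (mul_le_mul (freq_rpow_le hκ hh hn) h1 (norm_nonneg _) (by positivity)) h2
      (norm_nonneg _) hD0
  rw [norm_mul]
  refine (mul_le_mul (hM' n) h4 (norm_nonneg _) (by positivity)).trans (le_of_eq ?_)
  have e : Real.exp (-(δ * |(n : ℝ)|)) =
      Real.exp (δ * |(n : ℝ)|) * Real.exp (-(2 * δ * |(n : ℝ)|)) := by
    rw [← Real.exp_add]; ring_nf
  beta_reduce
  rw [e]
  ring

lemma differentiableOn_nonholKer_left {κ : ℝ} (hκ : 0 ≤ κ) {h : ℕ} (hh : 0 < h) {n : ℤ}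
    (hn : n < 0) (u : ℂ) :
    DifferentiableOn ℂ (fun v => nonholKer κ h n v u) {v | 0 < v.re} := by
  have h1 : DifferentiableOn ℂ (fun v : ℂ => lapKer κ ((-4 * π * ((n : ℝ) / h) : ℝ) * v))
      {v | 0 < v.re} := by
    refine (differentiableOn_lapKer hκ).comp (by fun_prop) fun v hv => ?_
    have hv : 0 < v.re := hv
    simp only [Set.mem_ofPred_eq]
    rw [re_ofReal_mul]
    exact mul_pos (neg_freq_pos hh hn) hv
  exact (h1.const_mul _).mul (by fun_prop)

/-- The exponential separates the variables: the kernel at (v, u) is the kernel at (v, iδ) times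
e^{2πi n(u - iδ)/h}. The shift by iδ divides the decay between the two factors, so that each is
summable by itself for n < 0. -/
lemma analyticAt_tsum_nonholKer {κ : ℝ} (hκ : 1 ≤ κ) {b : ℤ → ℂ}
    (hb : ∀ n : ℤ, 0 ≤ n → b n = 0) (hs : SubExp b) {h : ℕ} (hh : 0 < h) {p : ℂ × ℂ}
    (hp1 : 0 < p.1.re) (hp2 : p.2.im = 0) :
    AnalyticAt ℂ (fun q : ℂ × ℂ => ∑' n, b n * nonholKer κ h n q.1 q.2) p := by
  set r := p.1.re / 2 with hr
  have hr0 : 0 < r := by positivity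
  have hπ := Real.pi_pos
  have hh' : (0 : ℝ) < h := by exact_mod_cast hh
  obtain ⟨B, hB, hB'⟩ := nonholKer_bound hκ hb hs hh hr0
  set δ := r / 2 with hδ
  have hδ0 : 0 < δ := by positivity
  let y : ℤ → ℂ → ℂ := fun n u =>
    if n < 0 then cexp (2 * π * I * ((n : ℂ) / h) * (u - I * δ)) else 0
  have hx : ∀ n, DifferentiableOn ℂ (fun v => b n * nonholKer κ h n v (I * δ)) {v | r < v.re} := by
    intro n
    rcases le_or_gt 0 n with hn | hn
    · simp [hb n hn]
    · refine ((differentiableOn_nonholKer_left (by linarith) hh hn (I * δ)).mono ?_).const_mul _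
      intro v hv
      exact hr0.trans hv
  have hy : ∀ n, DifferentiableOn ℂ (y n) {u | u.im < δ / 2} := by
    intro n
    by_cases hn : n < 0
    · simp only [y, if_pos hn]; fun_prop
    · simp [y, if_neg hn]
  have hyb : ∀ n, ∀ u ∈ {u : ℂ | u.im < δ / 2}, ‖y n u‖ ≤ Real.exp (-(π * δ / h * |(n : ℝ)|)) := by
    intro n u hu
    have hu : u.im < δ / 2 := hu
    by_cases hn : n < 0
    · have hn0 : (n : ℝ) < 0 := by exact_mod_cast hn
      have := norm_expTerm h n (u - I * δ)
      simp only [expTerm] at this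
      simp only [y, if_pos hn]
      rw [this]
      refine Real.exp_le_exp.mpr ?_
      rw [abs_of_neg hn0]
      have e1 : (u - I * δ).im = u.im - δ := by simp
      have e2 : -(2 * π * ((n : ℝ) / h) * (u.im - δ)) = -(π / h * (-n) * (2 * (δ - u.im))) := by
        ring
      have e3 : -(π * δ / h * -(n : ℝ)) = -(π / h * (-n) * δ) := by ring
      rw [e1, e2, e3]
      exact neg_le_neg (mul_le_mul_of_nonneg_left (by linarith)
        (mul_nonneg (by positivity) (by linarith)))
    · simp only [y, if_neg hn, norm_zero]; positivity
  have := analyticAt_tsum_mul (x := fun n v => b n * nonholKer κ h n v (I * δ)) (y := y)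
    (isOpen_lt continuous_const continuous_re : IsOpen {v : ℂ | r < v.re})
    (isOpen_lt continuous_im continuous_const : IsOpen {u : ℂ | u.im < δ / 2}) hB
    (summable_exp_neg_abs (δ := π * δ / h) (by positivity)) hx hy
    (fun n v hv => hB' n v (I * δ) (le_of_lt hv) (by simp [abs_of_pos hδ0])) hyb
    (p := p) (by simp [hr]; linarith) (by simp [hp2]; positivity)
  convert! this using 2 with q
  refine tsum_congr fun n => ?_
  by_cases hn : n < 0
  · simp only [y, if_pos hn, nonholKer]
    rw [mul_assoc (b n), mul_assoc _ _ (cexp (2 * π * I * _ * _)), ← Complex.exp_add]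
    congr 3
    push_cast
    ring
  · simp [hb n (not_lt.mp hn)]

/-! ### The nonholomorphic part -/

/-- `Γ(1 - κ, -4π n v / h) e^{2πi n z / h}`, `v = Im z`. -/
def nonholFn (κ : ℝ) (h : ℕ) (n : ℤ) (z : ℂ) : ℂ :=
  (incGamma (1 - κ) (-4 * π * ((n : ℝ) / h) * z.im) : ℂ) * expTerm h n z

/-- The nonholomorphic part `∑ b(n) Γ(1 - κ, -4π n v / h) e^{2πi n z / h}`. -/
def nonholSeries (κ : ℝ) (h : ℕ) (b : ℤ → ℂ) (z : ℂ) : ℂ := ∑' n : ℤ, b n * nonholFn κ h n z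

/-- The sum of the holomorphic and the nonholomorphic part. -/
def maassSeries (κ : ℝ) (h : ℕ) (a b : ℤ → ℂ) (z : ℂ) : ℂ :=
  holSeries h a z + nonholSeries κ h b z

lemma cexp_neg_mul_expTerm (h : ℕ) (n : ℤ) (z : ℂ) :
    cexp (-((-4 * π * ((n : ℝ) / h) * z.im : ℝ) : ℂ)) * expTerm h n z =
      cexp ((2 * π * ((n : ℝ) / h) : ℝ) * (z.im + I * z.re)) := by
  rw [expTerm, ← Complex.exp_add]
  congr 1
  push_cast
  linear_combination (2 * π * (n / h) * z.im) * I_sq - (2 * π * (n / h) * I) * re_add_im z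

lemma cexp_eq_conj_expTerm (h : ℕ) (n : ℤ) (z : ℂ) :
    cexp ((2 * π * ((n : ℝ) / h) : ℝ) * (z.im + I * z.re)) = conj (expTerm h (-n) z) := by
  rw [expTerm, ← Complex.exp_conj]
  congr 1
  have : conj z = z.re - z.im * I := by apply Complex.ext <;> simp
  simp only [map_mul, this, map_div₀, conj_I, conj_ofReal, map_ofNat, map_natCast]
  push_cast
  simp
  linear_combination (2 * π * (n / h) * z.im) * I_sq

/-- Only the factor v^{1-κ} depends on no index, so it can be taken out of the series; what remains
is holomorphic in both variables. -/
lemma nonholFn_eq {κ : ℝ} {h : ℕ} (hh : 0 < h) {n : ℤ} (hn : n < 0) {z : ℂ} (hz : 0 < z.im) :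
    nonholFn κ h n z = (z.im : ℂ) ^ ((1 - κ : ℝ) : ℂ) * nonholKer κ h n z.im z.re := by
  have hf := neg_freq_pos hh hn
  rw [nonholFn, incGamma_eq_lapKer κ (mul_pos hf hz), Real.mul_rpow hf.le hz.le, nonholKer,
    ← cexp_neg_mul_expTerm, ← ofReal_cpow hz.le]
  push_cast
  ring

lemma nonholSeries_eq {κ : ℝ} {h : ℕ} (hh : 0 < h) {b : ℤ → ℂ} (hb : ∀ n : ℤ, 0 ≤ n → b n = 0)
    {z : ℂ} (hz : 0 < z.im) : nonholSeries κ h b z =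
      (z.im : ℂ) ^ ((1 - κ : ℝ) : ℂ) * ∑' n, b n * nonholKer κ h n z.im z.re := by
  rw [nonholSeries, ← tsum_mul_left]
  refine tsum_congr fun n => ?_
  rcases le_or_gt 0 n with hn | hn
  · simp [hb n hn]
  · rw [nonholFn_eq hh hn hz]; ring

lemma summable_nonholKer {κ : ℝ} (hκ : 1 ≤ κ) {b : ℤ → ℂ} (hb : ∀ n : ℤ, 0 ≤ n → b n = 0)
    (hs : SubExp b) {h : ℕ} (hh : 0 < h) {z : ℂ} (hz : 0 < z.im) :
    Summable fun n => b n * nonholKer κ h n z.im z.re := by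
  obtain ⟨B, hB, hB'⟩ := nonholKer_bound hκ hb hs hh hz
  exact Summable.of_norm_bounded hB fun n => hB' n _ _ (by simp) (by simp; positivity)

lemma summable_nonholFn {κ : ℝ} (hκ : 1 ≤ κ) {b : ℤ → ℂ} (hb : ∀ n : ℤ, 0 ≤ n → b n = 0)
    (hs : SubExp b) {h : ℕ} (hh : 0 < h) {z : ℂ} (hz : 0 < z.im) :
    Summable fun n => b n * nonholFn κ h n z := by
  refine ((summable_nonholKer hκ hb hs hh hz).mul_left ((z.im : ℂ) ^ ((1 - κ : ℝ) : ℂ))).congr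
    fun n => ?_
  rcases le_or_gt 0 n with hn | hn
  · simp [hb n hn]
  · rw [nonholFn_eq hh hn hz]; ring

lemma analyticAt_nonholSeries {κ : ℝ} (hκ : 1 ≤ κ) {b : ℤ → ℂ} (hb : ∀ n : ℤ, 0 ≤ n → b n = 0)
    (hs : SubExp b) {h : ℕ} (hh : 0 < h) {z : ℂ} (hz : 0 < z.im) :
    AnalyticAt ℝ (nonholSeries κ h b) z := by
  -- The real-linear map z ↦ (Im z, Re z) carries the upper half-plane into the domain of joint
  -- analyticity.
  let ι : ℂ →L[ℝ] ℂ × ℂ := (ofRealCLM ∘L imCLM).prod (ofRealCLM ∘L reCLM)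
  have h1 : AnalyticAt ℂ (fun q : ℂ × ℂ =>
      q.1 ^ ((1 - κ : ℝ) : ℂ) * ∑' n, b n * nonholKer κ h n q.1 q.2) (ι z) := by
    refine AnalyticAt.mul (AnalyticAt.cpow analyticAt_fst analyticAt_const ?_)
      (analyticAt_tsum_nonholKer hκ hb hs hh ?_ ?_)
    · exact ofReal_mem_slitPlane.mpr hz
    · simpa [ι] using hz
    · simp [ι]
  have h2 := (h1.restrictScalars (𝕜 := ℝ)).comp (ι.analyticAt z)
  refine h2.congr ?_
  filter_upwards [isOpen_im_pos.mem_nhds hz] with w hw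
  rw [nonholSeries_eq hh hb hw]
  rfl

/-- The coefficients of the (normalized) image of a nonholomorphic part under `∂/∂τ̄`. -/
def shadow (κ : ℝ) (h : ℕ) (b : ℤ → ℂ) (m : ℤ) : ℂ :=
  I / 2 * conj (b (-m)) * (((-4 * π * (((-m : ℤ) : ℝ) / h)) ^ (1 - κ) : ℝ) : ℂ)

lemma subExp_freqPow {κ : ℝ} (hκ : 1 ≤ κ) {h : ℕ} (hh : 0 < h) {b : ℤ → ℂ}
    (hb : ∀ n : ℤ, 0 ≤ n → b n = 0) (hs : SubExp b) :
    SubExp fun n => b n * (((-4 * π * ((n : ℝ) / h)) ^ (1 - κ) : ℝ) : ℂ) := by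
  have hc : SubExp fun _ => (((4 * π / h) ^ (1 - κ) : ℝ) : ℂ) :=
    subExp_of_norm_le (D := ‖(((4 * π / h) ^ (1 - κ) : ℝ) : ℂ)‖) fun _ => le_rfl
  refine (hs.mul hc).mono fun n => ?_
  rcases le_or_gt 0 n with hn | hn
  · simp [hb n hn]
  · rw [norm_mul, norm_mul]
    refine mul_le_mul_of_nonneg_left ((freq_rpow_le hκ hh hn).trans ?_) (norm_nonneg _)
    rw [norm_real]
    exact le_abs_self _

lemma shadow_lower {κ : ℝ} {h : ℕ} {b : ℤ → ℂ} (hb : ∀ n : ℤ, 0 ≤ n → b n = 0) :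
    ∃ N : ℤ, ∀ n < N, shadow κ h b n = 0 :=
  ⟨0, fun n hn => by simp [shadow, hb (-n) (by omega)]⟩

lemma subExp_shadow {κ : ℝ} (hκ : 1 ≤ κ) {h : ℕ} (hh : 0 < h) {b : ℤ → ℂ}
    (hb : ∀ n : ℤ, 0 ≤ n → b n = 0) (hs : SubExp b) : SubExp (shadow κ h b) := by
  refine ((subExp_freqPow hκ hh hb hs).comp_neg).mono fun n => ?_
  simp only [shadow, norm_mul, norm_div, norm_I, RCLike.norm_conj]
  refine mul_le_mul_of_nonneg_right ?_ (norm_nonneg _)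
  have := norm_nonneg (b (-n))
  norm_num
  linarith

lemma conj_holSeries_shadow (κ : ℝ) (h : ℕ) (b : ℤ → ℂ) (z : ℂ) :
    conj (holSeries h (shadow κ h b) z) = -I / 2 * ∑' n : ℤ, b n *
      (((-4 * π * ((n : ℝ) / h)) ^ (1 - κ) : ℝ) : ℂ) * conj (expTerm h (-n) z) := by
  rw [holSeries, conj_tsum, ← (Equiv.neg ℤ).tsum_eq, ← tsum_mul_left]
  refine tsum_congr fun n => ?_
  simp only [Equiv.neg_apply, shadow, neg_neg, map_mul, conj_conj, conj_ofReal, map_div₀, conj_I,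
    map_ofNat]
  ring

/-- The exponential gives i ∂/∂u, and the incomplete gamma factor has an elementary derivative,
which supplies the antiholomorphic term. The derivative is taken in complex v so that it can be
summed termwise; its value is found by restricting to real v. -/
lemma deriv_nonholFn_vertical {κ : ℝ} (hκ : 0 ≤ κ) {h : ℕ} (hh : 0 < h) {n : ℤ} (hn : n < 0)
    {z : ℂ} (hz : 0 < z.im) :
    deriv (fun v : ℂ => v ^ ((1 - κ : ℝ) : ℂ) * nonholKer κ h n v z.re) z.im =
      I * (2 * π * I * ((n : ℂ) / h)) * nonholFn κ h n z - ((z.im ^ (-κ) : ℝ) : ℂ) *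
        ((((-4 * π * ((n : ℝ) / h)) ^ (1 - κ) : ℝ) : ℂ) * conj (expTerm h (-n) z)) := by
  have hf := neg_freq_pos hh hn
  set f : ℝ := -4 * π * ((n : ℝ) / h) with hfd
  have hdiff : DifferentiableAt ℂ
      (fun v : ℂ => v ^ ((1 - κ : ℝ) : ℂ) * nonholKer κ h n v z.re) z.im := by
    refine DifferentiableAt.mul ?_ ?_
    · exact differentiableAt_id.cpow_const (Or.inl hz)
    · exact (differentiableOn_nonholKer_left hκ hh hn _ _ (by simpa using hz)).differentiableAt
        ((isOpen_lt continuous_const continuous_re).mem_nhds (by simpa using hz))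
  have h1 := hdiff.hasDerivAt.comp_ofReal
  have h2 : HasDerivAt (fun v : ℝ => ((incGamma (1 - κ) (f * v) : ℝ) : ℂ) *
      expTerm h n (z.re + v * I))
      (((-(Real.exp (-(f * z.im)) * (f * z.im) ^ (1 - κ - 1)) * f : ℝ) : ℂ) *
        expTerm h n (z.re + z.im * I) + ((incGamma (1 - κ) (f * z.im) : ℝ) : ℂ) *
          (2 * π * I * ((n : ℂ) / h) * expTerm h n (z.re + z.im * I) * I)) z.im := by
    refine HasDerivAt.mul ?_ ?_
    · have e := (hasDerivAt_incGamma (1 - κ) (mul_pos hf hz)).comp z.im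
        ((hasDerivAt_id z.im).const_mul f)
      rw [mul_one] at e
      exact e.ofReal_comp
    · have e1 : HasDerivAt (fun v : ℝ => (z.re : ℂ) + v * I) I z.im := by
        simpa using ((ofRealCLM.hasDerivAt (x := z.im)).mul_const I).const_add (z.re : ℂ)
      exact (hasDerivAt_expTerm h n _).comp z.im e1
  have h3 : HasDerivAt (fun v : ℝ => (v : ℂ) ^ ((1 - κ : ℝ) : ℂ) * nonholKer κ h n v z.re) _ z.im :=
    h2.congr_of_eventuallyEq (by
      filter_upwards [lt_mem_nhds hz] with v hv
      have := nonholFn_eq (κ := κ) hh hn (z := z.re + v * I) (by simpa using hv)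
      have e1 : ((z.re : ℂ) + v * I).im = v := by simp
      have e2 : ((z.re : ℂ) + v * I).re = z.re := by simp
      rw [nonholFn, e1, e2] at this
      exact this.symm)
  rw [h1.unique h3, re_add_im]
  have e3 : expTerm h n z = cexp ((f * z.im : ℝ) : ℂ) * conj (expTerm h (-n) z) := by
    rw [← cexp_eq_conj_expTerm, ← cexp_neg_mul_expTerm, ← mul_assoc, ← Complex.exp_add, ← hfd]
    simp
  have e4 : (f * z.im) ^ (1 - κ - 1) * f = z.im ^ (-κ) * f ^ (1 - κ) := by
    rw [Real.mul_rpow hf.le hz.le, show 1 - κ = -κ + 1 by ring, Real.rpow_add_one hf.ne']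
    ring_nf
  have e5 : ((-(Real.exp (-(f * z.im)) * (f * z.im) ^ (1 - κ - 1)) * f : ℝ) : ℂ) * expTerm h n z =
      -(((z.im ^ (-κ) : ℝ) : ℂ) * (((f ^ (1 - κ) : ℝ) : ℂ) * conj (expTerm h (-n) z))) := by
    have e6 : (-(Real.exp (-(f * z.im)) * (f * z.im) ^ (1 - κ - 1)) * f : ℝ) =
        -(Real.exp (-(f * z.im)) * (z.im ^ (-κ) * f ^ (1 - κ))) := by rw [← e4]; ring
    rw [e6, e3]
    have e7 : cexp (-((f * z.im : ℝ) : ℂ)) * cexp ((f * z.im : ℝ) : ℂ) = 1 := by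
      rw [← Complex.exp_add]; simp
    push_cast at e7 ⊢
    linear_combination (-((z.im ^ (-κ) : ℝ) : ℂ) * ((f ^ (1 - κ) : ℝ) : ℂ) *
      conj (expTerm h (-n) z)) * e7
  rw [e5, nonholFn, ← hfd]
  ring

/-- The two real partial derivatives are computed by termwise complex differentiation in u and in v.
The parts involving incomplete gamma functions cancel in ∂_u + i∂_v; what is left is v^{-κ} times
the conjugate of a holomorphic series. -/
lemma hasWirt_nonholSeries {κ : ℝ} (hκ : 1 ≤ κ) {b : ℤ → ℂ} (hb : ∀ n : ℤ, 0 ≤ n → b n = 0)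
    (hs : SubExp b) {h : ℕ} (hh : 0 < h) {z : ℂ} (hz : 0 < z.im) :
    HasWirt (nonholSeries κ h b)
      (2 * π * I * nonholSeries κ h (fun n => b n * ((n : ℂ) / h)) z -
        ((z.im ^ (-κ) : ℝ) : ℂ) * conj (holSeries h (shadow κ h b) z))
      (((z.im ^ (-κ) : ℝ) : ℂ) * conj (holSeries h (shadow κ h b) z)) z := by
  have hd := (analyticAt_nonholSeries hκ hb hs hh hz).differentiableAt.hasFDerivAt
  obtain ⟨B, hB, hB'⟩ := nonholKer_bound hκ hb hs hh (r := z.im / 2) (by positivity)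
  have hre : z = z.re + z.im * I := (re_add_im z).symm
  have hb' : ∀ n : ℤ, 0 ≤ n → b n * ((n : ℂ) / h) = 0 := fun n hn => by simp [hb n hn]
  have hs' : SubExp fun n => b n * ((n : ℂ) / h) := by
    refine hs.mul ?_
    have := subExp_intCast.mul (subExp_of_norm_le (c := fun _ => 1 / (h : ℂ)) fun _ => le_rfl)
    simpa [div_eq_mul_inv] using this
  have h1 : fderiv ℝ (nonholSeries κ h b) z 1 =
      2 * π * I * nonholSeries κ h (fun n => b n * ((n : ℂ) / h)) z := by
    set U : Set ℂ := {u | |u.im| < z.im / 2 / 2}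
    have hU : IsOpen U := isOpen_lt (continuous_abs.comp continuous_im) continuous_const
    have hzU : (z.re : ℂ) ∈ U := by simp [U]; positivity
    have hdiff : ∀ n, Differentiable ℂ fun u : ℂ => b n * nonholKer κ h n z.im u := fun n => by
      unfold nonholKer; fun_prop
    have hbd : ∀ n, ∀ u ∈ U, ‖b n * nonholKer κ h n z.im u‖ ≤ B n := fun n u hu =>
      hB' n _ _ (by simp; linarith) (le_of_lt hu)
    have t1 := Complex.differentiableOn_tsum_of_summable_norm hB
      (fun n => (hdiff n).differentiableOn) hU hbd
    have t2 := Complex.hasSum_deriv_of_summable_norm hB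
      (fun n => (hdiff n).differentiableOn) hU hbd hzU
    have t3 := ((t1 _ hzU).differentiableAt (hU.mem_nhds hzU)).hasDerivAt
    rw [← t2.tsum_eq] at t3
    have t4 := (t3.const_mul ((z.im : ℂ) ^ ((1 - κ : ℝ) : ℂ))).comp_ofReal
    have c1 : HasDerivAt (fun t : ℝ => (t : ℂ) + z.im * I) 1 z.re := by
      simpa using (ofRealCLM.hasDerivAt (x := z.re)).add_const ((z.im : ℂ) * I)
    have c2 := HasFDerivAt.comp_hasDerivAt (f := fun t : ℝ => (t : ℂ) + z.im * I) z.re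
      (l := nonholSeries κ h b) (by rw [re_add_im]; exact hd) c1
    have c3 : (nonholSeries κ h b ∘ fun t : ℝ => (t : ℂ) + z.im * I) = fun t : ℝ =>
        (z.im : ℂ) ^ ((1 - κ : ℝ) : ℂ) * ∑' n, b n * nonholKer κ h n z.im t := by
      funext t
      have := nonholSeries_eq (κ := κ) hh hb (z := t + z.im * I) (by simpa using hz)
      simpa using this
    rw [c3] at c2
    rw [c2.unique t4, nonholSeries_eq hh hb' hz, mul_left_comm,
      ← tsum_mul_left (a := 2 * (π : ℂ) * I)]
    refine congrArg _ (tsum_congr fun n => ?_)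
    have : HasDerivAt (fun u : ℂ => b n * nonholKer κ h n z.im u)
        (2 * π * I * (b n * (n / h) * nonholKer κ h n z.im z.re)) (z.re : ℂ) := by
      have e : HasDerivAt (fun u : ℂ => ((2 * π * ((n : ℝ) / h) : ℝ) : ℂ) * (z.im + I * u))
          (((2 * π * ((n : ℝ) / h) : ℝ) : ℂ) * I) (z.re : ℂ) := by
        simpa using (((hasDerivAt_id (z.re : ℂ)).const_mul I).const_add (z.im : ℂ)).const_mul
          ((2 * π * ((n : ℝ) / h) : ℝ) : ℂ)
      convert! (e.cexp.const_mul ((((-4 * π * ((n : ℝ) / h)) ^ (1 - κ) : ℝ) : ℂ) *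
        lapKer κ ((-4 * π * ((n : ℝ) / h) : ℝ) * z.im))).const_mul (b n) using 1
      rw [nonholKer]
      push_cast
      ring
    exact this.deriv
  have h2 : fderiv ℝ (nonholSeries κ h b) z I =
      I * (2 * π * I * nonholSeries κ h (fun n => b n * ((n : ℂ) / h)) z) -
        2 * I * (((z.im ^ (-κ) : ℝ) : ℂ) * conj (holSeries h (shadow κ h b) z)) := by
    set U : Set ℂ := {v | z.im / 2 < v.re}
    have hU : IsOpen U := isOpen_lt continuous_const continuous_re
    have hzU : (z.im : ℂ) ∈ U := by simp [U]; positivity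
    have hdiff : ∀ n, DifferentiableOn ℂ (fun v : ℂ => b n * nonholKer κ h n v z.re) U := fun n => by
      rcases le_or_gt 0 n with hn | hn
      · simp [hb n hn]
      · refine ((differentiableOn_nonholKer_left (by linarith) hh hn _).mono ?_).const_mul _
        intro v hv
        exact lt_trans (by positivity) (show z.im / 2 < v.re from hv)
    have hbd : ∀ n, ∀ v ∈ U, ‖b n * nonholKer κ h n v z.re‖ ≤ B n := fun n v hv =>
      hB' n _ _ (le_of_lt hv) (by simp; positivity)
    have t1 := Complex.differentiableOn_tsum_of_summable_norm hB hdiff hU hbd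
    have t2 := Complex.hasSum_deriv_of_summable_norm hB hdiff hU hbd hzU
    have t3 := ((t1 _ hzU).differentiableAt (hU.mem_nhds hzU)).hasDerivAt
    have p1 : HasDerivAt (fun v : ℂ => v ^ ((1 - κ : ℝ) : ℂ))
        (deriv (fun v : ℂ => v ^ ((1 - κ : ℝ) : ℂ)) z.im) z.im :=
      (DifferentiableAt.cpow_const differentiableAt_fun_id (by simpa using hz)).hasDerivAt
    set p' := deriv (fun v : ℂ => v ^ ((1 - κ : ℝ) : ℂ)) z.im
    have t4 := (p1.mul t3).comp_ofReal
    have c1 : HasDerivAt (fun t : ℝ => (z.re : ℂ) + t * I) I z.im := by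
      simpa using ((ofRealCLM.hasDerivAt (x := z.im)).mul_const I).const_add (z.re : ℂ)
    have c2 := HasFDerivAt.comp_hasDerivAt (f := fun t : ℝ => (z.re : ℂ) + t * I) z.im
      (l := nonholSeries κ h b) (by rw [re_add_im]; exact hd) c1
    have c3 : (nonholSeries κ h b ∘ fun t : ℝ => (z.re : ℂ) + t * I) =ᶠ[𝓝 z.im] fun t : ℝ =>
        (t : ℂ) ^ ((1 - κ : ℝ) : ℂ) * ∑' n, b n * nonholKer κ h n t z.re := by
      filter_upwards [lt_mem_nhds hz] with t ht
      have := nonholSeries_eq (κ := κ) hh hb (z := z.re + t * I) (by simpa using ht)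
      simpa using this
    rw [(c2.congr_of_eventuallyEq c3.symm).unique t4]
    have s1 := (summable_nonholKer hκ hb hs hh hz).hasSum.mul_left p'
    have s2 := s1.add (t2.mul_left ((z.im : ℂ) ^ ((1 - κ : ℝ) : ℂ)))
    have s3 := ((summable_nonholFn hκ hb' hs' hh hz).hasSum.mul_left (I * (2 * π * I)))
    have s4 := s3.sub s2
    -- The combination i ∂_u - ∂_v is summed as one series, since each of its terms is elementary by
    -- `s6`.
    have s5 := s4.tsum_eq
    have s6 : ∀ n : ℤ, I * (2 * π * I) * (b n * ((n : ℂ) / h) * nonholFn κ h n z) -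
        (p' * (b n * nonholKer κ h n z.im z.re) + (z.im : ℂ) ^ ((1 - κ : ℝ) : ℂ) *
          deriv (fun v : ℂ => b n * nonholKer κ h n v z.re) z.im) =
        ((z.im ^ (-κ) : ℝ) : ℂ) * (b n * (((-4 * π * ((n : ℝ) / h)) ^ (1 - κ) : ℝ) : ℂ) *
          conj (expTerm h (-n) z)) := by
      intro n
      rcases le_or_gt 0 n with hn | hn
      · simp [hb n hn]
      · have q := (p1.mul ((hdiff n).differentiableAt (hU.mem_nhds hzU)).hasDerivAt).deriv
        have q2 : ((fun v : ℂ => v ^ ((1 - κ : ℝ) : ℂ)) * fun v : ℂ => b n * nonholKer κ h n v z.re) =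
            fun v => b n * (v ^ ((1 - κ : ℝ) : ℂ) * nonholKer κ h n v z.re) := by
          funext v; simp only [Pi.mul_apply]; ring
        rw [q2, deriv_const_mul_field, deriv_nonholFn_vertical (by linarith) hh hn hz] at q
        linear_combination q
    rw [tsum_congr s6, tsum_mul_left] at s5
    have s7 := conj_holSeries_shadow κ h b z
    rw [s7]
    rw [nonholSeries]
    linear_combination s5 - (((z.im ^ (-κ) : ℝ) : ℂ) * ∑' n : ℤ, b n *
      (((-4 * π * ((n : ℝ) / h)) ^ (1 - κ) : ℝ) : ℂ) * conj (expTerm h (-n) z)) * I_sq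
  refine hasWirt_of_fderiv hd (by rw [h1]; ring) (by rw [h2]; ring)

/-! ### Test functions -/

/-- Integrable functions whose support is contained in a compact subset of the positive reals. -/
structure IsCompactlyIntegrable (φ : ℝ → ℂ) : Prop where
  integrable : Integrable φ
  support : ∃ c₁ c₂ : ℝ, 0 < c₁ ∧ ∀ x, φ x ≠ 0 → x ∈ Set.Icc c₁ c₂

lemma IsCompactlyIntegrable.eq_zero {φ : ℝ → ℂ} (h : IsCompactlyIntegrable φ) {x : ℝ}
    (hx : x ≤ 0) : φ x = 0 := by
  obtain ⟨c₁, c₂, hc, hs⟩ := h.support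
  by_contra hne
  exact absurd (hs x hne).1 (by linarith)

lemma IsCompactlyIntegrable.mul {φ g : ℝ → ℂ} (h : IsCompactlyIntegrable φ)
    (hg : ContinuousOn g (Set.Ioi 0)) : IsCompactlyIntegrable fun x => φ x * g x where
  integrable := by
    obtain ⟨c₁, c₂, hc, hs⟩ := h.support
    have h1 : IntegrableOn (fun x => φ x * g x) (Set.Icc c₁ c₂) :=
      h.integrable.integrableOn.mul_continuousOn
        (hg.mono fun x hx => hc.trans_le hx.1) isCompact_Icc
    refine (integrableOn_iff_integrable_of_support_subset fun x hx => ?_).mp h1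
    exact hs x (left_ne_zero_of_mul hx)
  support := by
    obtain ⟨c₁, c₂, hc, hs⟩ := h.support
    exact ⟨c₁, c₂, hc, fun x hx => hs x (left_ne_zero_of_mul hx)⟩

lemma IsTestFunction.isCompactlyIntegrable {φ : ℝ → ℂ} (h : IsTestFunction φ) :
    IsCompactlyIntegrable φ where
  integrable := by
    obtain ⟨c₁, c₂, hc, hs⟩ := h.support
    have h1 : LocallyIntegrableOn φ (Set.Icc c₁ c₂) := by
      intro y hy
      refine IntegrableAtFilter.filter_mono nhdsWithin_le_nhds ?_
      obtain ⟨g, k, hg, hk, hφg, hφk, -⟩ := h.piecewise y (hc.trans_le hy.1)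
      rw [← nhdsNE_sup_pure, ← nhdsLT_sup_nhdsGT, IntegrableAtFilter.sup_iff,
        IntegrableAtFilter.sup_iff]
      -- A neighbourhood of y is split into its left part, its right part and the null set {y}.
      refine ⟨⟨?_, ?_⟩, ⟨{y}, mem_pure.mpr rfl, integrableOn_singleton (hx := by rw [Real.volume_singleton]; simp)⟩⟩
      · obtain ⟨l, hl, hl'⟩ := (mem_nhdsLT_iff_exists_Ioo_subset).mp hφg
        refine ⟨Set.Ioo l y, Ioo_mem_nhdsLT hl, ?_⟩
        refine IntegrableOn.congr_fun (f := g) ?_ (fun x hx => (hl' hx).symm) measurableSet_Ioo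
        exact (hg.continuous.continuousOn.integrableOn_compact isCompact_Icc).mono_set
          Set.Ioo_subset_Icc_self
      · obtain ⟨l, hl, hl'⟩ := (mem_nhdsGT_iff_exists_Ioo_subset).mp hφk
        refine ⟨Set.Ioo y l, Ioo_mem_nhdsGT hl, ?_⟩
        refine IntegrableOn.congr_fun (f := k) ?_ (fun x hx => (hl' hx).symm) measurableSet_Ioo
        exact (hk.continuous.continuousOn.integrableOn_compact isCompact_Icc).mono_set
          Set.Ioo_subset_Icc_self
    exact (integrableOn_iff_integrable_of_support_subset fun x hx => hs x hx).mp
      (h1.integrableOn_isCompact isCompact_Icc)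
  support := h.support

lemma continuousOn_ofReal_cpow (s : ℂ) : ContinuousOn (fun x : ℝ => (x : ℂ) ^ s) (Set.Ioi 0) :=
  ContinuousOn.cpow_const continuous_ofReal.continuousOn
    fun _ hx => ofReal_mem_slitPlane.mpr hx

lemma IsCompactlyIntegrable.twist {φ : ℝ → ℂ} (h : IsCompactlyIntegrable φ) (s : ℂ) :
    IsCompactlyIntegrable (twist φ s) := h.mul (continuousOn_ofReal_cpow _)

lemma IsCompactlyIntegrable.twist_twist {φ : ℝ → ℂ} (h : IsCompactlyIntegrable φ) (s t : ℂ) :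
    KohnenPlus.twist (KohnenPlus.twist φ s) t = KohnenPlus.twist φ (s + t - 1) := by
  funext x
  rcases le_or_gt x 0 with hx | hx
  · simp [KohnenPlus.twist, h.eq_zero hx]
  · have : (x : ℂ) ≠ 0 := by exact_mod_cast hx.ne'
    rw [KohnenPlus.twist, KohnenPlus.twist, KohnenPlus.twist, mul_assoc, ← cpow_add _ _ this]
    ring_nf

lemma IsCompactlyIntegrable.setIntegral {φ : ℝ → ℂ} (h : IsCompactlyIntegrable φ) :
    ∫ x in Set.Ioi 0, φ x = ∫ x, φ x :=
  setIntegral_eq_integral_of_forall_compl_eq_zero fun _ hx => h.eq_zero (not_lt.mp hx)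

/-- A compactly supported integrable function on the positive reals all of whose moments vanish
is zero almost everywhere. -/
lemma IsCompactlyIntegrable.ae_eq_zero {φ : ℝ → ℂ} (h : IsCompactlyIntegrable φ)
    (hm : ∀ n : ℕ, ∫ x in Set.Ioi (0 : ℝ), φ x * (x : ℂ) ^ n = 0) : ∀ᵐ x, φ x = 0 := by
  obtain ⟨c₁, c₂, hc, hs⟩ := h.support
  have hint : ∀ n : ℕ, Integrable fun x => φ x * (x : ℂ) ^ n := fun n =>
    (h.mul (g := fun x => (x : ℂ) ^ n) (by fun_prop)).integrable
  have hpoly : ∀ p : Polynomial ℝ, ∫ x, φ x * ((p.eval x : ℝ) : ℂ) = 0 ∧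
      Integrable fun x => φ x * ((p.eval x : ℝ) : ℂ) := by
    intro p
    have hi : Integrable fun x => φ x * ((p.eval x : ℝ) : ℂ) :=
      (h.mul (g := fun x => ((p.eval x : ℝ) : ℂ)) (by fun_prop)).integrable
    refine ⟨?_, hi⟩
    have e : ∀ x : ℝ, φ x * ((p.eval x : ℝ) : ℂ) =
        ∑ n ∈ Finset.range (p.natDegree + 1), (p.coeff n : ℂ) * (φ x * (x : ℂ) ^ n) := by
      intro x
      rw [Polynomial.eval_eq_sum_range]
      push_cast
      rw [Finset.mul_sum]
      exact Finset.sum_congr rfl fun n _ => by ring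
    simp_rw [e]
    rw [integral_finsetSum _ fun n _ => (hint n).const_mul _]
    refine Finset.sum_eq_zero fun n _ => ?_
    rw [integral_const_mul,
      ← (h.mul (g := fun x => (x : ℂ) ^ n) (by fun_prop)).setIntegral, hm n, mul_zero]
  refine ae_eq_zero_of_integral_contDiff_smul_eq_zero h.integrable.locallyIntegrable
    fun g hg _ => ?_
  have hgi : Integrable fun x => φ x * (g x : ℂ) :=
    (h.mul (g := fun x => (g x : ℂ))
      (continuous_ofReal.comp hg.continuous).continuousOn).integrable
  have hbd : ∀ ε : ℝ, 0 < ε → ‖∫ x, φ x * (g x : ℂ)‖ ≤ ε * ∫ x, ‖φ x‖ := by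
    intro ε hε
    -- Weierstrass approximation on the compact support; the polynomial integrates to zero against φ
    -- by the vanishing of the moments.
    obtain ⟨p, hp⟩ := exists_polynomial_near_of_continuousOn c₁ c₂ g hg.continuous.continuousOn ε hε
    have e : ∫ x, φ x * (g x : ℂ) = ∫ x, (φ x * (g x : ℂ) - φ x * ((p.eval x : ℝ) : ℂ)) := by
      rw [integral_sub hgi (hpoly p).2, (hpoly p).1, sub_zero]
    rw [e, ← integral_const_mul]
    refine norm_integral_le_of_norm_le (h.integrable.norm.const_mul _) (ae_of_all _ fun x => ?_)
    by_cases hx : φ x = 0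
    · simp [hx]
    · rw [← mul_sub, norm_mul, mul_comm, ← ofReal_sub, norm_real, Real.norm_eq_abs, abs_sub_comm]
      exact mul_le_mul_of_nonneg_right (hp x (hs x hx)).le (norm_nonneg _)
  have h0 : ‖∫ x, φ x * (g x : ℂ)‖ ≤ 0 := by
    refine le_of_forall_pos_le_add fun ε hε => ?_
    set N := ∫ x, ‖φ x‖ with hN
    have hN0 : 0 ≤ N := integral_nonneg fun _ => norm_nonneg _
    refine (hbd (ε / (N + 1)) (by positivity)).trans ?_
    rw [zero_add, div_mul_eq_mul_div, div_le_iff₀ (by positivity)]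
    nlinarith
  have := norm_le_zero_iff.mp h0
  rw [← this]
  refine integral_congr_ae (ae_of_all _ fun x => ?_)
  simp [real_smul, mul_comm]

/-- A continuous function annihilated by a test family is zero. -/
lemma IsTestFamily.eq_zero {S : Set (ℝ → ℂ)} (hS : IsTestFamily S) {G : ℝ → ℂ}
    (hG : ContinuousOn G (Set.Ioi 0)) (h : ∀ φ ∈ S, ∫ x in Set.Ioi (0 : ℝ), φ x * G x = 0)
    {y : ℝ} (hy : 0 < y) : G y = 0 := by
  obtain ⟨φ, hφ, hφy⟩ := hS.nonvanishing y hy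
  have hφt := hS.isTest φ hφ
  have hae : ∀ᵐ x, φ x * G x = 0 := by
    refine (hφt.isCompactlyIntegrable.mul hG).ae_eq_zero fun n => ?_
    -- Twisting by s = n + 1 multiplies φ by x^n, so all moments of φ G vanish.
    rw [← h _ (hS.twist_mem φ hφ (n + 1))]
    refine setIntegral_congr_fun measurableSet_Ioi fun x _ => ?_
    simp only [twist, add_sub_cancel_right, cpow_natCast]
    ring
  by_contra hGy
  have hGn : ∀ᶠ x in 𝓝 y, G x ≠ 0 := (hG.continuousAt (Ioi_mem_nhds hy)).eventually_ne hGy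
  have key : ∀ l r : ℝ, l < r → ¬ (∀ x ∈ Set.Ioo l r, φ x * G x ≠ 0) := by
    intro l r hlr hne
    have h0 : volume (Set.Ioo l r) = 0 := measure_mono_null hne (ae_iff.mp hae)
    rw [Real.volume_Ioo] at h0
    simp only [ENNReal.ofReal_eq_zero] at h0
    linarith
  -- Because φ(y) is a one-sided limit, φ is nonzero on a whole interval on one side of y. If G(y) ≠
  -- 0, the product is nonzero on a set of positive measure.
  obtain ⟨g, k, hg, hk, hφg, hφk, hor⟩ := hφt.piecewise y hy
  rcases hor with e | e
  · have hgn : ∀ᶠ x in 𝓝 y, g x ≠ 0 :=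
      hg.continuous.continuousAt.eventually_ne (by rwa [← e])
    have : ∀ᶠ x in 𝓝[<] y, φ x * G x ≠ 0 := by
      filter_upwards [hφg, nhdsWithin_le_nhds hgn, nhdsWithin_le_nhds hGn] with x h1 h2 h3
      rw [h1]
      exact mul_ne_zero h2 h3
    obtain ⟨l, hl, hl'⟩ := (mem_nhdsLT_iff_exists_Ioo_subset).mp this
    exact key l y hl fun x hx => hl' hx
  · have hkn : ∀ᶠ x in 𝓝 y, k x ≠ 0 :=
      hk.continuous.continuousAt.eventually_ne (by rwa [← e])
    have : ∀ᶠ x in 𝓝[>] y, φ x * G x ≠ 0 := by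
      filter_upwards [hφk, nhdsWithin_le_nhds hkn, nhdsWithin_le_nhds hGn] with x h1 h2 h3
      rw [h1]
      exact mul_ne_zero h2 h3
    obtain ⟨l, hl, hl'⟩ := (mem_nhdsGT_iff_exists_Ioo_subset).mp this
    exact key y l hl fun x hx => hl' hx

/-- The form in which the substitution x ↦ x^{-1} produces the slash action: the Jacobian x^{-2}
accounts for the exponent w - 2. -/
lemma slashS_change (w : ℝ) (μ : ℂ) (φ : ℝ → ℂ) {x : ℝ} (hx : 0 < x) :
    (|(-1 : ℝ)| * x ^ ((-1 : ℝ) - 1)) • (φ (x ^ (-1 : ℝ)) * (((x ^ (-1 : ℝ)) ^ (w - 2) : ℝ) : ℂ) * μ)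
      = slashS w μ φ x := by
  have h1 : x ^ (-1 : ℝ) = 1 / x := by rw [Real.rpow_neg_one]; simp
  have h2 : x ^ ((-1 : ℝ) - 1) * (x ^ (-1 : ℝ)) ^ (w - 2) = x ^ (-w) := by
    rw [← Real.rpow_mul hx.le, ← Real.rpow_add hx]
    ring_nf
  rw [real_smul, slashS, ← h2, ← h1]
  push_cast
  simp
  ring

/-- The slashed function need not belong to the test family; this weaker class suffices for the
integral formulas of the L-series. -/
lemma IsCompactlyIntegrable.slashS {φ : ℝ → ℂ} (h : IsCompactlyIntegrable φ) (w : ℝ) (μ : ℂ) :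
    IsCompactlyIntegrable (slashS w μ φ) where
  integrable := by
    have h1 : IsCompactlyIntegrable fun x : ℝ => φ x * (((x ^ (w - 2) : ℝ) : ℂ)) * μ := by
      refine IsCompactlyIntegrable.mul (h.mul ?_) continuousOn_const
      exact continuous_ofReal.comp_continuousOn
        (ContinuousOn.rpow_const continuousOn_id fun x hx => Or.inl (ne_of_gt hx))
    have h2 := (integrableOn_Ioi_comp_rpow_iff _ (p := -1) (by norm_num)).mpr
      h1.integrable.integrableOn
    have h3 := h2.congr_fun (g := KohnenPlus.slashS w μ φ) (fun x hx => slashS_change w μ φ hx)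
      measurableSet_Ioi
    refine (integrableOn_iff_integrable_of_support_subset fun x hx => ?_).mp h3
    by_contra hx0
    have : (1 / x) ≤ 0 := one_div_nonpos.mpr (not_lt.mp hx0)
    exact hx (by rw [KohnenPlus.slashS, h.eq_zero this, mul_zero])
  support := by
    obtain ⟨c₁, c₂, hc, hs⟩ := h.support
    rcases le_or_gt c₂ 0 with h0 | h0
    · exact ⟨1, 1, one_pos, fun x hx => by
        have := hs (1 / x) (right_ne_zero_of_mul hx)
        exact absurd (this.1.trans this.2) (by linarith)⟩
    · refine ⟨1 / c₂, 1 / c₁, by positivity, fun x hx => ?_⟩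
      have := hs (1 / x) (right_ne_zero_of_mul hx)
      have hx0 : 0 < x := one_div_pos.mp (hc.trans_le this.1)
      exact ⟨(one_div_le hx0 h0).mp this.2, (le_one_div hc hx0).mp this.1⟩

lemma IsCompactlyIntegrable.integral_slashS_mul {φ : ℝ → ℂ} (w : ℝ)
    (μ : ℂ) (G : ℝ → ℂ) : ∫ x in Set.Ioi (0 : ℝ), KohnenPlus.slashS w μ φ x * G x =
      ∫ x in Set.Ioi (0 : ℝ), φ x * ((((x ^ (w - 2) : ℝ) : ℂ)) * μ * G (1 / x)) := by
  rw [← integral_comp_rpow_Ioi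
    (fun x => φ x * ((((x ^ (w - 2) : ℝ) : ℂ)) * μ * G (1 / x))) (p := -1) (by norm_num)]
  refine setIntegral_congr_fun measurableSet_Ioi fun x hx => ?_
  have hx : 0 < x := hx
  rw [← slashS_change w μ φ hx, smul_mul_assoc]
  have h1 : 1 / x ^ (-1 : ℝ) = x := by rw [Real.rpow_neg_one]; simp
  rw [h1]
  congr 1
  ring

/-! ### The series on the imaginary axis and the `L`-series -/

lemma subExp_div (h : ℕ) : SubExp fun n => (n : ℂ) / h := by
  have := subExp_intCast.mul (subExp_of_norm_le (c := fun _ => 1 / (h : ℂ)) fun _ => le_rfl)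
  simpa [div_eq_mul_inv] using this

lemma IsCoeff.freq {a b : ℤ → ℂ} (hc : IsCoeff a b) (h : ℕ) :
    IsCoeff (fun n => a n * ((n : ℂ) / h)) (fun n => b n * ((n : ℂ) / h)) :=
  hc.mul (subExp_div h)

lemma hasWirt_maassSeries {κ : ℝ} (hκ : 1 ≤ κ) {a b : ℤ → ℂ} (hc : IsCoeff a b) {h : ℕ}
    (hh : 0 < h) {z : ℂ} (hz : 0 < z.im) :
    HasWirt (maassSeries κ h a b)
      (2 * π * I * maassSeries κ h (fun n => a n * ((n : ℂ) / h)) (fun n => b n * ((n : ℂ) / h)) z -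
        ((z.im ^ (-κ) : ℝ) : ℂ) * conj (holSeries h (shadow κ h b) z))
      (((z.im ^ (-κ) : ℝ) : ℂ) * conj (holSeries h (shadow κ h b) z)) z := by
  have h1 := (hasWirt_of_hasDerivAt (hasDerivAt_holSeries hc.lower hc.subExp_left hh hz)).add
    (hasWirt_nonholSeries hκ hc.neg hc.subExp_right hh hz)
  rw [zero_add] at h1
  convert! h1 using 1
  rw [maassSeries]
  ring

lemma analyticAt_maassSeries {κ : ℝ} (hκ : 1 ≤ κ) {a b : ℤ → ℂ} (hc : IsCoeff a b) {h : ℕ}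
    (hh : 0 < h) {z : ℂ} (hz : 0 < z.im) : AnalyticAt ℝ (maassSeries κ h a b) z := by
  have h1 : DifferentiableOn ℂ (holSeries h a) {z | 0 < z.im} := fun w hw =>
    (hasDerivAt_holSeries hc.lower hc.subExp_left hh hw).differentiableAt.differentiableWithinAt
  have h2 := ((h1.analyticAt (isOpen_im_pos.mem_nhds hz)).restrictScalars (𝕜 := ℝ)).add
    (analyticAt_nonholSeries hκ hc.neg hc.subExp_right hh hz)
  exact h2

lemma differentiableOn_holSeries_shadow {κ : ℝ} (hκ : 1 ≤ κ) {b : ℤ → ℂ}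
    (hb : ∀ n : ℤ, 0 ≤ n → b n = 0) (hs : SubExp b) {h : ℕ} (hh : 0 < h) :
    DifferentiableOn ℂ (holSeries h (shadow κ h b)) {z | 0 < z.im} := fun _ hw =>
  (hasDerivAt_holSeries (shadow_lower hb) (subExp_shadow hκ hh hb hs) hh
    hw).differentiableAt.differentiableWithinAt

lemma continuousOn_maassSeries_axis {κ : ℝ} (hκ : 1 ≤ κ) {a b : ℤ → ℂ} (hc : IsCoeff a b) {h : ℕ}
    (hh : 0 < h) : ContinuousOn (fun y : ℝ => maassSeries κ h a b (y * I)) (Set.Ioi 0) := by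
  intro y hy
  have h1 := (analyticAt_maassSeries hκ hc hh (z := y * I) (by simpa using hy)).continuousAt
  exact (ContinuousAt.comp (f := fun y : ℝ => (y : ℂ) * I) h1
    (by fun_prop)).continuousWithinAt

lemma IsCompactlyIntegrable.tsum_integral {φ : ℝ → ℂ} (h : IsCompactlyIntegrable φ)
    {t : ℤ → ℝ → ℂ} (ht : ∀ n, ContinuousOn (t n) (Set.Ioi 0))
    (hb : ∀ c₁ c₂ : ℝ, 0 < c₁ → ∃ B : ℤ → ℝ, Summable B ∧
      ∀ n x, c₁ ≤ x → x ≤ c₂ → ‖t n x‖ ≤ B n) :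
    ∑' n, ∫ x in Set.Ioi (0 : ℝ), φ x * t n x = ∫ x in Set.Ioi (0 : ℝ), φ x * ∑' n, t n x := by
  obtain ⟨c₁, c₂, hc, hs⟩ := h.support
  obtain ⟨B, hB, hB'⟩ := hb c₁ c₂ hc
  simp_rw [← tsum_mul_left]
  refine integral_tsum_of_summable_integral_norm (fun n => (h.mul (ht n)).integrable.integrableOn)
    (Summable.of_nonneg_of_le (fun n => integral_nonneg fun _ => norm_nonneg _) (fun n => ?_)
      (hB.mul_left (∫ x in Set.Ioi (0 : ℝ), ‖φ x‖)))
  rw [← integral_mul_const]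
  refine integral_mono (h.mul (ht n)).integrable.integrableOn.norm
    (h.integrable.norm.integrableOn.mul_const _) fun x => ?_
  by_cases hx : φ x = 0
  · simp [hx]
  · simp only [norm_mul]
    exact mul_le_mul_of_nonneg_left (hB' n x (hs x hx).1 (hs x hx).2) (norm_nonneg _)

lemma laplace_eq (h : ℕ) (n : ℤ) (φ : ℝ → ℂ) :
    laplace φ (2 * π * ((n : ℝ) / h)) = ∫ x in Set.Ioi (0 : ℝ), φ x * expTerm h n (x * I) := by
  refine setIntegral_congr_fun measurableSet_Ioi fun x _ => ?_
  rw [mul_comm, expTerm]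
  congr 1
  push_cast
  congr 1
  linear_combination (-2 * π * (n / h) * x) * I_sq

lemma tsum_laplace {a : ℤ → ℂ} (ha : ∃ N : ℤ, ∀ n < N, a n = 0) (hs : SubExp a) {h : ℕ}
    (hh : 0 < h) {φ : ℝ → ℂ} (hφ : IsCompactlyIntegrable φ) :
    ∑' n : ℤ, a n * laplace φ (2 * π * ((n : ℝ) / h)) =
      ∫ x in Set.Ioi (0 : ℝ), φ x * holSeries h a (x * I) := by
  have h1 := hφ.tsum_integral (t := fun n x => a n * expTerm h n (x * I))
    (fun n => by unfold expTerm; fun_prop) (fun c₁ c₂ hc => by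
      obtain ⟨B, hB, hB'⟩ := holomorphic_bound ha hs hh (v₁ := c₂) hc
      exact ⟨B, hB, fun n x h1 h2 => hB' n _ (by simpa using h1) (by simpa using h2)⟩)
  simp only [holSeries]
  rw [← h1]
  refine tsum_congr fun n => ?_
  rw [laplace_eq, ← integral_const_mul]
  refine setIntegral_congr_fun measurableSet_Ioi fun x _ => ?_
  ring

/-- Fubini. With f = -4πn/h the Laplace transform is taken at ft + f/2; integrating
e^{-fxt}(1+t)^{-κ} over t gives `lapKer` at fx, while e^{-fx/2} and x^{1-κ} complete the incomplete
gamma term on the axis. -/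
lemma integral_laplace {κ : ℝ} (hκ : 1 ≤ κ) {h : ℕ} (hh : 0 < h) {n : ℤ} (hn : n < 0) {φ : ℝ → ℂ}
    (hφ : IsCompactlyIntegrable φ) :
    (((-4 * π * ((n : ℝ) / h)) ^ (1 - κ) : ℝ) : ℂ) *
      ∫ t in Set.Ioi (0 : ℝ),
        laplace (twist φ ((2 - κ : ℝ) : ℂ)) (-2 * π * ((n : ℝ) / h) * (2 * t + 1)) /
          (((1 + t) ^ κ : ℝ) : ℂ) =
      ∫ x in Set.Ioi (0 : ℝ), φ x * nonholFn κ h n (x * I) := by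
  set f : ℝ := -4 * π * ((n : ℝ) / h) with hfd
  have hf : 0 < f := neg_freq_pos hh hn
  set ψ : ℝ → ℂ := fun x => twist φ ((2 - κ : ℝ) : ℂ) x * cexp (-(f / 2 * x)) with hψd
  have hψ : IsCompactlyIntegrable ψ := (hφ.twist _).mul (by fun_prop)
  obtain ⟨c₁, c₂, hc, hs⟩ := hψ.support
  let G : ℝ → ℝ → ℂ := fun t x => cexp (-(f * x * t)) * (((1 + t) ^ (-κ) : ℝ) : ℂ) * ψ x
  have hG : Integrable (Function.uncurry G)
      ((volume.restrict (Set.Ioi (0 : ℝ))).prod (volume.restrict (Set.Ioi (0 : ℝ)))) := by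
    -- On the support x ≥ c₁, so the integrand is dominated by e^{-f c₁ t} ‖ψ(x)‖, a product.
    have hdom := (integrableOn_exp_mul_Ioi (show -(f * c₁) < 0 by nlinarith) 0).mul_prod
      hψ.integrable.norm.integrableOn (ν := volume.restrict (Set.Ioi (0 : ℝ)))
    refine Integrable.mono' hdom ?_ ?_
    · refine AEStronglyMeasurable.mul (AEStronglyMeasurable.mul ?_ ?_) ?_
      · exact Continuous.aestronglyMeasurable (by fun_prop)
      · refine Measurable.aestronglyMeasurable ?_
        exact measurable_ofReal.comp ((measurable_const.add measurable_fst).pow_const _)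
      · exact (hψ.integrable.integrableOn.aestronglyMeasurable
          (μ := volume.restrict (Set.Ioi (0 : ℝ)))).comp_snd
    · rw [Measure.prod_restrict]
      filter_upwards [ae_restrict_mem (measurableSet_Ioi.prod measurableSet_Ioi)] with p hp
      have hp1 : 0 < p.1 := hp.1
      have e : Function.uncurry G p =
          cexp (-((f * p.2 : ℝ) * p.1)) * (((1 + p.1) ^ (-κ) : ℝ) : ℂ) * ψ p.2 := by
        simp [G, Function.uncurry]
      rw [e, norm_mul]
      by_cases hx : ψ p.2 = 0
      · simp [hx]
      · refine mul_le_mul_of_nonneg_right ?_ (norm_nonneg _)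
        refine (norm_lapKer_integrand_le (by linarith) _ hp1).trans (Real.exp_le_exp.mpr ?_)
        rw [ofReal_re]
        have := mul_le_mul_of_nonneg_left (hs _ hx).1 hf.le
        nlinarith
  have h1 : ∀ t ∈ Set.Ioi (0 : ℝ),
      laplace (twist φ ((2 - κ : ℝ) : ℂ)) (-2 * π * ((n : ℝ) / h) * (2 * t + 1)) /
          (((1 + t) ^ κ : ℝ) : ℂ) = ∫ x in Set.Ioi (0 : ℝ), G t x := by
    intro t ht
    have ht : 0 < t := ht
    rw [laplace, div_eq_mul_inv, ← integral_mul_const]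
    refine setIntegral_congr_fun measurableSet_Ioi fun x _ => ?_
    have e1 : (Real.exp (-(-2 * π * ((n : ℝ) / h) * (2 * t + 1) * x)) : ℂ) =
        cexp (-(f * x * t)) * cexp (-(f / 2 * x)) := by
      rw [← Complex.exp_add, ofReal_exp, hfd]
      push_cast
      ring_nf
    have e2 : (((1 + t) ^ κ : ℝ) : ℂ)⁻¹ = (((1 + t) ^ (-κ) : ℝ) : ℂ) := by
      rw [Real.rpow_neg (by linarith)]; push_cast; rfl
    simp only [G, ψ]
    rw [e1, e2]
    ring
  rw [setIntegral_congr_fun measurableSet_Ioi h1, integral_integral_swap hG, ← integral_const_mul]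
  refine setIntegral_congr_fun measurableSet_Ioi fun x hx => ?_
  have hx : 0 < x := hx
  have e1 : ∫ t in Set.Ioi (0 : ℝ), G t x = lapKer κ ((f * x : ℝ) : ℂ) * ψ x := by
    simp only [G]
    rw [integral_mul_const, lapKer]
    push_cast
    rfl
  rw [e1, nonholFn_eq hh hn (by simpa using hx), nonholKer, ← hfd]
  simp only [ψ, twist]
  have e2 : ((x : ℂ) * I).im = x := by simp
  have e3 : ((x : ℂ) * I).re = 0 := by simp
  rw [e2, e3]
  have e4 : cexp (((2 * π * ((n : ℝ) / h) : ℝ) : ℂ) * ((x : ℂ) + I * ((0 : ℝ) : ℂ))) =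
      cexp (-(f / 2 * x)) := by
    congr 1
    rw [hfd]
    push_cast
    ring
  have e5 : (((2 - κ : ℝ) : ℂ) - 1) = ((1 - κ : ℝ) : ℂ) := by push_cast; ring
  rw [e4, e5]
  push_cast
  ring

/-- A single term is a series whose only nonzero coefficient is 1, so the analyticity of the series
applies. -/
lemma continuousOn_nonholFn_axis {κ : ℝ} (hκ : 1 ≤ κ) {h : ℕ} (hh : 0 < h) {n : ℤ} (hn : n < 0) :
    ContinuousOn (fun x : ℝ => nonholFn κ h n (x * I)) (Set.Ioi 0) := by
  have hs : SubExp (Pi.single n (1 : ℂ)) := subExp_of_norm_le (D := 1) fun m => by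
    by_cases hm : m = n
    · subst hm; simp
    · simp [hm]
  have hb : ∀ m : ℤ, 0 ≤ m → (Pi.single n (1 : ℂ) : ℤ → ℂ) m = 0 := fun m hm => by
    have : m ≠ n := by omega
    simp [this]
  intro y hy
  have h1 := (analyticAt_nonholSeries hκ hb hs hh (z := y * I) (by simpa using hy)).continuousAt
  have h2 : nonholSeries κ h (Pi.single n (1 : ℂ)) = nonholFn κ h n := by
    funext z
    rw [nonholSeries, tsum_eq_single n]
    · simp
    · intro m hm; simp [hm]
  rw [h2] at h1
  exact (ContinuousAt.comp (f := fun y : ℝ => (y : ℂ) * I) h1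
    (by fun_prop)).continuousWithinAt

lemma tsum_integral_laplace {κ : ℝ} (hκ : 1 ≤ κ) {b : ℤ → ℂ} (hb : ∀ n : ℤ, 0 ≤ n → b n = 0)
    (hs : SubExp b) {h : ℕ} (hh : 0 < h) {φ : ℝ → ℂ} (hφ : IsCompactlyIntegrable φ) :
    ∑' n : ℤ, b n * (((-4 * π * ((n : ℝ) / h)) ^ (1 - κ) : ℝ) : ℂ) *
      ∫ t in Set.Ioi (0 : ℝ),
        laplace (twist φ ((2 - κ : ℝ) : ℂ)) (-2 * π * ((n : ℝ) / h) * (2 * t + 1)) /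
          (((1 + t) ^ κ : ℝ) : ℂ) =
      ∫ x in Set.Ioi (0 : ℝ), φ x * nonholSeries κ h b (x * I) := by
  have h1 := hφ.tsum_integral (t := fun n x => b n * nonholFn κ h n (x * I))
    (fun n => by
      rcases le_or_gt 0 n with hn | hn
      · simpa [hb n hn] using continuousOn_const
      · exact continuousOn_const.mul (continuousOn_nonholFn_axis hκ hh hn)) (fun c₁ c₂ hc => by
      obtain ⟨B, hB, hB'⟩ := nonholKer_bound hκ hb hs hh hc
      refine ⟨fun n => c₁ ^ (1 - κ) * B n, hB.mul_left _, fun n x h1 h2 => ?_⟩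
      have hx : 0 < x := hc.trans_le h1
      have h3 := hB' n x 0 (by simpa using h1) (by simp; positivity)
      rcases le_or_gt 0 n with hn | hn
      · rw [hb n hn, zero_mul, norm_zero] at h3 ⊢
        positivity
      · rw [nonholFn_eq hh hn (by simpa using hx), mul_left_comm, norm_mul]
        have e2 : ((x : ℂ) * I).im = x := by simp
        have e3 : ((x : ℂ) * I).re = 0 := by simp
        rw [e2, e3, ofReal_zero, ← ofReal_cpow hx.le, norm_real,
          Real.norm_of_nonneg (by positivity)]
        exact mul_le_mul (Real.rpow_le_rpow_of_nonpos hc h1 (by linarith)) h3 (norm_nonneg _)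
          (by positivity))
  simp only [nonholSeries]
  rw [← h1]
  refine tsum_congr fun n => ?_
  rcases le_or_gt 0 n with hn | hn
  · simp [hb n hn]
  · rw [mul_assoc, integral_laplace hκ hh hn hφ, ← integral_const_mul]
    refine setIntegral_congr_fun measurableSet_Ioi fun x _ => ?_
    ring

lemma IsCoeff.component {a b : ℤ → ℂ} (h : IsCoeff a b) (j : Fin 2) :
    IsCoeff (component a j) (component b j) where
  lower := by
    obtain ⟨N, hN⟩ := h.lower
    exact ⟨N, fun n hn => by simp [KohnenPlus.component, hN n hn]⟩
  neg := fun n hn => by simp [KohnenPlus.component, h.neg n hn]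
  subExp_left := h.subExp_left.mono fun n => by
    unfold KohnenPlus.component; split_ifs <;> simp
  subExp_right := h.subExp_right.mono fun n => by
    unfold KohnenPlus.component; split_ifs <;> simp

lemma integral_add_maassSeries {κ : ℝ} (hκ : 1 ≤ κ) {a b : ℤ → ℂ} (hc : IsCoeff a b) {h : ℕ}
    (hh : 0 < h) {φ : ℝ → ℂ} (hφ : IsCompactlyIntegrable φ) :
    (∫ x in Set.Ioi (0 : ℝ), φ x * holSeries h a (x * I)) +
      ∫ x in Set.Ioi (0 : ℝ), φ x * nonholSeries κ h b (x * I) =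
    ∫ x in Set.Ioi (0 : ℝ), φ x * maassSeries κ h a b (x * I) := by
  have c1 : ContinuousOn (fun y : ℝ => holSeries h a (y * I)) (Set.Ioi 0) := by
    intro y hy
    have h1 := (hasDerivAt_holSeries hc.lower hc.subExp_left hh (z := y * I)
      (by simpa using hy)).continuousAt
    exact (ContinuousAt.comp (f := fun y : ℝ => (y : ℂ) * I) h1
      (by fun_prop)).continuousWithinAt
  have c2 : ContinuousOn (fun y : ℝ => nonholSeries κ h b (y * I)) (Set.Ioi 0) := by
    refine ((continuousOn_maassSeries_axis hκ hc hh).sub c1).congr fun y _ => ?_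
    simp [maassSeries]
  rw [← integral_add (hφ.mul c1).integrable.integrableOn (hφ.mul c2).integrable.integrableOn]
  refine setIntegral_congr_fun measurableSet_Ioi fun x _ => ?_
  simp only [maassSeries]
  ring

/-- The `j`-th component of the vector-valued function `F`. -/
def vecF (κ : ℝ) (a b : ℤ → ℂ) (j : Fin 2) : ℂ → ℂ :=
  maassSeries κ 4 (component a j) (component b j)

lemma LSeriesF_eq {κ : ℝ} (hκ : 1 ≤ κ) {a b : ℤ → ℂ} (hc : IsCoeff a b) {φ : ℝ → ℂ}
    (hφ : IsCompactlyIntegrable φ) (j : Fin 2) :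
    LSeriesF κ a b φ j = ∫ x in Set.Ioi (0 : ℝ), φ x * vecF κ a b j (x * I) := by
  have hj := hc.component j
  rw [vecF, ← integral_add_maassSeries hκ hj four_pos hφ, ← tsum_laplace hj.lower hj.subExp_left
    four_pos hφ, ← tsum_integral_laplace hκ hj.neg hj.subExp_right four_pos hφ]
  simp [LSeriesF]

/-- The `j`-th component of `(2πi)⁻¹ ∂F/∂u`. -/
def vecF' (κ : ℝ) (a b : ℤ → ℂ) (j : Fin 2) : ℂ → ℂ :=
  maassSeries κ 4 (fun n => component a j n * ((n : ℂ) / (4 : ℕ)))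
    (fun n => component b j n * ((n : ℂ) / (4 : ℕ)))

/-- Since φ_{3-κ} = (φ_2)_{2-κ}, the additional sums form the L-series of (2πi)⁻¹ ∂F/∂u at φ_2, and
φ_2(x) = x φ(x). The factor -2πx is the product of τ = ix and 2πi. -/
lemma LSeriesDeltaF_eq {κ : ℝ} (hκ : 1 ≤ κ) {a b : ℤ → ℂ} (hc : IsCoeff a b) {φ : ℝ → ℂ}
    (hφ : IsCompactlyIntegrable φ) (j : Fin 2) :
    LSeriesDeltaF κ a b φ j = ∫ x in Set.Ioi (0 : ℝ), φ x *
      (((κ / 2 : ℝ) : ℂ) * vecF κ a b j (x * I) - 2 * π * x * vecF' κ a b j (x * I)) := by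
  have hj := (hc.component j).freq 4
  have hφ2 := hφ.twist 2
  have e1 : twist φ ((3 - κ : ℝ) : ℂ) = twist (twist φ 2) ((2 - κ : ℝ) : ℂ) := by
    rw [hφ.twist_twist]
    congr 1
    push_cast
    ring
  have e2 : LSeriesDeltaF κ a b φ j = ((κ / 2 : ℝ) : ℂ) * LSeriesF κ a b φ j -
      2 * π * ∫ x in Set.Ioi (0 : ℝ), twist φ 2 x * vecF' κ a b j (x * I) := by
    rw [vecF', ← integral_add_maassSeries hκ hj four_pos hφ2, ← tsum_laplace hj.lower
      hj.subExp_left four_pos hφ2, ← tsum_integral_laplace hκ hj.neg hj.subExp_right four_pos hφ2]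
    simp only [LSeriesDeltaF, e1, Nat.cast_ofNat]
    ring
  have c1 : ContinuousOn (fun x : ℝ => ((κ / 2 : ℝ) : ℂ) * vecF κ a b j (x * I)) (Set.Ioi 0) :=
    continuousOn_const.mul (continuousOn_maassSeries_axis hκ (hc.component j) four_pos)
  have c2 : ContinuousOn (fun x : ℝ => 2 * π * x * vecF' κ a b j (x * I)) (Set.Ioi 0) :=
    ContinuousOn.mul (by fun_prop) (continuousOn_maassSeries_axis hκ hj four_pos)
  rw [e2, LSeriesF_eq hκ hc hφ, ← integral_const_mul, ← integral_const_mul]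
  simp_rw [mul_sub]
  rw [integral_sub (hφ.mul c1).integrable.integrableOn (hφ.mul c2).integrable.integrableOn]
  congr 1
  · refine setIntegral_congr_fun measurableSet_Ioi fun x _ => ?_
    ring
  · refine setIntegral_congr_fun measurableSet_Ioi fun x _ => ?_
    simp only [twist, show (2 : ℂ) - 1 = 1 by norm_num, cpow_one]
    ring

/-! ### The transformation law under `S` -/

/-- `g` is harmonic of weight `κ` with `∂g/∂u = g'` and `∂g/∂τ̄ = v^{-κ} \overline{H}`. -/
structure IsHarm (κ : ℝ) (g g' H : ℂ → ℂ) : Prop where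
  holomorphic : DifferentiableOn ℂ H {z | 0 < z.im}
  wirt : ∀ z : ℂ, 0 < z.im → HasWirt g (g' z - ((z.im ^ (-κ) : ℝ) : ℂ) * conj (H z))
    (((z.im ^ (-κ) : ℝ) : ℂ) * conj (H z)) z

lemma isHarm_maassSeries {κ : ℝ} (hκ : 1 ≤ κ) {a b : ℤ → ℂ} (hc : IsCoeff a b) {h : ℕ}
    (hh : 0 < h) : IsHarm κ (maassSeries κ h a b)
      (fun z => 2 * π * I * maassSeries κ h (fun n => a n * ((n : ℂ) / h))
        (fun n => b n * ((n : ℂ) / h)) z) (holSeries h (shadow κ h b)) where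
  holomorphic := differentiableOn_holSeries_shadow hκ hc.neg hc.subExp_right hh
  wirt := fun _ hz => hasWirt_maassSeries hκ hc hh hz

lemma IsHarm.linear_comb {κ : ℝ} {g₀ g₀' H₀ g₁ g₁' H₁ : ℂ → ℂ} (h₀ : IsHarm κ g₀ g₀' H₀)
    (h₁ : IsHarm κ g₁ g₁' H₁) (α β : ℂ) : IsHarm κ (fun z => α * g₀ z + β * g₁ z)
      (fun z => α * g₀' z + β * g₁' z) (fun z => conj α * H₀ z + conj β * H₁ z) where
  holomorphic := (h₀.holomorphic.const_mul _).add (h₁.holomorphic.const_mul _)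
  wirt := fun z hz => by
    convert! ((h₀.wirt z hz).const_mul α).add ((h₁.wirt z hz).const_mul β) using 1 <;>
    · simp only [map_add, map_mul, conj_conj]
      ring

lemma neg_I_mul_mem {z : ℂ} (hz : 0 < z.im) : 0 < (-I * z).re := by simpa using hz

lemma neg_inv_im {z : ℂ} : (-z⁻¹).im = z.im / normSq z := by
  rw [neg_im, inv_im]; ring

lemma neg_inv_im_pos {z : ℂ} (hz : 0 < z.im) : 0 < (-z⁻¹).im := by
  have h0 : z ≠ 0 := fun h => by simp [h] at hz
  rw [neg_inv_im]
  exact div_pos hz (normSq_pos.mpr h0)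

lemma hasDerivAt_neg_inv {z : ℂ} (hz : z ≠ 0) : HasDerivAt (fun w : ℂ => -w⁻¹) ((z ^ 2)⁻¹) z := by
  simpa using (hasDerivAt_inv hz).fun_neg

lemma hasDerivAt_neg_I_mul_cpow {z : ℂ} (hz : 0 < z.im) (s : ℂ) :
    HasDerivAt (fun w : ℂ => (-I * w) ^ s) (s * (-I * z) ^ (s - 1) * (-I)) z := by
  have h1 : HasDerivAt (fun w : ℂ => -I * w) (-I) z := by
    simpa using (hasDerivAt_id z).const_mul (-I)
  exact h1.cpow_const (Or.inl (neg_I_mul_mem hz))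

lemma mul_cpow_of_re_pos {a b : ℂ} (ha : 0 < a.re) (hb : 0 < b.re) (s : ℂ) :
    (a * b) ^ s = a ^ s * b ^ s := by
  have ha0 : a ≠ 0 := fun h => by simp [h] at ha
  have hb0 : b ≠ 0 := fun h => by simp [h] at hb
  have h1 := abs_lt.mp (abs_arg_lt_pi_div_two_iff.mpr (Or.inl ha))
  have h2 := abs_lt.mp (abs_arg_lt_pi_div_two_iff.mpr (Or.inl hb))
  rw [cpow_def_of_ne_zero (mul_ne_zero ha0 hb0), cpow_def_of_ne_zero ha0, cpow_def_of_ne_zero hb0,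
    (log_mul_eq_add_log_iff ha0 hb0).mpr ⟨by linarith, by linarith⟩, add_mul, Complex.exp_add]

/-- Here |w|² = w conj(w), and for Re w > 0 the arguments of both factors are below π/2, so
principal powers multiply. This converts the automorphy factor of weight κ into that of the shadow,
of weight 2 - κ. -/
lemma cpow_mul_normSq_rpow {w : ℂ} (hw : 0 < w.re) (κ : ℝ) :
    w ^ (-(κ : ℂ)) * ((normSq w ^ κ : ℝ) : ℂ) = conj (w ^ (κ : ℂ)) := by
  have h0 : w ≠ 0 := fun h => by simp [h] at hw
  have harg : w.arg ≠ π := by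
    intro h
    have := (arg_eq_pi_iff.mp h).1
    linarith
  have h1 : conj (w ^ (κ : ℂ)) = (conj w) ^ (κ : ℂ) := by
    have := cpow_conj w (κ : ℂ) harg
    rw [conj_ofReal] at this
    rw [this, conj_conj]
  have h2 : (w * conj w) ^ (κ : ℂ) = w ^ (κ : ℂ) * conj w ^ (κ : ℂ) :=
    mul_cpow_of_re_pos hw (by simpa using hw) _
  rw [h1, ofReal_cpow (normSq_nonneg w), ← mul_conj, h2, ← mul_assoc, ← cpow_add _ _ h0]
  simp

/-- The shadow of `(-iz)^{-κ} g(-1/z)`. -/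
lemma IsHarm.slash {κ : ℝ} {g g' H : ℂ → ℂ} (h : IsHarm κ g g' H) :
    IsHarm κ (fun z => (-I * z) ^ (-(κ : ℂ)) * g (-z⁻¹))
      (fun z => -(κ : ℂ) * (-I * z) ^ (-(κ : ℂ) - 1) * (-I) * g (-z⁻¹) + (-I * z) ^ (-(κ : ℂ)) *
        ((g' (-z⁻¹) - (((-z⁻¹).im ^ (-κ) : ℝ) : ℂ) * conj (H (-z⁻¹))) * (z ^ 2)⁻¹ +
          (((-z⁻¹).im ^ (-κ) : ℝ) : ℂ) * conj (H (-z⁻¹)) * conj ((z ^ 2)⁻¹)))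
      (fun z => (-I * z) ^ (κ : ℂ) * (H (-z⁻¹) * (z ^ 2)⁻¹)) where
  holomorphic := by
    intro z hz
    have hz : 0 < z.im := hz
    have h0 : z ≠ 0 := fun h => by simp [h] at hz
    have e1 := (h.holomorphic _ (neg_inv_im_pos hz)).differentiableAt
      (isOpen_im_pos.mem_nhds (neg_inv_im_pos hz))
    refine DifferentiableAt.differentiableWithinAt ?_
    refine DifferentiableAt.mul (hasDerivAt_neg_I_mul_cpow hz _).differentiableAt
      (DifferentiableAt.mul ?_ ?_)
    · exact DifferentiableAt.comp (g := H) z e1 (hasDerivAt_neg_inv h0).differentiableAt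
    · exact (differentiableAt_pow 2).inv (pow_ne_zero 2 h0)
  wirt := fun z hz => by
    have h0 : z ≠ 0 := fun h => by simp [h] at hz
    have e1 := (hasWirt_of_hasDerivAt (hasDerivAt_neg_I_mul_cpow hz (-(κ : ℂ)))).mul
      ((h.wirt _ (neg_inv_im_pos hz)).comp (p := fun w => -w⁻¹) (hasDerivAt_neg_inv h0))
    -- Im(-1/z) = v/|z|², and |z| = |-iz|.
    have e2 : (((-z⁻¹).im ^ (-κ) : ℝ) : ℂ) =
        ((z.im ^ (-κ) : ℝ) : ℂ) * ((normSq (-I * z) ^ κ : ℝ) : ℂ) := by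
      rw [neg_inv_im, Real.div_rpow hz.le (normSq_nonneg z), Real.rpow_neg (normSq_nonneg z),
        div_inv_eq_mul]
      simp
    have e3 : 0 * g (-z⁻¹) + (-I * z) ^ (-(κ : ℂ)) *
        ((((-z⁻¹).im ^ (-κ) : ℝ) : ℂ) * conj (H (-z⁻¹)) * conj ((z ^ 2)⁻¹)) =
        ((z.im ^ (-κ) : ℝ) : ℂ) * conj ((-I * z) ^ (κ : ℂ) * (H (-z⁻¹) * (z ^ 2)⁻¹)) := by
      rw [e2, map_mul (starRingEnd ℂ), map_mul (starRingEnd ℂ), ← cpow_mul_normSq_rpow (neg_I_mul_mem hz)]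
      ring
    rw [e3] at e1
    convert! e1 using 1
    rw [← e3]
    ring

/-- Two harmonic functions related on the imaginary axis, together with their derivatives, as
`g₂` and `g₁|S` are related on the upper half-plane. -/
lemma IsHarm.eq_slash {κ : ℝ} {g₁ g₁' H₁ g₂ g₂' H₂ : ℂ → ℂ} (h₁ : IsHarm κ g₁ g₁' H₁)
    (h₂ : IsHarm κ g₂ g₂' H₂)
    (hax : ∀ y : ℝ, 0 < y → g₂ (y * I) = ((y ^ (-κ) : ℝ) : ℂ) * g₁ ((1 / y : ℝ) * I))
    (hax' : ∀ y : ℝ, 0 < y → κ / 2 * g₂ (y * I) + y * I * g₂' (y * I) =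
      -(((y ^ (-κ) : ℝ) : ℂ) *
        (κ / 2 * g₁ ((1 / y : ℝ) * I) + (1 / y : ℝ) * I * g₁' ((1 / y : ℝ) * I))))
    {z : ℂ} (hz : 0 < z.im) : g₂ z = (-I * z) ^ (-(κ : ℂ)) * g₁ (-z⁻¹) := by
  have h := h₂.linear_comb h₁.slash 1 (-1)
  have e1 : ∀ y : ℝ, 0 < y → -((y : ℂ) * I)⁻¹ = (1 / y : ℝ) * I := fun y hy => by
    rw [mul_inv, inv_I]; push_cast; ring
  have e2 : ∀ y : ℝ, -I * ((y : ℂ) * I) = y := fun y => by linear_combination -(y : ℂ) * I_sq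
  have e3 : ∀ y : ℝ, 0 < y → ∀ s : ℝ, (y : ℂ) ^ (s : ℂ) = ((y ^ s : ℝ) : ℂ) := fun y hy s =>
    (ofReal_cpow hy.le s).symm
  have key := eq_zero_of_cauchy_data h.holomorphic (fun z hz => ⟨_, h.wirt z hz⟩) ?_ ?_ hz
  · linear_combination key
  · intro y hy
    have := e3 y hy (-κ)
    rw [ofReal_neg] at this
    rw [e1 y hy, e2, this, hax y hy]
    ring
  · intro y hy
    have hyI : 0 < ((y : ℂ) * I).im := by simpa using hy
    have hy0 : (y : ℂ) ≠ 0 := by exact_mod_cast hy.ne'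
    rw [(h.wirt _ hyI).fderiv_apply]
    have t1 := e3 y hy (-κ)
    have t2 := e3 y hy (-κ - 1)
    rw [ofReal_neg] at t1
    rw [ofReal_sub, ofReal_neg, ofReal_one] at t2
    have t3 : ((y : ℂ) * I) ^ 2 = -(y : ℂ) ^ 2 := by rw [mul_pow, I_sq]; ring
    have t4 : ((y ^ (-κ - 1) : ℝ) : ℂ) = ((y ^ (-κ) : ℝ) : ℂ) / y := by
      rw [Real.rpow_sub_one hy.ne']; push_cast; rfl
    simp only [map_one, mul_one]
    have d1 := hax y hy
    have d2 := hax' y hy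
    rw [sub_add_cancel, e1 y hy, e2, t1, t2, t3, t4]
    set P := ((y ^ (-κ) : ℝ) : ℂ)
    -- On the axis z² is real, so the ∂ and ∂̄ parts of g₁ carry the same factor -y^{-2} and add up
    -- to its u-derivative. Inserting `hax` into `hax'` merges the two terms with κ/2 into the κ
    -- produced by differentiating (-iz)^{-κ}.
    have t5 : conj ((-(y : ℂ) ^ 2)⁻¹) = (-(y : ℂ) ^ 2)⁻¹ := by
      simp
    rw [t5, ← add_mul, sub_add_cancel]
    push_cast at d1 d2 ⊢
    rw [d1] at d2
    field_simp at d2 ⊢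
    have hI : (y : ℂ) * I ≠ 0 := mul_ne_zero hy0 I_ne_zero
    apply mul_left_cancel₀ (mul_ne_zero (two_ne_zero (α := ℂ)) I_ne_zero)
    ring_nf at d2 ⊢
    simp only [I_sq] at d2 ⊢
    linear_combination d2

/-! ### The constants of the Weil representation and the law under `S` -/

/-- The integral matrix underlying `ρ_1(S)`. -/
def signMatrix : Matrix (Fin 2) (Fin 2) ℂ := !![-1, 1; 1, 1]

lemma I_cpow_half_sq : ((I : ℂ) ^ (1 / 2 : ℂ)) ^ 2 = I := by
  rw [← cpow_nat_mul]; norm_num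

/-- The point i is fixed by S and η(i) ≠ 0, so the eta values cancel. -/
lemma chiEta_S : chiEta ModularGroup.S = (I ^ (1 / 2 : ℂ))⁻¹ := by
  have h1 : ((ModularGroup.S • UpperHalfPlane.I : ℍ) : ℂ) = I := by
    rw [UpperHalfPlane.modular_S_smul]
    simp
  have h2 : ModularForm.eta I ≠ 0 := ModularForm.eta_ne_zero (by
    simp [UpperHalfPlane.upperHalfPlaneSet])
  rw [chiEta, h1]
  simp only [ModularGroup.S]
  simp
  field_simp

lemma chiEta_S_mul_conj : chiEta ModularGroup.S * conj (chiEta ModularGroup.S) = 1 := by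
  rw [mul_conj, chiEta_S, ← Complex.sq_norm]
  have h1 : ‖(I : ℂ) ^ (1 / 2 : ℂ)‖ ^ 2 = 1 := by
    rw [← norm_pow, I_cpow_half_sq, norm_I]
  rw [norm_inv, inv_pow, h1]
  simp

lemma weilS_eq : weilS = (1 / (2 * I) ^ (1 / 2 : ℂ)) • signMatrix := by
  have e : ∀ m : ℕ, cexp (2 * π * I * (-(m : ℂ)) / 2) = (-1) ^ m := fun m => by
    rw [show 2 * (π : ℂ) * I * (-(m : ℂ)) / 2 = m * -(π * I) by ring, Complex.exp_nat_mul,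
      Complex.exp_neg, exp_pi_mul_I]
    norm_num
  ext l' l
  simp only [weilS, signMatrix, Matrix.of_apply, Matrix.smul_apply, smul_eq_mul, e]
  fin_cases l' <;> fin_cases l <;> norm_num

/-- The constant by which `signMatrix` has to be multiplied in the transformation law. -/
lemma exists_const {k : ℕ} (hk : Even k) : ∃ c : ℂ, c ^ 2 = 1 / 2 ∧ ∀ v : Fin 2 → ℂ,
    I ^ ((k : ℂ) - 1 / 2) • weilS'Conj.mulVec (chiEta ModularGroup.S • v) =
      c • signMatrix.mulVec v := by
  refine ⟨I ^ ((k : ℂ) - 1 / 2) * conj (1 / (2 * I) ^ (1 / 2 : ℂ)), ?_, fun v => ?_⟩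
  · have h1 : (I ^ ((k : ℂ) - 1 / 2)) ^ 2 = -I := by
      rw [← cpow_nat_mul, show ((2 : ℕ) : ℂ) * ((k : ℂ) - 1 / 2) = ((2 * k : ℕ) : ℂ) - 1 by
        push_cast; ring, cpow_sub _ _ I_ne_zero, cpow_natCast, cpow_one, pow_mul, I_sq,
        hk.neg_one_pow]
      simp
    have h2 : ((2 * I) ^ (1 / 2 : ℂ)) ^ 2 = 2 * I := by
      rw [← cpow_nat_mul]; norm_num
    rw [mul_pow, h1, ← map_pow, div_pow, h2]
    simp [Complex.conj_ofNat]
    linear_combination (-1 / 2) * I_sq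
  · have h3 : weilS'Conj = (conj (chiEta ModularGroup.S) * conj (1 / (2 * I) ^ (1 / 2 : ℂ))) •
        signMatrix := by
      rw [weilS'Conj, weilS', weilS_eq]
      ext l' l
      simp only [Matrix.map_apply, Matrix.smul_apply, smul_eq_mul, map_mul]
      have : conj (signMatrix l' l) = signMatrix l' l := by
        fin_cases l' <;> fin_cases l <;> simp [signMatrix]
      rw [this]
      ring
    rw [h3, Matrix.smul_mulVec, Matrix.mulVec_smul, smul_smul, smul_smul]
    congr 1
    linear_combination (I ^ ((k : ℂ) - 1 / 2) * conj (1 / (2 * I) ^ (1 / 2 : ℂ))) *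
      chiEta_S_mul_conj

/-- After x ↦ 1/x the slashed test function becomes φ tested against μ x^{-κ} G(1/x), so a
functional equation is the vanishing of φ against one continuous function. The sign s is 1 for F and
-1 for δ_κ F. -/
lemma IsTestFamily.axis_relation {S : Set (ℝ → ℂ)} (hS : IsTestFamily S) {κ : ℝ} {μ c s w : ℂ}
    {W : Matrix (Fin 2) (Fin 2) ℂ}
    (hW : ∀ v : Fin 2 → ℂ, w • W.mulVec (μ • v) = c • signMatrix.mulVec v) {G : Fin 2 → ℝ → ℂ}
    (hG : ∀ j, ContinuousOn (G j) (Set.Ioi 0))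
    (h : ∀ φ ∈ S, (fun j => ∫ x in Set.Ioi (0 : ℝ), φ x * G j x) =
      s • w • W.mulVec fun j => ∫ x in Set.Ioi (0 : ℝ), slashS (2 - κ) μ φ x * G j x)
    {y : ℝ} (hy : 0 < y) (j : Fin 2) : G j y = s * c *
      (signMatrix j 0 * (((y ^ (-κ) : ℝ) : ℂ) * G 0 (1 / y)) +
        signMatrix j 1 * (((y ^ (-κ) : ℝ) : ℂ) * G 1 (1 / y))) := by
  have hG' : ∀ l, ContinuousOn (fun y : ℝ => ((y ^ (-κ) : ℝ) : ℂ) * G l (1 / y)) (Set.Ioi 0) := by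
    intro l
    refine ContinuousOn.mul (continuous_ofReal.comp_continuousOn
      (ContinuousOn.rpow_const continuousOn_id fun x hx => Or.inl (ne_of_gt hx))) ?_
    refine (hG l).comp (ContinuousOn.div continuousOn_const continuousOn_id
      fun x hx => ne_of_gt hx) fun x hx => ?_
    have hx : 0 < x := hx
    exact one_div_pos.mpr hx
  have := hS.eq_zero (G := fun y => G j y - s * c *
      (signMatrix j 0 * (((y ^ (-κ) : ℝ) : ℂ) * G 0 (1 / y)) +
        signMatrix j 1 * (((y ^ (-κ) : ℝ) : ℂ) * G 1 (1 / y))))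
    ((hG j).sub (continuousOn_const.mul ((continuousOn_const.mul (hG' 0)).add
      (continuousOn_const.mul (hG' 1))))) ?_ hy
  · exact sub_eq_zero.mp this
  · intro φ hφ
    have hφi := (hS.isTest φ hφ).isCompactlyIntegrable
    have h1 := congrFun (h φ hφ) j
    have h2 : (fun j => ∫ x in Set.Ioi (0 : ℝ), slashS (2 - κ) μ φ x * G j x) =
        μ • fun l => ∫ x in Set.Ioi (0 : ℝ), φ x * (((x ^ (-κ) : ℝ) : ℂ) * G l (1 / x)) := by
      funext l
      rw [IsCompactlyIntegrable.integral_slashS_mul, Pi.smul_apply, smul_eq_mul,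
        ← integral_const_mul, show 2 - κ - 2 = -κ by ring]
      refine setIntegral_congr_fun measurableSet_Ioi fun x _ => ?_
      ring
    rw [h2, hW] at h1
    simp only [Pi.smul_apply, smul_eq_mul, Matrix.mulVec, dotProduct, Fin.sum_univ_two] at h1
    have i1 := fun l => (hφi.mul (hG' l)).integrable.integrableOn (s := Set.Ioi (0 : ℝ))
    have i2 := (hφi.mul (hG j)).integrable.integrableOn (s := Set.Ioi (0 : ℝ))
    have e : ∀ x : ℝ, φ x * (G j x - s * c *
        (signMatrix j 0 * (((x ^ (-κ) : ℝ) : ℂ) * G 0 (1 / x)) +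
          signMatrix j 1 * (((x ^ (-κ) : ℝ) : ℂ) * G 1 (1 / x)))) =
        φ x * G j x - (s * c * signMatrix j 0 * (φ x * (((x ^ (-κ) : ℝ) : ℂ) * G 0 (1 / x))) +
          s * c * signMatrix j 1 * (φ x * (((x ^ (-κ) : ℝ) : ℂ) * G 1 (1 / x)))) := fun x => by ring
    have i3 := (i1 0).const_mul (s * c * signMatrix j 0)
    have i4 := (i1 1).const_mul (s * c * signMatrix j 1)
    have i5 : IntegrableOn (fun x => s * c * signMatrix j 0 *
        (φ x * (((x ^ (-κ) : ℝ) : ℂ) * G 0 (1 / x))) +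
          s * c * signMatrix j 1 * (φ x * (((x ^ (-κ) : ℝ) : ℂ) * G 1 (1 / x))))
        (Set.Ioi 0) := i3.add i4
    simp_rw [e]
    refine (integral_sub i2 i5).trans ?_
    rw [integral_add i3 i4, integral_const_mul, integral_const_mul, h1]
    ring

/-- The functional equations of the `L`-series imply the transformation law under `S`. -/
theorem vecF_transform {k : ℕ} (hk0 : 0 < k) (hk : Even k) {a b : ℤ → ℂ} (hc : IsCoeff a b)
    {S : Set (ℝ → ℂ)} (hS : IsTestFamily S)
    (hL : ∀ φ ∈ S, LSeriesF ((k : ℝ) - 1 / 2) a b φ = I ^ ((k : ℂ) - 1 / 2) •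
      weilS'Conj.mulVec (LSeriesF ((k : ℝ) - 1 / 2) a b
        (slashS (2 - ((k : ℝ) - 1 / 2)) (chiEta ModularGroup.S) φ)))
    (hLδ : ∀ φ ∈ S, LSeriesDeltaF ((k : ℝ) - 1 / 2) a b φ = -(I ^ ((k : ℂ) - 1 / 2) •
      weilS'Conj.mulVec (LSeriesDeltaF ((k : ℝ) - 1 / 2) a b
        (slashS (2 - ((k : ℝ) - 1 / 2)) (chiEta ModularGroup.S) φ)))) :
    ∃ c : ℂ, c ^ 2 = 1 / 2 ∧ ∀ z : ℂ, 0 < z.im → ∀ j, vecF ((k : ℝ) - 1 / 2) a b j z =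
      (-I * z) ^ (-((k : ℂ) - 1 / 2)) * (c * (signMatrix j 0 * vecF ((k : ℝ) - 1 / 2) a b 0 (-z⁻¹) +
        signMatrix j 1 * vecF ((k : ℝ) - 1 / 2) a b 1 (-z⁻¹))) := by
  obtain ⟨c, hc2, hW⟩ := exists_const hk
  refine ⟨c, hc2, fun z hz j => ?_⟩
  set κ : ℝ := (k : ℝ) - 1 / 2 with hκd
  have hκ : 1 ≤ κ := by
    have : (2 : ℝ) ≤ k := by
      obtain ⟨m, hm⟩ := hk
      exact_mod_cast (by omega : 2 ≤ k)
    linarith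
  have cF := fun j => continuousOn_maassSeries_axis hκ (hc.component j) four_pos
  have cF' := fun j => continuousOn_maassSeries_axis hκ ((hc.component j).freq 4) four_pos
  have ax := fun (y : ℝ) (hy : 0 < y) (j : Fin 2) => hS.axis_relation (κ := κ) (s := 1) hW
    (G := fun j x => vecF κ a b j (x * I)) cF (fun φ hφ => by
      have hφi := (hS.isTest φ hφ).isCompactlyIntegrable
      have := hL φ hφ
      have e1 := funext fun j => LSeriesF_eq hκ hc hφi j
      have e2 : LSeriesF κ a b (slashS (2 - κ) (chiEta ModularGroup.S) φ) = _ := funext fun j =>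
        LSeriesF_eq hκ hc (hφi.slashS (2 - κ) (chiEta ModularGroup.S)) j
      rw [e1, e2] at this
      rw [this, one_smul]) hy j
  have axδ := fun (y : ℝ) (hy : 0 < y) (j : Fin 2) => hS.axis_relation (κ := κ) (s := -1) hW
    (G := fun j x => ((κ / 2 : ℝ) : ℂ) * vecF κ a b j (x * I) - 2 * π * x * vecF' κ a b j (x * I))
    (fun j => (continuousOn_const.mul (cF j)).sub (ContinuousOn.mul (by fun_prop) (cF' j)))
    (fun φ hφ => by
      have hφi := (hS.isTest φ hφ).isCompactlyIntegrable
      have := hLδ φ hφ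
      have e1 := funext fun j => LSeriesDeltaF_eq hκ hc hφi j
      have e2 : LSeriesDeltaF κ a b (slashS (2 - κ) (chiEta ModularGroup.S) φ) = _ := funext fun j =>
        LSeriesDeltaF_eq hκ hc (hφi.slashS (2 - κ) (chiEta ModularGroup.S)) j
      rw [e1, e2] at this
      rw [this, neg_smul, one_smul]) hy j
  have hF := fun j => isHarm_maassSeries hκ (hc.component j) (h := 4) four_pos
  have hcomb := (hF 0).linear_comb (hF 1) (c * signMatrix j 0) (c * signMatrix j 1)
  have key := hcomb.eq_slash (hF j) ?_ ?_ hz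
  · have e : -((k : ℂ) - 1 / 2) = -(κ : ℂ) := by rw [hκd]; push_cast; ring
    rw [e]
    refine key.trans ?_
    simp only [vecF]
    ring
  · intro y hy
    have := ax y hy j
    simp only [vecF] at this
    rw [this]
    ring
  · intro y hy
    have := axδ y hy j
    simp only [vecF, vecF'] at this
    push_cast at this ⊢
    -- The factor 2πi in ∂F/∂u meets τ = iy, so the two forms of δ_κ F on the axis differ by I² =
    -- -1.
    linear_combination this + (2 * π * y * maassSeries κ 4
      (fun n => component a j n * ((n : ℂ) / (4 : ℕ)))
      (fun n => component b j n * ((n : ℂ) / (4 : ℕ))) (y * I) +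
        2 * π * c * ((y ^ (-κ) : ℝ) : ℂ) * (1 / y) * (signMatrix j 0 * maassSeries κ 4
          (fun n => component a 0 n * ((n : ℂ) / (4 : ℕ)))
          (fun n => component b 0 n * ((n : ℂ) / (4 : ℕ))) (1 / y * I) +
        signMatrix j 1 * maassSeries κ 4 (fun n => component a 1 n * ((n : ℂ) / (4 : ℕ)))
          (fun n => component b 1 n * ((n : ℂ) / (4 : ℕ))) (1 / y * I))) * I_sq

/-! ### Generators of Γ_0(4) -/

/-- Division with the remainder of least absolute value; the plain remainder would not make the
descent for Γ_0(4) terminate. -/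
lemma exists_two_mul_abs_add_mul_le {c : ℤ} (hc : c ≠ 0) (d : ℤ) :
    ∃ m : ℤ, 2 * |d + m * c| ≤ |c| := by
  have h1 := Int.emod_nonneg d hc
  have h2 := Int.emod_lt_abs d hc
  have h3 := Int.emod_add_mul_ediv d c
  rcases le_or_gt (2 * (d % c)) |c| with h | h
  · refine ⟨-(d / c), ?_⟩
    rw [show d + -(d / c) * c = d % c by linarith, abs_of_nonneg h1]
    exact h
  · refine ⟨-(d / c) - SignType.sign c, ?_⟩
    have h4 : (SignType.sign c : ℤ) * c = |c| := sign_mul_self c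
    rw [show d + (-(d / c) - (SignType.sign c : ℤ)) * c = d % c - |c| by linarith, abs_of_neg
      (by linarith)]
    linarith

lemma SL2_coe_mul_apply (γ δ : SL(2, ℤ)) (i j : Fin 2) :
    (γ * δ) i j = γ i 0 * δ 0 j + γ i 1 * δ 1 j := by
  rw [Matrix.SpecialLinearGroup.coe_mul, Matrix.mul_apply, Fin.sum_univ_two]

lemma coe_conj_T_zpow (m : ℤ) :
    (((ModularGroup.S * ModularGroup.T ^ (-4 : ℤ) * ModularGroup.S⁻¹) ^ m : SL(2, ℤ)) :
      Matrix (Fin 2) (Fin 2) ℤ) = !![1, 0; 4 * m, 1] := by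
  rw [conj_zpow, ← zpow_mul, Matrix.SpecialLinearGroup.coe_mul, Matrix.SpecialLinearGroup.coe_mul,
    ModularGroup.coe_T_zpow, Matrix.SpecialLinearGroup.coe_inv, ModularGroup.coe_S,
    Matrix.adjugate_fin_two_of]
  ext i j
  fin_cases i <;> fin_cases j <;> simp [Matrix.mul_apply]

lemma SL2_det (γ : SL(2, ℤ)) : γ 0 0 * γ 1 1 - γ 0 1 * γ 1 0 = 1 := by
  have := γ.det_coe
  rwa [Matrix.det_fin_two] at this

lemma mem_of_lower_left_eq_zero {H : Subgroup SL(2, ℤ)} (hT : ModularGroup.T ∈ H)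
    (hneg : (-1 : SL(2, ℤ)) ∈ H) {γ : SL(2, ℤ)} (hc : γ 1 0 = 0) : γ ∈ H := by
  have hd := SL2_det γ
  rw [hc, mul_zero, sub_zero] at hd
  rcases Int.mul_eq_one_iff_eq_one_or_neg_one.mp hd with ⟨h1, h2⟩ | ⟨h1, h2⟩
  · have : γ = ModularGroup.T ^ (γ 0 1) := by
      ext i j
      fin_cases i <;> fin_cases j <;> simp [ModularGroup.coe_T_zpow, h1, h2, hc]
    rw [this]
    exact H.zpow_mem hT _
  · have : γ = -1 * ModularGroup.T ^ (-(γ 0 1)) := by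
      ext i j
      fin_cases i <;> fin_cases j <;>
        simp [ModularGroup.coe_T_zpow, h1, h2, hc, Matrix.SpecialLinearGroup.coe_neg]
    rw [this]
    exact H.mul_mem hneg (H.zpow_mem hT _)

/-- `Γ₀(4)` is generated by `T`, `-1` and `(1 0; 4 1)`. -/
lemma Gamma0_four_le {H : Subgroup SL(2, ℤ)} (hT : ModularGroup.T ∈ H)
    (hneg : (-1 : SL(2, ℤ)) ∈ H)
    (hU : ModularGroup.S * ModularGroup.T ^ (-4 : ℤ) * ModularGroup.S⁻¹ ∈ H) :
    CongruenceSubgroup.Gamma0 4 ≤ H := by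
  suffices h : ∀ N : ℕ, ∀ γ : SL(2, ℤ), (γ 1 0).natAbs = N → (4 : ℤ) ∣ γ 1 0 → γ ∈ H by
    intro γ hγ
    rw [CongruenceSubgroup.Gamma0_mem] at hγ
    exact h _ γ rfl ((ZMod.intCast_zmod_eq_zero_iff_dvd _ 4).mp hγ)
  intro N
  induction N using Nat.strong_induction_on with
  | _ N ih =>
    intro γ hN h4
    by_cases hc : γ 1 0 = 0
    · exact mem_of_lower_left_eq_zero hT hneg hc
    -- Descent on the lower row (c, d): a power of T gives 2|d| ≤ |c|, and a power of (1 0; 4 1)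
    -- then gives |c'| ≤ 2|d|. The first inequality is strict because d is odd and 4 divides c.
    obtain ⟨m, hm⟩ := exists_two_mul_abs_add_mul_le hc (γ 1 1)
    set d := γ 1 1 + m * γ 1 0 with hd
    have hodd : d % 2 = 1 := by
      have h1 := SL2_det γ
      obtain ⟨e, he⟩ := h4
      have h2 : γ 1 1 % 2 = 1 := by
        rcases Int.emod_two_eq_zero_or_one (γ 1 1) with h | h
        · exfalso
          obtain ⟨x, hx⟩ := Int.dvd_of_emod_eq_zero h
          rw [he, hx] at h1
          have : 2 * (γ 0 0 * x - γ 0 1 * (2 * e)) = 1 := by linarith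
          omega
        · exact h
      have h3 : m * γ 1 0 = 2 * (m * (2 * e)) := by rw [he]; ring
      omega
    have hd0 : 4 * d ≠ 0 := by omega
    have hlt : 2 * |d| < |γ 1 0| := by
      refine lt_of_le_of_ne hm fun h => ?_
      obtain ⟨e, he⟩ := h4
      rcases abs_choice d with h1 | h1 <;> rcases abs_choice (γ 1 0) with h2 | h2 <;>
        rw [h1, h2] at h <;> omega
    obtain ⟨m', hm'⟩ := exists_two_mul_abs_add_mul_le hd0 (γ 1 0)
    set δ := γ * ModularGroup.T ^ m *
      (ModularGroup.S * ModularGroup.T ^ (-4 : ℤ) * ModularGroup.S⁻¹) ^ m' with hδ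
    have e1 : δ 1 0 = γ 1 0 + m' * (4 * d) := by
      have t : ∀ i j, (ModularGroup.T ^ m) i j = !![1, m; 0, 1] i j := fun i j => by
        rw [← ModularGroup.coe_T_zpow]
      have u : ∀ i j, ((ModularGroup.S * ModularGroup.T ^ (-4 : ℤ) * ModularGroup.S⁻¹) ^ m') i j =
          !![1, 0; 4 * m', 1] i j := fun i j => by
        rw [← coe_conj_T_zpow]
      rw [hδ, SL2_coe_mul_apply, SL2_coe_mul_apply, SL2_coe_mul_apply, t, t, t, t, u, u]
      simp
      ring
    have hlt' : (δ 1 0).natAbs < N := by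
      rw [← hN, ← Int.ofNat_lt, Int.natCast_natAbs, Int.natCast_natAbs, e1]
      rw [abs_mul, show |(4 : ℤ)| = 4 from rfl] at hm'
      linarith
    have hmem := ih _ hlt' δ rfl (by
      rw [e1]; exact dvd_add h4 ⟨m' * d, by ring⟩)
    have : γ = δ * ((ModularGroup.S * ModularGroup.T ^ (-4 : ℤ) * ModularGroup.S⁻¹) ^ m')⁻¹ *
        (ModularGroup.T ^ m)⁻¹ := by
      rw [hδ]; group
    rw [this]
    exact H.mul_mem (H.mul_mem hmem (H.inv_mem (H.zpow_mem hU _))) (H.inv_mem (H.zpow_mem hT _))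

/-! ### Modularity on Γ_0(4) by comparison with theta -/

/-- The elements `γ` for which `f(γτ) = J(τ)^m f(τ)`, where `g(γτ) = J(τ) g(τ)`. -/
def automorphySubgroup (g f : ℍ → ℂ) (m : ℕ) : Subgroup SL(2, ℤ) where
  carrier := {γ | ∃ J : ℍ → ℂ, ∀ τ, J τ ≠ 0 ∧ g (γ • τ) = J τ * g τ ∧ f (γ • τ) = J τ ^ m * f τ}
  one_mem' := ⟨1, fun τ => by simp⟩
  mul_mem' := by
    rintro γ δ ⟨J, hJ⟩ ⟨K, hK⟩
    refine ⟨fun τ => J (δ • τ) * K τ, fun τ => ⟨mul_ne_zero (hJ _).1 (hK _).1, ?_, ?_⟩⟩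
    · rw [mul_smul, (hJ _).2.1, (hK _).2.1, mul_assoc]
    · rw [mul_smul, (hJ _).2.2, (hK _).2.2, mul_pow, mul_assoc]
  inv_mem' := by
    rintro γ ⟨J, hJ⟩
    refine ⟨fun τ => (J (γ⁻¹ • τ))⁻¹, fun τ => ?_⟩
    obtain ⟨h1, h2, h3⟩ := hJ (γ⁻¹ • τ)
    rw [smul_inv_smul] at h2 h3
    refine ⟨inv_ne_zero h1, ?_, ?_⟩
    · rw [h2, inv_mul_cancel_left₀ h1]
    · rw [h3, inv_pow, inv_mul_cancel_left₀ (pow_ne_zero _ h1)]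

/-- The transformation laws of a vector-valued form `(F₀, F₁)` of weight `k - 1/2` under the
generators `S` and `T`. -/
structure TransformsWeil (k : ℕ) (c : ℂ) (F : Fin 2 → ℂ → ℂ) : Prop where
  sq_const : c ^ 2 = 1 / 2
  apply_neg_inv : ∀ z : ℂ, 0 < z.im → ∀ j, F j (-z⁻¹) =
    (-I * z) ^ ((k : ℂ) - 1 / 2) * (c * (signMatrix j 0 * F 0 z + signMatrix j 1 * F 1 z))
  zero_apply_add_one : ∀ z : ℂ, 0 < z.im → F 0 (z + 1) = -I * F 0 z
  one_apply_add_one : ∀ z : ℂ, 0 < z.im → F 1 (z + 1) = F 1 z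

/-- The square of `signMatrix` is 2 and c² = 1/2, so c times this matrix is its own inverse and the
law can be solved for F(-1/z). -/
lemma transformsWeil_of_slash {k : ℕ} {c : ℂ} {F : Fin 2 → ℂ → ℂ} (hc : c ^ 2 = 1 / 2)
    (hS : ∀ z : ℂ, 0 < z.im → ∀ j, F j z = (-I * z) ^ (-((k : ℂ) - 1 / 2)) *
      (c * (signMatrix j 0 * F 0 (-z⁻¹) + signMatrix j 1 * F 1 (-z⁻¹))))
    (hT0 : ∀ z : ℂ, 0 < z.im → F 0 (z + 1) = -I * F 0 z)
    (hT1 : ∀ z : ℂ, 0 < z.im → F 1 (z + 1) = F 1 z) : TransformsWeil k c F where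
  sq_const := hc
  apply_neg_inv := fun z hz j => by
    have h0 : -I * z ≠ 0 := fun h => by simpa [h] using neg_I_mul_mem hz
    have h1 := hS z hz 0
    have h2 := hS z hz 1
    rw [h1, h2]
    have h3 : (-I * z) ^ ((k : ℂ) - 1 / 2) * (-I * z) ^ (-((k : ℂ) - 1 / 2)) = 1 := by
      rw [← cpow_add _ _ h0]; simp
    set p := (-I * z) ^ ((k : ℂ) - 1 / 2)
    set q := (-I * z) ^ (-((k : ℂ) - 1 / 2))
    have h4 : p * q * c ^ 2 = 1 / 2 := by rw [h3, hc, one_mul]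
    fin_cases j <;> simp [signMatrix]
    · linear_combination (-2 * F 0 (-z⁻¹)) * h4
    · linear_combination (-2 * F 1 (-z⁻¹)) * h4
  zero_apply_add_one := hT0
  one_apply_add_one := hT1

lemma jacobiTheta_neg_inv {z : ℂ} (hz : 0 < z.im) :
    jacobiTheta (-z⁻¹) = (-I * z) ^ (1 / 2 : ℂ) * jacobiTheta z := by
  have := jacobiTheta_S_smul ⟨z, hz⟩
  rwa [UpperHalfPlane.modular_S_smul, UpperHalfPlane.coe_mk, UpperHalfPlane.coe_mk,
    ← neg_inv] at this

lemma sqrt_cpow_pow {k : ℕ} (hk : 0 < k) (z : ℂ) :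
    (z ^ (1 / 2 : ℂ)) ^ (2 * k - 1) = z ^ ((k : ℂ) - 1 / 2) := by
  rw [← cpow_nat_mul, Nat.cast_sub (by omega)]
  congr 1
  push_cast
  ring

lemma coe_conj_T_smul (τ : ℍ) :
    (((ModularGroup.S * ModularGroup.T ^ (-4 : ℤ) * ModularGroup.S⁻¹) • τ : ℍ) : ℂ) =
      τ / (4 * τ + 1) := by
  have h := coe_conj_T_zpow 1
  rw [zpow_one] at h
  rw [UpperHalfPlane.coe_specialLinearGroup_apply, h]
  simp

/-- `f(τ) = F₀(4τ) + F₁(4τ)` transforms under `Γ₀(4)` like `θ^{2k-1}`. -/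
theorem TransformsWeil.modular {k : ℕ} (hk : 0 < k) {c : ℂ} {F : Fin 2 → ℂ → ℂ}
    (hF : TransformsWeil k c F) {f : ℍ → ℂ} (hf : ∀ τ : ℍ, f τ = F 0 (4 * τ) + F 1 (4 * τ))
    {γ : SL(2, ℤ)} (hγ : γ ∈ CongruenceSubgroup.Gamma0 4) (τ : ℍ) :
    f (γ • τ) * jacobiTheta (2 * τ) ^ (2 * k - 1) =
      jacobiTheta (2 * ((γ • τ : ℍ) : ℂ)) ^ (2 * k - 1) * f τ := by
  have key : CongruenceSubgroup.Gamma0 4 ≤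
      automorphySubgroup (fun τ => jacobiTheta (2 * τ)) f (2 * k - 1) := by
    refine Gamma0_four_le ⟨1, fun τ => ⟨one_ne_zero, ?_, ?_⟩⟩ ⟨1, fun τ => ?_⟩ ?_
    · beta_reduce
      rw [UpperHalfPlane.modular_T_smul, UpperHalfPlane.coe_vadd]
      simp only [ofReal_one, Pi.one_apply, one_mul]
      rw [mul_add, mul_one, jacobiTheta_two_add]
    · have him : 0 < (4 * (τ : ℂ)).im := by
        have := τ.im_pos; simpa using this
      have h1 : ∀ n : ℕ, 0 < (4 * (τ : ℂ) + n).im := fun n => by simpa using him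
      -- T moves 4τ by 4, and (-i)^4 = 1.
      have e : 4 * (((1 : ℝ) : ℂ) + (τ : ℂ)) = 4 * τ + (0 : ℕ) + 1 + 1 + 1 + 1 := by
        push_cast; ring
      have h2 := h1 0
      have h3 : 0 < (4 * (τ : ℂ) + (0 : ℕ) + 1).im := by simpa using him
      have h4 : 0 < (4 * (τ : ℂ) + (0 : ℕ) + 1 + 1).im := by simpa using him
      have h5 : 0 < (4 * (τ : ℂ) + (0 : ℕ) + 1 + 1 + 1).im := by simpa using him
      rw [UpperHalfPlane.modular_T_smul, hf, hf, UpperHalfPlane.coe_vadd, e,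
        hF.zero_apply_add_one _ h5, hF.zero_apply_add_one _ h4, hF.zero_apply_add_one _ h3,
        hF.zero_apply_add_one _ h2, hF.one_apply_add_one _ h5, hF.one_apply_add_one _ h4,
        hF.one_apply_add_one _ h3, hF.one_apply_add_one _ h2]
      simp only [Nat.cast_zero, add_zero, Pi.one_apply, one_pow, one_mul]
      linear_combination (F 0 (4 * τ)) * I_pow_four
    · rw [ModularGroup.SL_neg_smul]; simp
    -- This factor comes from applying inversion, translation and inversion to θ at 2τ. For f the
    -- same path runs through x = w/2, and the powers of 2 from both inversions agree on the two
    -- sides.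
    · refine ⟨fun τ => (-I * (-(2 * (τ : ℂ))⁻¹ - 2)) ^ (1 / 2 : ℂ) *
        (-I * (2 * τ)) ^ (1 / 2 : ℂ), fun τ => ?_⟩
      have hτ : (τ : ℂ) ≠ 0 := τ.ne_zero
      have hτi : 0 < (τ : ℂ).im := τ.im_pos
      have i2 : 0 < (2 * (τ : ℂ)).im := by simpa using hτi
      have i4 : 0 < (4 * (τ : ℂ)).im := by simpa using hτi
      set w : ℂ := -(2 * (τ : ℂ))⁻¹ - 2 with hw
      set x : ℂ := -(4 * (τ : ℂ))⁻¹ - 1 with hx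
      have iw : 0 < w.im := by
        have := neg_inv_im_pos i2
        rw [hw, sub_im]; simpa using this
      have ix : 0 < x.im := by
        have := neg_inv_im_pos i4
        rw [hx, sub_im]; simpa using this
      have w0 : w ≠ 0 := fun h => by simp [h] at iw
      have h1 : 4 * (τ : ℂ) + 1 ≠ 0 := fun h => by
        have := congrArg im h
        simp at this
        exact hτi.ne' this
      have eU : 2 * ((τ : ℂ) / (4 * τ + 1)) = -w⁻¹ := by
        have : w = -((4 * τ + 1) / (2 * τ)) := by rw [hw]; field_simp; ring
        rw [this, inv_neg, inv_div]; field_simp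
      have eU' : 4 * ((τ : ℂ) / (4 * τ + 1)) = -x⁻¹ := by
        have : x = -((4 * τ + 1) / (4 * τ)) := by rw [hx]; field_simp; ring
        rw [this, inv_neg, inv_div]; field_simp
      have ewx : -I * w = 2 * (-I * x) := by rw [hw, hx]; field_simp; ring
      refine ⟨mul_ne_zero ?_ ?_, ?_, ?_⟩
      · rw [cpow_ne_zero_iff_of_exponent_ne_zero (by norm_num)]
        exact mul_ne_zero (neg_ne_zero.mpr I_ne_zero) w0
      · rw [cpow_ne_zero_iff_of_exponent_ne_zero (by norm_num)]
        simpa using hτ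
      · change jacobiTheta (2 * _) = _
        have e1 : -(2 * (τ : ℂ))⁻¹ = 2 + w := by rw [hw]; ring
        have e2 : jacobiTheta w = jacobiTheta (-(2 * (τ : ℂ))⁻¹) := by rw [e1, jacobiTheta_two_add]
        rw [coe_conj_T_smul, eU, jacobiTheta_neg_inv iw, e2, jacobiTheta_neg_inv i2, mul_assoc]
      -- F_0 + F_1 at -1/x involves only F_1(x), because the first column of `signMatrix` sums to 0
      -- and the second to 2. As F_1 has period 1, a second inversion returns F_0 + F_1 with total
      -- constant 2c² = 1.
      · have hF1 : F 1 x = F 1 (-(4 * (τ : ℂ))⁻¹) := by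
          rw [← hF.one_apply_add_one x ix, hx, sub_add_cancel]
        rw [hf, hf, coe_conj_T_smul, eU', hF.apply_neg_inv x ix 0, hF.apply_neg_inv x ix 1,
          mul_pow, sqrt_cpow_pow hk, sqrt_cpow_pow hk, ewx,
          mul_cpow_of_re_pos (by norm_num) (neg_I_mul_mem ix), hF1, hF.apply_neg_inv _ i4 1,
          show -I * (4 * (τ : ℂ)) = 2 * (-I * (2 * τ)) by ring,
          mul_cpow_of_re_pos (by norm_num) (neg_I_mul_mem i2)]
        simp [signMatrix]
        linear_combination (2 * (-(I * x)) ^ ((k : ℂ) - 2⁻¹) * 2 ^ ((k : ℂ) - 2⁻¹) *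
          (-(I * (2 * τ))) ^ ((k : ℂ) - 2⁻¹) * (F 0 (4 * τ) + F 1 (4 * τ))) * hF.sq_const
  obtain ⟨J, hJ⟩ := key hγ
  obtain ⟨-, h2, h3⟩ := hJ τ
  dsimp only at h2
  rw [h2, h3]
  ring

/-! ### Translations and the decomposition modulo 4 -/

lemma expTerm_add (h : ℕ) (n : ℤ) (z w : ℂ) :
    expTerm h n (z + w) = expTerm h n z * expTerm h n w := by
  rw [expTerm, mul_add, Complex.exp_add]; rfl

lemma nonholFn_add_real (κ : ℝ) (h : ℕ) (n : ℤ) (z : ℂ) (x : ℝ) :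
    nonholFn κ h n (z + x) = nonholFn κ h n z * expTerm h n x := by
  simp [nonholFn, expTerm_add, mul_assoc]

lemma maassSeries_add_real {κ : ℝ} {h : ℕ} {a b : ℤ → ℂ} (z : ℂ) (x : ℝ) :
    maassSeries κ h a b (z + x) =
      maassSeries κ h (fun n => a n * expTerm h n x) (fun n => b n * expTerm h n x) z := by
  rw [maassSeries, maassSeries, holSeries, holSeries, nonholSeries, nonholSeries]
  congr 1 <;> refine tsum_congr fun n => ?_
  · rw [expTerm_add]; ring
  · rw [nonholFn_add_real]; ring

lemma maassSeries_const_mul (κ : ℝ) (h : ℕ) (a b : ℤ → ℂ) (q z : ℂ) :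
    maassSeries κ h (fun n => q * a n) (fun n => q * b n) z = q * maassSeries κ h a b z := by
  rw [maassSeries, maassSeries, holSeries, holSeries, nonholSeries, nonholSeries, mul_add,
    ← tsum_mul_left, ← tsum_mul_left]
  simp_rw [mul_assoc]

lemma SubExp.add {c d : ℤ → ℂ} (hc : SubExp c) (hd : SubExp d) : SubExp fun n => c n + d n := by
  intro ε hε
  obtain ⟨M, hM, hM'⟩ := hc ε hε
  obtain ⟨N, hN, hN'⟩ := hd ε hε
  refine ⟨M + N, by positivity, fun n => (norm_add_le _ _).trans ?_⟩
  rw [add_mul]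
  exact add_le_add (hM' n) (hN' n)

lemma IsCoeff.add {a b a' b' : ℤ → ℂ} (h : IsCoeff a b) (h' : IsCoeff a' b') :
    IsCoeff (fun n => a n + a' n) (fun n => b n + b' n) where
  lower := by
    obtain ⟨N, hN⟩ := h.lower
    obtain ⟨N', hN'⟩ := h'.lower
    exact ⟨min N N', fun n hn => by
      rw [hN n (hn.trans_le (min_le_left _ _)), hN' n (hn.trans_le (min_le_right _ _)), add_zero]⟩
  neg := fun n hn => by simp [h.neg n hn, h'.neg n hn]
  subExp_left := h.subExp_left.add h'.subExp_left
  subExp_right := h.subExp_right.add h'.subExp_right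

lemma IsCoeff.const_mul {a b : ℤ → ℂ} (h : IsCoeff a b) (q : ℂ) :
    IsCoeff (fun n => q * a n) (fun n => q * b n) := by
  simpa only [mul_comm q] using h.mul (subExp_of_norm_le (c := fun _ => q) fun _ => le_rfl)

lemma maassSeries_add {κ : ℝ} (hκ : 1 ≤ κ) {a b a' b' : ℤ → ℂ} (hc : IsCoeff a b)
    (hc' : IsCoeff a' b') {h : ℕ} (hh : 0 < h) {z : ℂ} (hz : 0 < z.im) :
    maassSeries κ h (fun n => a n + a' n) (fun n => b n + b' n) z =
      maassSeries κ h a b z + maassSeries κ h a' b' z := by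
  have h1 := (summable_hol hc.lower hc.subExp_left hh hz).tsum_add
    (summable_hol hc'.lower hc'.subExp_left hh hz)
  have h2 := (summable_nonholFn hκ hc.neg hc.subExp_right hh hz).tsum_add
    (summable_nonholFn hκ hc'.neg hc'.subExp_right hh hz)
  simp only [maassSeries, holSeries, nonholSeries, add_mul]
  rw [h1, h2]
  ring

lemma expTerm_four_one (n : ℤ) : expTerm 4 n 1 = I ^ n := by
  rw [expTerm, show 2 * (π : ℂ) * I * ((n : ℂ) / (4 : ℕ)) * 1 = n * (π / 2 * I) by push_cast; ring,
    Complex.exp_int_mul, exp_pi_div_two_mul_I]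

lemma component_ne_zero {c : ℤ → ℂ} {j : Fin 2} {n : ℤ} (h : component c j n ≠ 0) :
    n ≡ -(((j : ℕ) : ℤ) + 1) ^ 2 [ZMOD 4] := by
  by_contra h'
  exact h (if_neg h')

lemma I_zpow_of_modEq_three {n : ℤ} (h : n ≡ 3 [ZMOD 4]) : I ^ n = -I := by
  obtain ⟨m, hm⟩ := h.symm.dvd
  rw [show n = 4 * m + 3 by omega, zpow_add₀ I_ne_zero, zpow_mul]
  norm_num

lemma I_zpow_of_modEq_zero {n : ℤ} (h : n ≡ 0 [ZMOD 4]) : I ^ n = 1 := by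
  obtain ⟨m, hm⟩ := h.symm.dvd
  rw [show n = 4 * m by omega, zpow_mul]
  norm_num

/-- Translation by 1 multiplies the n-th term by e^{2πi n/4} = i^n, which is constant on a residue
class modulo 4: -i for n ≡ 3 and 1 for n ≡ 0. -/
lemma vecF_add_one {κ : ℝ} {a b : ℤ → ℂ} {j : Fin 2} {q : ℂ}
    (h : ∀ n : ℤ, n ≡ -(((j : ℕ) : ℤ) + 1) ^ 2 [ZMOD 4] → I ^ n = q) (z : ℂ) :
    vecF κ a b j (z + 1) = q * vecF κ a b j z := by
  have e : ∀ (c : ℤ → ℂ) (n : ℤ), component c j n * expTerm 4 n ((1 : ℝ) : ℂ) =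
      q * component c j n := fun c n => by
    by_cases h0 : component c j n = 0
    · simp [h0]
    · rw [ofReal_one, expTerm_four_one, h n (component_ne_zero h0), mul_comm]
  have := maassSeries_add_real (κ := κ) (h := 4) (a := component a j) (b := component b j) z 1
  rw [vecF, ← maassSeries_const_mul, ← ofReal_one, this]
  simp_rw [e]

lemma component_add {c : ℤ → ℂ} {n : ℤ} (h : c n ≠ 0 → n ≡ 0 [ZMOD 4] ∨ n ≡ 3 [ZMOD 4]) :
    component c 0 n + component c 1 n = c n := by
  by_cases h0 : c n = 0
  · simp [component, h0]
  rw [component, component]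
  rcases h h0 with h1 | h1 <;> rw [Int.ModEq] at h1
  · rw [if_neg, if_pos, zero_add]
    · simp [Int.ModEq, h1]
    · simp [Int.ModEq, h1]
  · rw [if_pos, if_neg, add_zero]
    · simp [Int.ModEq, h1]
    · simp [Int.ModEq, h1]

lemma plusSeries_eq_maassSeries (k : ℕ) (a b : ℤ → ℂ) (τ : ℍ) :
    plusSeries k a b τ = maassSeries ((k : ℝ) - 1 / 2) 1 a b τ := rfl

lemma plusSeries_eq_vecF {k : ℕ} (hκ : 1 ≤ (k : ℝ) - 1 / 2) {a b : ℤ → ℂ} (hc : IsCoeff a b)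
    (hplus : ∀ n : ℤ, (a n ≠ 0 ∨ b n ≠ 0) → n ≡ 0 [ZMOD 4] ∨ n ≡ 3 [ZMOD 4]) (τ : ℍ) :
    plusSeries k a b τ =
      vecF ((k : ℝ) - 1 / 2) a b 0 (4 * τ) + vecF ((k : ℝ) - 1 / 2) a b 1 (4 * τ) := by
  have hτ : 0 < (4 * (τ : ℂ)).im := by have := τ.im_pos; simpa using this
  have e : ∀ n, expTerm 4 n (4 * (τ : ℂ)) = expTerm 1 n τ := fun n => by
    rw [expTerm, expTerm]; congr 1; push_cast; ring
  have e' : ∀ n, nonholFn ((k : ℝ) - 1 / 2) 4 n (4 * (τ : ℂ)) =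
      nonholFn ((k : ℝ) - 1 / 2) 1 n τ := fun n => by
    have : -4 * π * ((n : ℝ) / (4 : ℕ)) * (4 * (τ : ℂ)).im =
        -4 * π * ((n : ℝ) / (1 : ℕ)) * (τ : ℂ).im := by
      simp; ring
    rw [nonholFn, nonholFn, e, this]
  rw [vecF, vecF, ← maassSeries_add hκ (hc.component 0) (hc.component 1) four_pos hτ,
    plusSeries_eq_maassSeries]
  simp only [maassSeries, holSeries, nonholSeries, e, e']
  congr 1 <;> refine tsum_congr fun n => ?_
  · rw [component_add fun h => hplus n (Or.inl h)]
  · rw [component_add fun h => hplus n (Or.inr h)]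

lemma transformsWeil_vecF {k : ℕ} {κ : ℝ} {c : ℂ} {a b : ℤ → ℂ} (hc : c ^ 2 = 1 / 2)
    (hS : ∀ z : ℂ, 0 < z.im → ∀ j, vecF κ a b j z = (-I * z) ^ (-((k : ℂ) - 1 / 2)) *
      (c * (signMatrix j 0 * vecF κ a b 0 (-z⁻¹) + signMatrix j 1 * vecF κ a b 1 (-z⁻¹)))) :
    TransformsWeil k c (vecF κ a b) :=
  transformsWeil_of_slash hc hS
    (fun z _ => vecF_add_one (fun n hn => I_zpow_of_modEq_three (hn.trans (by decide))) z)
    (fun z _ => by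
      rw [vecF_add_one (fun n hn => I_zpow_of_modEq_zero (hn.trans (by decide))) z, one_mul])

/-! ### The action of SL(2, ℤ) and the expansions at the cusps -/

/-- The automorphy factor `cτ + d`. -/
def autFactor (A : SL(2, ℤ)) (τ : ℍ) : ℂ := ((A 1 0 : ℤ) : ℂ) * τ + ((A 1 1 : ℤ) : ℂ)

lemma autFactor_ne_zero (A : SL(2, ℤ)) (τ : ℍ) : autFactor A τ ≠ 0 := by
  rw [autFactor, ← ModularGroup.denom_apply]
  exact UpperHalfPlane.denom_ne_zero _ τ

lemma coe_SL2_smul (A : SL(2, ℤ)) (τ : ℍ) : ((A • τ : ℍ) : ℂ) =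
    (((A 0 0 : ℤ) : ℂ) * τ + ((A 0 1 : ℤ) : ℂ)) / autFactor A τ := by
  rw [UpperHalfPlane.coe_specialLinearGroup_apply]
  simp [autFactor]

lemma autFactor_mul (A B : SL(2, ℤ)) (τ : ℍ) :
    autFactor (A * B) τ = autFactor A (B • τ) * autFactor B τ := by
  have h := autFactor_ne_zero B τ
  rw [autFactor, autFactor, SL2_coe_mul_apply, SL2_coe_mul_apply, coe_SL2_smul, add_mul,
    mul_assoc, div_mul_cancel₀ _ h, autFactor]
  push_cast
  ring

lemma continuous_autFactor_cpow (A : SL(2, ℤ)) (s : ℂ) :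
    Continuous fun τ => autFactor A τ ^ s := by
  by_cases hc : A 1 0 = 0
  · simp only [autFactor, hc, Int.cast_zero, zero_mul, zero_add]
    exact continuous_const
  have h1 : Continuous fun τ : ℍ => autFactor A τ :=
    (continuous_const.mul UpperHalfPlane.continuous_coe).add continuous_const
  refine continuous_iff_continuousAt.mpr fun τ => ?_
  refine (continuousAt_cpow_const ?_).comp h1.continuousAt
  refine Or.inr ?_
  have : (autFactor A τ).im = ((A 1 0 : ℤ) : ℝ) * (τ : ℂ).im := by simp [autFactor]
  rw [this]
  exact mul_ne_zero (by exact_mod_cast hc) τ.im_pos.ne'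

lemma continuous_SL2_smul (A : SL(2, ℤ)) : Continuous fun τ : ℍ => A • τ := by
  refine UpperHalfPlane.isEmbedding_coe.continuous_iff.mpr ?_
  have h1 : Continuous fun τ : ℍ => autFactor A τ :=
    (continuous_const.mul UpperHalfPlane.continuous_coe).add continuous_const
  have h2 : Continuous fun τ : ℍ => ((A 0 0 : ℤ) : ℂ) * (τ : ℂ) + ((A 0 1 : ℤ) : ℂ) :=
    (continuous_const.mul UpperHalfPlane.continuous_coe).add continuous_const
  exact (h2.div h1 (autFactor_ne_zero A)).congr fun τ => (coe_SL2_smul A τ).symm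

/-- Handles all branch ambiguities of half-integral powers at once: two continuous square roots on
the connected half-plane differ by a constant sign. -/
lemma exists_eq_const_mul_of_sq_eq {f g : ℍ → ℂ} (hf : Continuous f) (hg : Continuous g)
    (hg0 : ∀ τ, g τ ≠ 0) {C : ℂ} (hC : C ≠ 0) (h : ∀ τ, f τ ^ 2 = C * g τ ^ 2) :
    ∃ e : ℂ, ∀ τ, f τ = e * g τ := by
  have hs : (C ^ (1 / 2 : ℂ)) ^ 2 = C := by rw [← cpow_nat_mul]; norm_num
  have hs0 : C ^ (1 / 2 : ℂ) ≠ 0 := fun h => hC (by rw [← hs, h]; simp)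
  rcases isPreconnected_univ.eq_or_eq_neg_of_sq_eq hf.continuousOn
    (g := fun τ => C ^ (1 / 2 : ℂ) * g τ) (continuous_const.mul hg).continuousOn
    (fun τ _ => by simp only [Pi.pow_apply]; rw [mul_pow, hs, h])
    (fun _ => mul_ne_zero hs0 (hg0 _)) with h1 | h1
  · exact ⟨_, fun τ => h1 (Set.mem_univ τ)⟩
  · exact ⟨-C ^ (1 / 2 : ℂ), fun τ => by
      rw [h1 (Set.mem_univ τ)]; simp⟩

lemma cpow_sub_half_sq (k : ℕ) (z : ℂ) :
    (z ^ ((k : ℂ) - 1 / 2)) ^ 2 = z ^ (2 * (k : ℤ) - 1) := by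
  rw [← cpow_nat_mul, ← cpow_intCast]
  congr 1
  push_cast
  ring

lemma cpow_sub_half_ne_zero (k : ℕ) {z : ℂ} (hz : z ≠ 0) : z ^ ((k : ℂ) - 1 / 2) ≠ 0 :=
  fun h => zpow_ne_zero (2 * (k : ℤ) - 1) hz (by rw [← cpow_sub_half_sq k, h]; simp)

/-- A form satisfying the transformation laws for the generators transforms under every element of
`SL(2, ℤ)` by some matrix. -/
theorem TransformsWeil.exists_matrix {k : ℕ} {c : ℂ} {F : Fin 2 → ℂ → ℂ}
    (hF : TransformsWeil k c F) (A : SL(2, ℤ)) : ∃ P : Matrix (Fin 2) (Fin 2) ℂ, ∀ (τ : ℍ) j,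
      F j (A • τ : ℍ) = autFactor A τ ^ ((k : ℂ) - 1 / 2) * P.mulVec (fun l => F l τ) j := by
  have hmul : ∀ A B : SL(2, ℤ),
      (∃ P : Matrix (Fin 2) (Fin 2) ℂ, ∀ (τ : ℍ) j,
        F j (A • τ : ℍ) = autFactor A τ ^ ((k : ℂ) - 1 / 2) * P.mulVec (fun l => F l τ) j) →
      (∃ P : Matrix (Fin 2) (Fin 2) ℂ, ∀ (τ : ℍ) j,
        F j (B • τ : ℍ) = autFactor B τ ^ ((k : ℂ) - 1 / 2) * P.mulVec (fun l => F l τ) j) →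
      ∃ P : Matrix (Fin 2) (Fin 2) ℂ, ∀ (τ : ℍ) j,
        F j ((A * B) • τ : ℍ) =
          autFactor (A * B) τ ^ ((k : ℂ) - 1 / 2) * P.mulVec (fun l => F l τ) j := by
    rintro A B ⟨P, hP⟩ ⟨Q, hQ⟩
    -- The squares of the factors are integral powers, which satisfy the cocycle relation exactly;
    -- the half-integral powers satisfy it up to a constant.
    obtain ⟨e, he⟩ := exists_eq_const_mul_of_sq_eq
      (f := fun τ => autFactor A (B • τ) ^ ((k : ℂ) - 1 / 2) * autFactor B τ ^ ((k : ℂ) - 1 / 2))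
      (((continuous_autFactor_cpow A _).comp (continuous_SL2_smul B)).mul
        (continuous_autFactor_cpow B _)) (continuous_autFactor_cpow (A * B) ((k : ℂ) - 1 / 2))
      (fun τ => cpow_sub_half_ne_zero k (autFactor_ne_zero _ τ)) one_ne_zero (fun τ => by
        rw [mul_pow, cpow_sub_half_sq,
          cpow_sub_half_sq, cpow_sub_half_sq,
          autFactor_mul, mul_zpow, one_mul])
    refine ⟨e • (P * Q), fun τ j => ?_⟩
    have h1 : (fun l => F l (B • τ : ℍ)) =
        autFactor B τ ^ ((k : ℂ) - 1 / 2) • Q.mulVec fun l => F l τ := funext fun l => hQ τ l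
    rw [mul_smul, hP, h1, Matrix.mulVec_smul, Matrix.mulVec_mulVec, Matrix.smul_mulVec,
      Pi.smul_apply, Pi.smul_apply, smul_eq_mul, smul_eq_mul, ← mul_assoc, he]
    ring
  have hT : ∀ (A : SL(2, ℤ)), (∀ τ, autFactor A τ = 1) → (∃ d : Fin 2 → ℂ, ∀ (τ : ℍ) j,
      F j (A • τ : ℍ) = d j * F j τ) → ∃ P : Matrix (Fin 2) (Fin 2) ℂ, ∀ (τ : ℍ) j,
      F j (A • τ : ℍ) = autFactor A τ ^ ((k : ℂ) - 1 / 2) * P.mulVec (fun l => F l τ) j := by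
    rintro A h1 ⟨d, hd⟩
    exact ⟨Matrix.diagonal d, fun τ j => by rw [hd, h1, one_cpow, one_mul, Matrix.mulVec_diagonal]⟩
  have hSS : ∀ (A : SL(2, ℤ)) (u : ℂ), u ≠ 0 → (∀ τ : ℍ, -I * τ = u * autFactor A τ) →
      (∀ τ : ℍ, ((A • τ : ℍ) : ℂ) = -(τ : ℂ)⁻¹) → ∃ P : Matrix (Fin 2) (Fin 2) ℂ, ∀ (τ : ℍ) j,
      F j (A • τ : ℍ) = autFactor A τ ^ ((k : ℂ) - 1 / 2) * P.mulVec (fun l => F l τ) j := by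
    intro A u hu h1 h2
    obtain ⟨e, he⟩ := exists_eq_const_mul_of_sq_eq
      (f := fun τ : ℍ => (-I * τ) ^ ((k : ℂ) - 1 / 2))
      (continuous_iff_continuousAt.mpr fun τ => ContinuousAt.comp
        (f := fun τ : ℍ => -I * (τ : ℂ)) (continuousAt_cpow_const
        (Or.inl (neg_I_mul_mem τ.im_pos)))
          (continuous_const.mul UpperHalfPlane.continuous_coe).continuousAt)
      (continuous_autFactor_cpow A ((k : ℂ) - 1 / 2))
      (fun τ => cpow_sub_half_ne_zero k (autFactor_ne_zero _ τ))
      (zpow_ne_zero (2 * (k : ℤ) - 1) hu) (fun τ => by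
        rw [cpow_sub_half_sq, cpow_sub_half_sq, h1, mul_zpow])
    refine ⟨(e * c) • signMatrix, fun τ j => ?_⟩
    rw [h2, hF.apply_neg_inv _ τ.im_pos, he, Matrix.smul_mulVec, Pi.smul_apply, smul_eq_mul,
      Matrix.mulVec, dotProduct, Fin.sum_univ_two]
    ring
  have hgen : A ∈ Subgroup.closure {ModularGroup.S, ModularGroup.T} := by
    simp [SpecialLinearGroup.SL2Z_generators]
  have hbase : ∀ x ∈ ({ModularGroup.S, ModularGroup.T} : Set SL(2, ℤ)),
      (∃ P : Matrix (Fin 2) (Fin 2) ℂ, ∀ (τ : ℍ) j,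
        F j (x • τ : ℍ) = autFactor x τ ^ ((k : ℂ) - 1 / 2) * P.mulVec (fun l => F l τ) j) ∧
      ∃ P : Matrix (Fin 2) (Fin 2) ℂ, ∀ (τ : ℍ) j,
        F j (x⁻¹ • τ : ℍ) = autFactor x⁻¹ τ ^ ((k : ℂ) - 1 / 2) * P.mulVec (fun l => F l τ) j := by
    rintro x (rfl | rfl)
    · constructor
      · refine hSS _ (-I) (neg_ne_zero.mpr I_ne_zero) (fun τ => ?_) fun τ => ?_
        · simp [autFactor, ModularGroup.S]
        · rw [UpperHalfPlane.modular_S_smul, UpperHalfPlane.coe_mk, neg_inv]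
      · refine hSS _ I I_ne_zero (fun τ => ?_) fun τ => ?_
        · simp [autFactor, ModularGroup.coe_S, Matrix.SpecialLinearGroup.coe_inv,
            Matrix.adjugate_fin_two_of]
        · rw [coe_SL2_smul, autFactor, Matrix.SpecialLinearGroup.coe_inv, ModularGroup.coe_S,
            Matrix.adjugate_fin_two_of]
          simp [div_eq_mul_inv, inv_neg]
    · constructor
      · refine hT _ (fun τ => by simp [autFactor, ModularGroup.coe_T]) ⟨![-I, 1], fun τ j => ?_⟩
        rw [UpperHalfPlane.modular_T_smul, UpperHalfPlane.coe_vadd, add_comm, ofReal_one]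
        fin_cases j
        · exact hF.zero_apply_add_one _ τ.im_pos
        · exact (hF.one_apply_add_one _ τ.im_pos).trans (one_mul _).symm
      · refine hT _ (fun τ => by
          simp [autFactor, ModularGroup.coe_T, Matrix.SpecialLinearGroup.coe_inv,
            Matrix.adjugate_fin_two_of]) ⟨![I, 1], fun τ j => ?_⟩
        have h1 : (τ : ℂ) = ((ModularGroup.T⁻¹ • τ : ℍ) : ℂ) + 1 := by
          conv_lhs => rw [← smul_inv_smul ModularGroup.T τ]
          rw [UpperHalfPlane.modular_T_smul, UpperHalfPlane.coe_vadd, add_comm, ofReal_one]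
        have h2 := (ModularGroup.T⁻¹ • τ).im_pos
        rw [h1]
        fin_cases j
        · have := hF.zero_apply_add_one _ h2
          simp only [Fin.zero_eta, Matrix.cons_val_zero]
          rw [this]
          linear_combination (F 0 ((ModularGroup.T⁻¹ • τ : ℍ) : ℂ)) * I_sq
        · exact (hF.one_apply_add_one _ h2).symm.trans (one_mul _).symm
  induction hgen using Subgroup.closure_induction_left with
  | one =>
    refine hT _ (fun τ => by simp [autFactor]) ⟨1, fun τ j => by simp⟩
  | mul_left x hx y hy ih => exact hmul x y (hbase x hx).1 ih
  | inv_mul_cancel x hx y hy ih => exact hmul x⁻¹ y (hbase x hx).2 ih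

/-- The matrix (4a 4b; c d) of determinant 4 equals A (g s; 0 r). The first column of A is (4a, c)
divided by its gcd g, and a Bézout relation supplies the second column; s and r are then forced, and
gr = 4. -/
lemma exists_upper_triangular (γ : SL(2, ℤ)) : ∃ (A : SL(2, ℤ)) (g r : ℕ) (s : ℤ),
    0 < g ∧ 0 < r ∧ 4 * γ 0 0 = A 0 0 * g ∧ 4 * γ 0 1 = A 0 0 * s + A 0 1 * r ∧
      γ 1 0 = A 1 0 * g ∧ γ 1 1 = A 1 0 * s + A 1 1 * r := by
  have hdet := SL2_det γ
  set a := γ 0 0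
  set b := γ 0 1
  set c := γ 1 0
  set d := γ 1 1
  set g := Int.gcd (4 * a) c with hg
  have hg0 : 0 < g := by
    rw [hg, Int.gcd_pos_iff]
    by_contra! h
    obtain ⟨h1, h2⟩ := h
    have : a = 0 := by omega
    rw [this, h2] at hdet
    simp at hdet
  obtain ⟨x, hx⟩ := Int.gcd_dvd_left (4 * a) c
  obtain ⟨y, hy⟩ := Int.gcd_dvd_right (4 * a) c
  have hbez := Int.gcd_eq_gcd_ab (4 * a) c
  set u := Int.gcdA (4 * a) c
  set v := Int.gcdB (4 * a) c
  rw [← hg] at hx hy hbez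
  have hg0' : (0 : ℤ) < g := by exact_mod_cast hg0
  have h1 : x * u + y * v = 1 := by
    have : (g : ℤ) * (x * u + y * v) = g * 1 := by
      rw [mul_one]
      conv_rhs => rw [hbez, hx, hy]
      ring
    exact mul_left_cancel₀ hg0'.ne' this
  have h2 : (g : ℤ) * (x * d - 4 * b * y) = 4 := by
    linear_combination (-d) * hx + 4 * b * hy + 4 * hdet
  have h3 : 0 < x * d - 4 * b * y := by
    by_contra! h
    nlinarith
  refine ⟨⟨!![x, -v; y, u], by rw [Matrix.det_fin_two_of]; linarith⟩, g,
    (x * d - 4 * b * y).toNat, 4 * b * u + v * d, hg0, by omega, ?_, ?_, ?_, ?_⟩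
  · simp; linarith
  · simp only [Int.toNat_of_nonneg h3.le]
    simp
    linear_combination (-4 * b) * h1
  · simp; linarith
  · simp only [Int.toNat_of_nonneg h3.le]
    simp
    linear_combination (-d) * h1

lemma expTerm_affine {h r : ℕ} (hr : 0 < r) (g : ℕ) (s n : ℤ) (z : ℂ) :
    expTerm h n ((g * z + s) / r) = expTerm (h * r) (g * n) z * expTerm h n ((s : ℂ) / r) := by
  have : (r : ℂ) ≠ 0 := by exact_mod_cast hr.ne'
  rw [expTerm, expTerm, expTerm, ← Complex.exp_add]
  congr 1
  push_cast
  field_simp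

lemma nonholFn_affine (κ : ℝ) {h r : ℕ} (hr : 0 < r) (g : ℕ) (s n : ℤ) (z : ℂ) :
    nonholFn κ h n ((g * z + s) / r) =
      nonholFn κ (h * r) (g * n) z * expTerm h n ((s : ℂ) / r) := by
  have him : (((g : ℂ) * z + s) / r).im = g * z.im / r := by
    rw [← ofReal_natCast r, div_ofReal_im]
    simp
  have : -4 * π * ((n : ℝ) / h) * (((g : ℂ) * z + s) / r).im =
      -4 * π * (((g * n : ℤ) : ℝ) / (h * r : ℕ)) * z.im := by
    rw [him]
    push_cast
    field_simp
  rw [nonholFn, nonholFn, this, expTerm_affine hr]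
  ring

/-- Substituting `(gτ + s)/r` for the variable of an expansion of period `h` gives an expansion of
period `hr`. -/
lemma hasHarmonicExpansion_affine {κ : ℝ} (hκ : 1 ≤ κ) {a b : ℤ → ℂ} (hc : IsCoeff a b)
    {h g r : ℕ} (hh : 0 < h) (hg : 0 < g) (hr : 0 < r) (s : ℤ) :
    HasHarmonicExpansion κ (h * r)
      (Function.extend (fun n : ℤ => (g : ℤ) * n) (fun n => a n * expTerm h n ((s : ℂ) / r)) 0)
      (Function.extend (fun n : ℤ => (g : ℤ) * n) (fun n => b n * expTerm h n ((s : ℂ) / r)) 0)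
      fun τ => maassSeries κ h a b ((g * τ + s) / r) := by
  have hg' : (0 : ℤ) < g := by exact_mod_cast hg
  have hinj : Function.Injective fun n : ℤ => (g : ℤ) * n :=
    fun m n hmn => mul_left_cancel₀ hg'.ne' hmn
  -- Frequency n/h becomes gn/(hr), so the new coefficients live on the multiples of g and are zero
  -- elsewhere.
  have hout : ∀ (d : ℤ → ℂ) (t : ℤ → ℂ) (m : ℤ), m ∉ Set.range (fun n : ℤ => (g : ℤ) * n) →
      Function.extend (fun n : ℤ => (g : ℤ) * n) d 0 m * t m = 0 := fun d t m hm => by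
    rw [Function.extend_apply' _ _ _ (fun h => hm h), Pi.zero_apply, zero_mul]
  have him : ∀ τ : ℍ, 0 < (((g : ℂ) * τ + s) / r).im := fun τ => by
    rw [← ofReal_natCast r, div_ofReal_im]
    have h1 : (0 : ℝ) < r := by exact_mod_cast hr
    have h2 : (0 : ℝ) < g := by exact_mod_cast hg
    have h3 := τ.im_pos
    simp only [add_im, mul_im, natCast_re, natCast_im, zero_mul, add_zero, intCast_im]
    exact div_pos (mul_pos h2 h3) h1
  have e1 : ∀ (τ : ℍ), (fun m => Function.extend (fun n : ℤ => (g : ℤ) * n)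
      (fun n => a n * expTerm h n ((s : ℂ) / r)) 0 m * holTerm (h * r) m τ) ∘
        (fun n : ℤ => (g : ℤ) * n) = fun n => a n * expTerm h n ((g * τ + s) / r) := fun τ => by
    funext n
    simp only [Function.comp_apply]
    rw [hinj.extend_apply, expTerm_affine hr, show holTerm (h * r) (g * n) τ =
      expTerm (h * r) (g * n) τ from rfl]
    ring
  have e2 : ∀ (τ : ℍ), (fun m => Function.extend (fun n : ℤ => (g : ℤ) * n)
      (fun n => b n * expTerm h n ((s : ℂ) / r)) 0 m * nonholTerm κ (h * r) m τ) ∘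
        (fun n : ℤ => (g : ℤ) * n) = fun n => b n * nonholFn κ h n ((g * τ + s) / r) := fun τ => by
    funext n
    simp only [Function.comp_apply]
    rw [hinj.extend_apply, nonholFn_affine κ hr, show nonholTerm κ (h * r) (g * n) τ =
      nonholFn κ (h * r) (g * n) τ from rfl]
    ring
  constructor
  · obtain ⟨N, hN⟩ := hc.lower
    refine ⟨g * N, fun m hm => ?_⟩
    by_cases hr : ∃ n : ℤ, (g : ℤ) * n = m
    · obtain ⟨n, rfl⟩ := hr
      rw [hinj.extend_apply, hN n (lt_of_mul_lt_mul_left hm hg'.le), zero_mul]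
    · rw [Function.extend_apply' _ _ _ hr, Pi.zero_apply]
  · intro m hm
    by_cases hr : ∃ n : ℤ, (g : ℤ) * n = m
    · obtain ⟨n, rfl⟩ := hr
      rw [hinj.extend_apply, hc.neg n (nonneg_of_mul_nonneg_right hm hg'), zero_mul]
    · rw [Function.extend_apply' _ _ _ hr, Pi.zero_apply]
  · intro τ
    rw [← hinj.summable_iff (hout _ _), e1]
    exact summable_hol hc.lower hc.subExp_left hh (him τ)
  · intro τ
    rw [← hinj.summable_iff (hout _ _), e2]
    exact summable_nonholFn hκ hc.neg hc.subExp_right hh (him τ)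
  · intro τ
    rw [maassSeries, holSeries, nonholSeries, ← e1, ← e2]
    congr 1
    · exact hinj.tsum_eq (Function.support_subset_iff'.mpr (hout _ fun m => holTerm (h * r) m τ))
    · exact hinj.tsum_eq
        (Function.support_subset_iff'.mpr (hout _ fun m => nonholTerm κ (h * r) m τ))

lemma HasHarmonicExpansion.congr {κ : ℝ} {h : ℕ} {a b : ℤ → ℂ} {g g' : ℍ → ℂ}
    (hg : HasHarmonicExpansion κ h a b g) (e : ∀ τ, g' τ = g τ) :
    HasHarmonicExpansion κ h a b g' := by
  rwa [funext e]

lemma natCast_mul_cpow {r : ℕ} (hr : 0 < r) {z : ℂ} (hz : z ≠ 0) (s : ℂ) :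
    ((r : ℂ) * z) ^ s = (r : ℂ) ^ s * z ^ s := by
  have hr' : (0 : ℝ) < r := by exact_mod_cast hr
  have hr0 : (r : ℂ) ≠ 0 := by exact_mod_cast hr.ne'
  rw [cpow_def_of_ne_zero (mul_ne_zero hr0 hz), cpow_def_of_ne_zero hr0, cpow_def_of_ne_zero hz,
    ← Complex.exp_add, ← add_mul, ← ofReal_natCast, log_ofReal_mul hr' hz, ofReal_log hr'.le]

/-- The expansions of `f(τ) = F₀(4τ) + F₁(4τ)` at the cusps. -/
theorem TransformsWeil.cusps {k : ℕ} (hκ : 1 ≤ (k : ℝ) - 1 / 2) {a b : ℤ → ℂ} (hc : IsCoeff a b)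
    {c : ℂ} (hF : TransformsWeil k c (vecF ((k : ℝ) - 1 / 2) a b)) {f : ℍ → ℂ}
    (hf : ∀ τ : ℍ, f τ =
      vecF ((k : ℝ) - 1 / 2) a b 0 (4 * τ) + vecF ((k : ℝ) - 1 / 2) a b 1 (4 * τ))
    (γ : SL(2, ℤ)) : ∃ (h : ℕ) (a b : ℤ → ℂ), 0 < h ∧
    HasHarmonicExpansion ((k : ℝ) - 1 / 2) h a b fun τ : ℍ =>
      (((γ 1 0 : ℤ) : ℂ) * τ + ((γ 1 1 : ℤ) : ℂ)) ^ (-((k : ℂ) - 1 / 2)) * f (γ • τ) := by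
  obtain ⟨A, g, r, s, hg, hr, e1, e2, e3, e4⟩ := exists_upper_triangular γ
  obtain ⟨P, hP⟩ := hF.exists_matrix A
  -- Column sums of P, because f adds the two components; the power of r comes from cτ + d = r ·
  -- `autFactor A z` with z = (gτ + s)/r.
  set q : Fin 2 → ℂ := fun l => (r : ℂ) ^ (-((k : ℂ) - 1 / 2)) * (P 0 l + P 1 l)
  have hcc := ((hc.component 0).const_mul (q 0)).add ((hc.component 1).const_mul (q 1))
  refine ⟨4 * r, _, _, by positivity,
    (hasHarmonicExpansion_affine hκ hcc four_pos hg hr s).congr fun τ => ?_⟩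
  have hr0 : (r : ℂ) ≠ 0 := by exact_mod_cast hr.ne'
  have hz : 0 < (((g : ℂ) * τ + s) / r).im := by
    rw [← ofReal_natCast r, div_ofReal_im]
    have h1 : (0 : ℝ) < r := by exact_mod_cast hr
    have h2 : (0 : ℝ) < g := by exact_mod_cast hg
    have h3 := τ.im_pos
    simp only [add_im, mul_im, natCast_re, natCast_im, zero_mul, add_zero, intCast_im]
    exact div_pos (mul_pos h2 h3) h1
  set z : ℍ := ⟨((g : ℂ) * τ + s) / r, hz⟩ with hzd
  have hzc : (z : ℂ) = ((g : ℂ) * τ + s) / r := rfl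
  have hA := autFactor_ne_zero A z
  have e1' : 4 * ((γ 0 0 : ℤ) : ℂ) = A 0 0 * g := by exact_mod_cast e1
  have e2' : 4 * ((γ 0 1 : ℤ) : ℂ) = A 0 0 * s + A 0 1 * r := by exact_mod_cast e2
  have e3' : ((γ 1 0 : ℤ) : ℂ) = A 1 0 * g := by exact_mod_cast e3
  have e4' : ((γ 1 1 : ℤ) : ℂ) = A 1 0 * s + A 1 1 * r := by exact_mod_cast e4
  have hj : autFactor γ τ = r * autFactor A z := by
    rw [autFactor, autFactor, e3', e4', hzc]
    field_simp
    ring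
  have hs : 4 * ((γ • τ : ℍ) : ℂ) = (A • z : ℍ) := by
    rw [coe_SL2_smul, coe_SL2_smul, hj, hzc]
    field_simp
    linear_combination (τ : ℂ) * e1' + e2'
  have hcp : autFactor A z ^ (-((k : ℂ) - 1 / 2)) * autFactor A z ^ ((k : ℂ) - 1 / 2) = 1 := by
    rw [← cpow_add _ _ hA]; simp
  rw [maassSeries_add hκ ((hc.component 0).const_mul (q 0)) ((hc.component 1).const_mul (q 1))
    four_pos hz, maassSeries_const_mul, maassSeries_const_mul]
  change autFactor γ τ ^ _ * _ = q 0 * vecF _ a b 0 z + q 1 * vecF _ a b 1 z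
  rw [hf, hs, hP, hP, hj, natCast_mul_cpow hr hA]
  simp only [Matrix.mulVec, dotProduct, Fin.sum_univ_two, q]
  linear_combination ((r : ℂ) ^ (-((k : ℂ) - 1 / 2)) *
    ((P 0 0 + P 1 0) * vecF ((k : ℝ) - 1 / 2) a b 0 z +
      (P 0 1 + P 1 1) * vecF ((k : ℝ) - 1 / 2) a b 1 z)) * hcp

end KohnenPlus

end

/-! ### The converse theorem -/

theorem mainTheorem4 (k : ℕ) (hk0 : 0 < k) (hk : Even k) (n₀ : ℕ) (cp cm : ℤ → ℂ)
    (hcp : ∀ n : ℤ, n < -(n₀ : ℤ) → cp n = 0)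
    (hcm : ∀ n : ℤ, 0 ≤ n → cm n = 0)
    (hplus : ∀ n : ℤ, (cp n ≠ 0 ∨ cm n ≠ 0) → n ≡ 0 [ZMOD 4] ∨ n ≡ 3 [ZMOD 4])
    (C : ℝ) (hC : 0 < C)
    (hcpO : cp =O[Filter.cofinite] fun n : ℤ => Real.exp (C * Real.sqrt |(n : ℝ)|))
    (hcmO : cm =O[Filter.cofinite] fun n : ℤ => Real.exp (C * Real.sqrt |(n : ℝ)|))
    (S : Set (ℝ → ℂ)) (hS : KohnenPlus.IsTestFamily S)
    (hL : ∀ φ ∈ S, KohnenPlus.LSeriesF ((k : ℝ) - 1 / 2) cp cm φ =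
      Complex.I ^ ((k : ℂ) - 1 / 2) •
        KohnenPlus.weilS'Conj.mulVec (KohnenPlus.LSeriesF ((k : ℝ) - 1 / 2) cp cm
          (KohnenPlus.slashS (2 - ((k : ℝ) - 1 / 2))
            (KohnenPlus.chiEta ModularGroup.S) φ)))
    (hLδ : ∀ φ ∈ S, KohnenPlus.LSeriesDeltaF ((k : ℝ) - 1 / 2) cp cm φ =
      -(Complex.I ^ ((k : ℂ) - 1 / 2) •
        KohnenPlus.weilS'Conj.mulVec (KohnenPlus.LSeriesDeltaF ((k : ℝ) - 1 / 2) cp cm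
          (KohnenPlus.slashS (2 - ((k : ℝ) - 1 / 2))
            (KohnenPlus.chiEta ModularGroup.S) φ)))) :
    KohnenPlus.IsHarmonicMaassPlus k (KohnenPlus.plusSeries k cp cm) := by
  -- A positive even k is at least 2; the bounds on the nonholomorphic terms use 1 - κ ≤ 0.
  have hκ : 1 ≤ (k : ℝ) - 1 / 2 := by
    have : (2 : ℝ) ≤ k := by
      obtain ⟨m, hm⟩ := hk
      exact_mod_cast (by omega : 2 ≤ k)
    linarith
  have hc : KohnenPlus.IsCoeff cp cm := ⟨⟨_, hcp⟩, hcm, KohnenPlus.subExp_of_isBigO hcpO,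
    KohnenPlus.subExp_of_isBigO hcmO⟩
  obtain ⟨c, hc2, hslash⟩ := KohnenPlus.vecF_transform hk0 hk hc hS hL hLδ
  have hF := KohnenPlus.transformsWeil_vecF hc2 hslash
  have hf := KohnenPlus.plusSeries_eq_vecF hκ hc hplus
  have hcoe : ∀ z : ℂ, 0 < z.im →
      KohnenPlus.plusSeries k cp cm ∘ UpperHalfPlane.ofComplex =ᶠ[nhds z]
        KohnenPlus.maassSeries ((k : ℝ) - 1 / 2) 1 cp cm := fun z hz => by
    filter_upwards [KohnenPlus.isOpen_im_pos.mem_nhds hz] with w hw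
    rw [Function.comp_apply, UpperHalfPlane.ofComplex_apply_of_im_pos hw]
    rfl
  exact
    { analytic := fun z hz =>
        (KohnenPlus.analyticAt_maassSeries hκ hc one_pos hz).congr (hcoe z hz).symm
      modular := fun γ hγ τ => hF.modular hk0 hf hγ τ
      harmonic := fun z hz => KohnenPlus.hypLaplacian_eq_zero
        (KohnenPlus.differentiableOn_holSeries_shadow hκ hc.neg hc.subExp_right one_pos)
        (fun w hw => ⟨_, (KohnenPlus.hasWirt_maassSeries hκ hc one_pos hw).congr (hcoe w hw)⟩) hz
      plus := ⟨cp, cm, ⟨hc.lower, hc.neg,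
        fun τ => KohnenPlus.summable_hol hc.lower hc.subExp_left one_pos τ.im_pos,
        fun τ => KohnenPlus.summable_nonholFn hκ hc.neg hc.subExp_right one_pos τ.im_pos,
        fun _ => rfl⟩, hplus⟩
      cusps := hF.cusps hκ hc hf }
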